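/- Let $\mathfrak G$ be the complex Lie algebra with basis $\mathbf 1,\beta_n,\gamma_n$ $(n\in\mathbb Z)$, in which $\mathbf 1$ is central, $[\gamma_m,\beta_n]=\delta_{m+n,0}\mathbf 1$ and $[\beta_m,\beta_n]=[\gamma_m,\gamma_n]=0$ (the mode algebra of the rank one bosonic ghost vertex algebra). All $\mathfrak G$-modules are complex, and $\mathbf 1$ acts on them as the identity. A module is smooth if every vector is annihilated by $\beta_n$ and $\gamma_n$ for all sufficiently large $n$; on a smooth module let $J_0=\gamma_0\beta_0+\sum_{n\ge 1}(\beta_{-n}\gamma_n+\gamma_{-n}\beta_n)$. A weight module is a smooth module on which $J_0$ acts semisimply (i.e. diagonalisably). For $\ell\in\mathbb Z$ the spectral flow twist $\sigma^\ell M$ of a module $M$ is the same vector space, on which $\beta_n$ and $\gamma_n$ act as $\beta_{n+\ell}$ and $\gamma_{n-\ell}$ act on $M$. Let $\mathscr R$ be the class of finitely generated weight modules $M$ such that, for every $m\in M$, the space $U(\mathfrak G^+)m$ is finite dimensional, where $\mathfrak G^+=\operatorname{span}\{\beta_n,\gamma_n : n\ge 1\}$. Let $\mathscr F$ be the category of all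 weight modules whose $J_0$-weights are real and which are obtained by finitely many successive extensions from modules of the form $\sigma^\ell M$ with $\ell\in\mathbb Z$, $M\in\mathscr R$; its morphisms are all $\mathfrak G$-module homomorphisms. For $X,Y\in\mathscr F$ let $\operatorname{Ext}^1(X,Y)$ be the complex vector space, under the Baer sum, of equivalence classes of short exact sequences $0\to Y\to E\to X\to 0$ in $\mathscr F$. A module $N$ over the Weyl algebra $\mathbb C\langle p,q\rangle/(pq-qp-1)$ induces a $\mathfrak G$-module in which $\beta_n,\gamma_n$ $(n\ge1)$ annihilate $N$, $\beta_0,\gamma_0$ act on $N$ as $-p,q$, and the modes $\beta_{-n},\gamma_{-n}$ $(n\geq 1)$ act freely. Let $\mathcal V$ (the vacuum module) be induced from $\mathbb C[x]$ and, for $\lambda\in\mathbb R/\mathbb Z$ with $\lambda\ne\mathbb Z$, let $\mathcal W_\lambda$ be induced from $\mathbb C[x,x^{-1}]x^{\mu}$ with $\mu\in\lambda$ (up to isomorphism this does not depend on the choice of $\mu$); in both cases $p$ acts as $\partial/\partial x$ and $q$ as multiplication by $x$. Then $\sigma^k\mathcal V$ and $\sigma^k\mathcal W_\lambda$ are objects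 of $\mathscr F$ and, for all $k,\ell\in\mathbb Z$ and all $\lambda\in\mathbb R/\mathbb Z$, $\lambda\neq\mathbb Z$, $$\dim\operatorname{Ext}^1(\sigma^k\mathcal V,\sigma^\ell\mathcal V)=\begin{cases}1,&|k-\ell|=1,\\0,&\text{otherwise},\end{cases}\qquad \dim\operatorname{Ext}^1(\sigma^k\mathcal W_\lambda,M)=\dim\operatorname{Ext}^1(M,\sigma^k\mathcal W_\lambda)=0$$ for every module $M$ in $\mathscr F$. In particular, the modules $\sigma^k\mathcal W_\lambda$ are both projective and injective in $\mathscr F$. -/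

import Mathlib

open CategoryTheory
open scoped TensorProduct ModuleCat

namespace BosonicGhost

noncomputable section

/-! ### The algebra of modes -/

/-- The modes `β_n` and `γ_n`, `n ∈ ℤ`, of the two generating fields. -/
inductive Mode : Type
  | beta (n : ℤ)
  | gamma (n : ℤ)

/-- The commutation relations of the modes, the central element being set equal to `1`. -/
inductive ModeRel : FreeAlgebra ℂ Mode → FreeAlgebra ℂ Mode → Prop
  | gamma_beta (m n : ℤ) : ModeRel
      (FreeAlgebra.ι ℂ (.gamma m) * FreeAlgebra.ι ℂ (.beta n))
      (FreeAlgebra.ι ℂ (.beta n) * FreeAlgebra.ι ℂ (.gamma m) + if m + n = 0 then 1 else 0)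
  | beta_beta (m n : ℤ) : ModeRel
      (FreeAlgebra.ι ℂ (.beta m) * FreeAlgebra.ι ℂ (.beta n))
      (FreeAlgebra.ι ℂ (.beta n) * FreeAlgebra.ι ℂ (.beta m))
  | gamma_gamma (m n : ℤ) : ModeRel
      (FreeAlgebra.ι ℂ (.gamma m) * FreeAlgebra.ι ℂ (.gamma n))
      (FreeAlgebra.ι ℂ (.gamma n) * FreeAlgebra.ι ℂ (.gamma m))

/-- The associative algebra generated by the modes, that is, the universal enveloping algebra of
the bosonic ghost Lie algebra modulo the identification of its central element with `1`. Its
modules are exactly the modules over the ghost Lie algebra on which the central element acts as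
the identity. -/
def Ghost : Type := RingQuot ModeRel

instance : Ring Ghost := inferInstanceAs (Ring (RingQuot ModeRel))

instance : Algebra ℂ Ghost := inferInstanceAs (Algebra ℂ (RingQuot ModeRel))

/-- The mode `β_n`. -/
def beta (n : ℤ) : Ghost := RingQuot.mkAlgHom ℂ ModeRel (FreeAlgebra.ι ℂ (.beta n))

/-- The mode `γ_n`. -/
def gamma (n : ℤ) : Ghost := RingQuot.mkAlgHom ℂ ModeRel (FreeAlgebra.ι ℂ (.gamma n))

theorem gamma_mul_beta (m n : ℤ) :
    gamma m * beta n = beta n * gamma m + if m + n = 0 then 1 else 0 := by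
  have h := RingQuot.mkAlgHom_rel ℂ (ModeRel.gamma_beta m n)
  rw [map_mul, map_add, map_mul] at h
  refine h.trans ?_
  congr 1
  split_ifs
  · exact map_one _
  · exact map_zero _

theorem beta_mul_beta (m n : ℤ) : beta m * beta n = beta n * beta m := by
  have h := RingQuot.mkAlgHom_rel ℂ (ModeRel.beta_beta m n)
  rw [map_mul, map_mul] at h
  exact h

theorem gamma_mul_gamma (m n : ℤ) : gamma m * gamma n = gamma n * gamma m := by
  have h := RingQuot.mkAlgHom_rel ℂ (ModeRel.gamma_gamma m n)
  rw [map_mul, map_mul] at h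
  exact h

/-- The universal property: operators satisfying the commutation relations define an algebra
homomorphism. -/
def liftModes {A : Type*} [Ring A] [Algebra ℂ A] (b c : ℤ → A)
    (hcb : ∀ m n, c m * b n = b n * c m + if m + n = 0 then 1 else 0)
    (hbb : ∀ m n, b m * b n = b n * b m) (hcc : ∀ m n, c m * c n = c n * c m) :
    Ghost →ₐ[ℂ] A :=
  RingQuot.liftAlgHom ℂ ⟨FreeAlgebra.lift ℂ (fun x => match x with
    | .beta n => b n
    | .gamma n => c n), by
      intro x y h
      cases h with
      | gamma_beta m n =>
        simp only [map_mul, map_add, FreeAlgebra.lift_ι_apply, hcb]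
        split_ifs <;> simp
      | beta_beta m n => simp only [map_mul, FreeAlgebra.lift_ι_apply, hbb m n]
      | gamma_gamma m n => simp only [map_mul, FreeAlgebra.lift_ι_apply, hcc m n]⟩

section

variable {A : Type*} [Ring A] [Algebra ℂ A] (b c : ℤ → A)
    (hcb : ∀ m n, c m * b n = b n * c m + if m + n = 0 then 1 else 0)
    (hbb : ∀ m n, b m * b n = b n * b m) (hcc : ∀ m n, c m * c n = c n * c m)

theorem liftModes_beta (n : ℤ) : liftModes b c hcb hbb hcc (beta n) = b n := by
  refine (RingQuot.liftAlgHom_mkAlgHom_apply ℂ _ _ _).trans ?_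
  rw [FreeAlgebra.lift_ι_apply]

theorem liftModes_gamma (n : ℤ) : liftModes b c hcb hbb hcc (gamma n) = c n := by
  refine (RingQuot.liftAlgHom_mkAlgHom_apply ℂ _ _ _).trans ?_
  rw [FreeAlgebra.lift_ι_apply]

end

/-- The spectral flow automorphism `σ^ℓ`, with `σ^ℓ β_n = β_{n-ℓ}` and `σ^ℓ γ_n = γ_{n+ℓ}`. -/
def spectralFlow (l : ℤ) : Ghost →ₐ[ℂ] Ghost :=
  liftModes (fun n => beta (n - l)) (fun n => gamma (n + l))
    (fun m n => by
      have h : m + l + (n - l) = m + n := by ring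
      simp only [gamma_mul_beta, h])
    (fun _ _ => beta_mul_beta _ _) (fun _ _ => gamma_mul_gamma _ _)

/-- The twist `σ^ℓ M` of a module `M`: the same vector space, on which `a` acts as `σ^{-ℓ}(a)`
acts on `M`. -/
def flow (l : ℤ) (M : ModuleCat.{0} Ghost) : ModuleCat.{0} Ghost :=
  (ModuleCat.restrictScalars (spectralFlow (-l)).toRingHom).obj M

/-! ### Module categories -/

section Conditions

variable (M : Type) [AddCommGroup M] [Module Ghost M]

/-- Smooth (weak) modules: every vector is annihilated by all modes of sufficiently large index. -/
def Smooth : Prop :=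
  ∀ v : M, ∃ N : ℤ, ∀ n, N ≤ n → beta n • v = 0 ∧ gamma n • v = 0

variable {M}

/-- The summand with index `n + 1` in `J_0`. -/
def jTerm (n : ℕ) (v : M) : M :=
  beta (-(n + 1 : ℤ)) • gamma (n + 1 : ℤ) • v + gamma (-(n + 1 : ℤ)) • beta (n + 1 : ℤ) • v

theorem Smooth.finite_jTerm (h : Smooth M) (v : M) :
    (Function.support fun n : ℕ => jTerm n v).Finite := by
  obtain ⟨N, hN⟩ := h v
  refine (Set.finite_lt_nat N.toNat).subset fun n hn => ?_
  by_contra hlt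
  simp only [Set.mem_ofPred_eq, not_lt, Int.toNat_le] at hlt
  obtain ⟨h1, h2⟩ := hN (n + 1) (by omega)
  exact hn (by simp [jTerm, h1, h2])

variable [Module ℂ M] [IsScalarTower ℂ Ghost M]

/-- The zero mode `J_0 = γ_0 β_0 + ∑_{n ≥ 1} (β_{-n} γ_n + γ_{-n} β_n)` of the field
`J(z) = :β(z) γ(z):`. On every vector of a smooth module only finitely many summands are
non-zero. -/
def J0 (h : Smooth M) : M →ₗ[ℂ] M where
  toFun v := gamma 0 • beta 0 • v + ∑ᶠ n : ℕ, jTerm n v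
  map_add' v w := by
    have : ∀ n : ℕ, jTerm n (v + w) = jTerm n v + jTerm n w := fun n => by
      simp only [jTerm, smul_add]; abel
    simp only [this, smul_add, finsum_add_distrib (h.finite_jTerm v) (h.finite_jTerm w)]
    abel
  map_smul' c v := by
    have hc : ∀ (a : Ghost) (w : M), a • c • w = c • a • w := fun a w => by
      rw [← algebraMap_smul Ghost c w, ← algebraMap_smul Ghost c (a • w), smul_smul, smul_smul,
        Algebra.commutes]
    have : ∀ n : ℕ, jTerm n (c • v) = c • jTerm n v := fun n => by
      simp only [jTerm, hc, smul_add]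
    simp only [this, hc, smul_add, RingHom.id_apply, smul_finsum' c (h.finite_jTerm v)]

variable (M)

/-- Smooth weight modules: smooth modules on which `J_0` acts semisimply. -/
structure IsWeightModule : Prop where
  smooth : Smooth M
  semisimple : ⨆ j : ℂ, Module.End.eigenspace (J0 smooth) j = ⊤

/-- All `J_0`-weights are real. -/
def HasRealWeights : Prop :=
  ∃ h : Smooth M, ∀ j : ℂ, Module.End.HasEigenvalue (J0 h) j → j.im = 0

/-- The image of the universal enveloping algebra of the span of all `β_n` and `γ_n`
with `n ≥ 1`. -/
def positiveModes : Subalgebra ℂ Ghost :=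
  Algebra.adjoin ℂ ({x | ∃ n : ℤ, 1 ≤ n ∧ x = beta n} ∪ {x | ∃ n : ℤ, 1 ≤ n ∧ x = gamma n})

/-- The category `R`: finitely generated smooth weight modules on which the positive modes act
locally nilpotently, in the sense that every vector generates a finite-dimensional space under
the positive modes. -/
structure IsR : Prop extends IsWeightModule M where
  finite : Module.Finite Ghost M
  nilpotent : ∀ v : M, FiniteDimensional ℂ
    ((Subalgebra.toSubmodule positiveModes).map ((LinearMap.toSpanSingleton Ghost M v).restrictScalars ℂ))

end Conditions

/-- Modules obtained from spectral flow twists of modules in `R` by finitely many extensions. -/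
inductive IsIteratedExtension : ModuleCat.{0} Ghost → Prop
  | flow (l : ℤ) (M : ModuleCat.{0} Ghost) (hM : IsR M) : IsIteratedExtension (flow l M)
  | extension {L M N : ModuleCat.{0} Ghost} (f : L →ₗ[Ghost] M) (g : M →ₗ[Ghost] N)
      (hf : Function.Injective f) (hfg : Function.Exact f g) (hg : Function.Surjective g)
      (hL : IsIteratedExtension L) (hN : IsIteratedExtension N) : IsIteratedExtension M

/-- The objects of the category `F`: smooth weight modules with real `J_0`-weights that are finite
iterated extensions of spectral flow twists of modules in `R`. -/
def IsF : ObjectProperty (ModuleCat.{0} Ghost) := fun M =>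
  IsWeightModule M ∧ HasRealWeights M ∧ IsIteratedExtension M

/-- The category `F`, a full subcategory of the category of all modules. -/
abbrev CatF := IsF.FullSubcategory

/-! ### Closure properties of the conditions -/

section Closure

variable {M N : Type} [AddCommGroup M] [Module Ghost M] [AddCommGroup N] [Module Ghost N]

theorem Smooth.of_injective (f : M →ₗ[Ghost] N) (hf : Function.Injective f) (hN : Smooth N) :
    Smooth M := fun v => by
  obtain ⟨K, hK⟩ := hN (f v)
  refine ⟨K, fun n hn => ⟨hf ?_, hf ?_⟩⟩
  · rw [map_smul, map_zero, (hK n hn).1]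
  · rw [map_smul, map_zero, (hK n hn).2]

theorem Smooth.of_surjective (f : M →ₗ[Ghost] N) (hf : Function.Surjective f) (hM : Smooth M) :
    Smooth N := fun w => by
  obtain ⟨v, rfl⟩ := hf w
  obtain ⟨K, hK⟩ := hM v
  refine ⟨K, fun n hn => ⟨?_, ?_⟩⟩
  · rw [← map_smul, (hK n hn).1, map_zero]
  · rw [← map_smul, (hK n hn).2, map_zero]

theorem Smooth.prod (hM : Smooth M) (hN : Smooth N) : Smooth (M × N) := fun v => by
  obtain ⟨K, hK⟩ := hM v.1
  obtain ⟨L, hL⟩ := hN v.2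
  refine ⟨max K L, fun n hn => ⟨?_, ?_⟩⟩
  · exact Prod.ext (hK n (le_trans (le_max_left _ _) hn)).1 (hL n (le_trans (le_max_right _ _) hn)).1
  · exact Prod.ext (hK n (le_trans (le_max_left _ _) hn)).2 (hL n (le_trans (le_max_right _ _) hn)).2

variable [Module ℂ M] [IsScalarTower ℂ Ghost M] [Module ℂ N] [IsScalarTower ℂ Ghost N]

theorem map_complex_smul (f : M →ₗ[Ghost] N) (c : ℂ) (v : M) : f (c • v) = c • f v := by
  rw [← algebraMap_smul Ghost c v, map_smul, algebraMap_smul]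

/-- A homomorphism of modules, viewed as a linear map over `ℂ`. -/
def toC (f : M →ₗ[Ghost] N) : M →ₗ[ℂ] N where
  toFun := f
  map_add' := map_add f
  map_smul' := map_complex_smul f

theorem toC_apply (f : M →ₗ[Ghost] N) (v : M) : toC f v = f v := rfl

theorem map_J0 (hM : Smooth M) (hN : Smooth N) (f : M →ₗ[Ghost] N) (v : M) :
    f (J0 hM v) = J0 hN (f v) := by
  have hj : ∀ n : ℕ, jTerm n (f v) = f (jTerm n v) := fun n => by simp [jTerm]
  have hs := f.toAddMonoidHom.map_finsum (hM.finite_jTerm v)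
  simp only [LinearMap.toAddMonoidHom_coe] at hs
  simp only [J0, LinearMap.coe_mk, AddHom.coe_mk, map_add, map_smul, hs, hj]

/-- Homomorphisms send weight vectors to weight vectors. -/
theorem map_mem_weights (hM : Smooth M) (hN : Smooth N) (f : M →ₗ[Ghost] N) {v : M}
    (hv : v ∈ ⨆ j : ℂ, Module.End.eigenspace (J0 hM) j) :
    f v ∈ ⨆ j : ℂ, Module.End.eigenspace (J0 hN) j := by
  have : (⨆ j : ℂ, Module.End.eigenspace (J0 hM) j) ≤
      (⨆ j : ℂ, Module.End.eigenspace (J0 hN) j).comap (toC f) := by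
    refine iSup_le fun j w hw => ?_
    rw [Module.End.mem_eigenspace_iff] at hw
    refine Submodule.mem_iSup_of_mem j ?_
    rw [Module.End.mem_eigenspace_iff, toC_apply, ← map_J0 hM hN, hw, map_complex_smul]
  exact this hv

theorem IsWeightModule.of_surjective (f : M →ₗ[Ghost] N) (hf : Function.Surjective f)
    (hM : IsWeightModule M) : IsWeightModule N where
  smooth := hM.smooth.of_surjective f hf
  semisimple := by
    refine eq_top_iff.2 fun w _ => ?_
    obtain ⟨v, rfl⟩ := hf w
    exact map_mem_weights hM.smooth _ f (hM.semisimple ▸ Submodule.mem_top)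

theorem IsWeightModule.prod (hM : IsWeightModule M) (hN : IsWeightModule N) :
    IsWeightModule (M × N) where
  smooth := hM.smooth.prod hN.smooth
  semisimple := by
    refine eq_top_iff.2 fun w _ => ?_
    have h1 := map_mem_weights hM.smooth (hM.smooth.prod hN.smooth) (LinearMap.inl Ghost M N)
      (v := w.1) (hM.semisimple ▸ Submodule.mem_top)
    have h2 := map_mem_weights hN.smooth (hM.smooth.prod hN.smooth) (LinearMap.inr Ghost M N)
      (v := w.2) (hN.semisimple ▸ Submodule.mem_top)
    have h := Submodule.add_mem _ h1 h2
    simpa using h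

theorem IsWeightModule.of_injective (f : M →ₗ[Ghost] N) (hf : Function.Injective f)
    (hN : IsWeightModule N) : IsWeightModule M where
  smooth := hN.smooth.of_injective f hf
  semisimple := by
    classical
    have hM : Smooth M := hN.smooth.of_injective f hf
    refine eq_top_iff.2 fun v _ => ?_
    have hv : f v ∈ ⨆ j : ℂ, Module.End.eigenspace (J0 hN.smooth) j :=
      hN.semisimple ▸ Submodule.mem_top
    rw [Submodule.mem_iSup_iff_exists_finsupp] at hv
    obtain ⟨w, hw, hsum⟩ := hv
    -- the component of weight `j` is a polynomial in `J_0` applied to the vector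
    have hpoly : ∀ (p : Polynomial ℂ) (u : M),
        f (Polynomial.aeval (J0 hM) p u) = Polynomial.aeval (J0 hN.smooth) p (f u) := by
      intro p u
      induction p using Polynomial.induction_on' with
      | add p q hp hq => simp only [map_add, LinearMap.add_apply, hp, hq]
      | monomial n a =>
        have hpow : ∀ n : ℕ, f ((J0 hM ^ n) u) = (J0 hN.smooth ^ n) (f u) := by
          intro n
          induction n with
          | zero => rfl
          | succ k ih =>
            rw [pow_succ', pow_succ', Module.End.mul_apply, Module.End.mul_apply, ← ih,
              map_J0 hM hN.smooth]
        simp only [Polynomial.aeval_monomial, Module.End.mul_apply,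
          Module.algebraMap_end_apply, map_complex_smul, hpow]
    have hcomp : ∀ i ∈ w.support,
        f (Polynomial.aeval (J0 hM) (Lagrange.basis w.support id i) v) = w i := by
      intro i hi
      rw [hpoly, ← hsum, Finsupp.sum, map_sum, Finset.sum_eq_single i]
      · have := Module.End.aeval_apply_of_hasEigenvector
          (f := J0 hN.smooth) (p := Lagrange.basis w.support id i) (μ := i) (x := w i)
          ⟨hw i, Finsupp.mem_support_iff.1 hi⟩
        rw [this]
        have h1 := Lagrange.eval_basis_self (s := w.support) (v := id) (i := i)
          Function.injective_id.injOn hi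
        simp only [id] at h1
        rw [h1, one_smul]
      · intro k hk hki
        have := Module.End.aeval_apply_of_hasEigenvector
          (f := J0 hN.smooth) (p := Lagrange.basis w.support id i) (μ := k) (x := w k)
          ⟨hw k, Finsupp.mem_support_iff.1 hk⟩
        rw [this]
        have h1 := Lagrange.eval_basis_of_ne (s := w.support) (v := id) hki.symm hk
        simp only [id] at h1
        rw [h1, zero_smul]
      · exact fun h => absurd hi h
    have hvsum : v = ∑ i ∈ w.support,
        Polynomial.aeval (J0 hM) (Lagrange.basis w.support id i) v := by
      apply hf
      rw [map_sum, ← hsum, Finsupp.sum]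
      exact (Finset.sum_congr rfl hcomp).symm
    rw [hvsum]
    refine Submodule.sum_mem _ fun i hi => Submodule.mem_iSup_of_mem i ?_
    rw [Module.End.mem_eigenspace_iff]
    apply hf
    have := hw i
    rw [Module.End.mem_eigenspace_iff] at this
    rw [map_J0 hM hN.smooth, map_complex_smul, hcomp i hi, this]

end Closure

/-- An extension of two objects of `F` is an object of `F` as soon as it is a smooth weight
module. -/
theorem isF_of_exact {L M N : ModuleCat.{0} Ghost} (f : L →ₗ[Ghost] M) (g : M →ₗ[Ghost] N)
    (hf : Function.Injective f) (hfg : Function.Exact f g) (hg : Function.Surjective g)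
    (hL : IsF L) (hN : IsF N) (hM : IsWeightModule M) : IsF M := by
  refine ⟨hM, ⟨hM.smooth, fun j hj => ?_⟩, .extension f g hf hfg hg hL.2.2 hN.2.2⟩
  obtain ⟨hLs, hLr⟩ := hL.2.1
  obtain ⟨hNs, hNr⟩ := hN.2.1
  obtain ⟨v, hv⟩ := hj.exists_hasEigenvector
  have hJ := hv.apply_eq_smul
  by_cases h0 : g v = 0
  · obtain ⟨u, rfl⟩ := (hfg v).1 h0
    refine hLr j (Module.End.hasEigenvalue_of_hasEigenvector (x := u) ⟨?_, ?_⟩)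
    · rw [Module.End.mem_eigenspace_iff]
      apply hf
      rw [map_J0 hLs hM.smooth, hJ, map_complex_smul]
    · rintro rfl
      exact hv.2 (map_zero f)
  · refine hNr j (Module.End.hasEigenvalue_of_hasEigenvector (x := g v) ⟨?_, h0⟩)
    rw [Module.End.mem_eigenspace_iff, ← map_J0 hM.smooth hNs, hJ, map_complex_smul]

/-! ### The first extension groups of the category `F` -/

/-- Short exact sequences `0 ⟶ Y ⟶ E ⟶ X ⟶ 0` in the category `F`. -/
structure Extn (X Y : CatF) : Type 1 where
  E : CatF
  i : Y.obj →ₗ[Ghost] E.obj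
  p : E.obj →ₗ[Ghost] X.obj
  injective : Function.Injective i
  exact : Function.Exact i p
  surjective : Function.Surjective p

namespace Extn

variable {X Y : CatF}

/-- Equivalence of extensions: an isomorphism of the middle terms which is compatible with the
identities of `X` and `Y`. -/
def Equivalent (e e' : Extn X Y) : Prop :=
  ∃ φ : e.E.obj ≃ₗ[Ghost] e'.E.obj, (∀ y, φ (e.i y) = e'.i y) ∧ ∀ v, e'.p (φ v) = e.p v

instance setoid (X Y : CatF) : Setoid (Extn X Y) where
  r := Equivalent
  iseqv :=
    { refl := fun e => ⟨LinearEquiv.refl _ _, fun _ => rfl, fun _ => rfl⟩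
      symm := by
        rintro e e' ⟨φ, h1, h2⟩
        refine ⟨φ.symm, fun y => ?_, fun v => ?_⟩
        · rw [← h1, φ.symm_apply_apply]
        · rw [← h2, φ.apply_symm_apply]
      trans := by
        rintro e e' e'' ⟨φ, h1, h2⟩ ⟨ψ, h3, h4⟩
        refine ⟨φ.trans ψ, fun y => ?_, fun v => ?_⟩
        · rw [LinearEquiv.trans_apply, h1, h3]
        · rw [LinearEquiv.trans_apply, h4, h2] }

/-- The split extension `Y × X`. -/
def split (X Y : CatF) : Extn X Y where
  E := ⟨ModuleCat.of Ghost (Y.obj × X.obj),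
    isF_of_exact (M := ModuleCat.of Ghost (Y.obj × X.obj))
      (LinearMap.inl Ghost Y.obj X.obj) (LinearMap.snd Ghost Y.obj X.obj)
      LinearMap.inl_injective .inl_snd LinearMap.snd_surjective Y.property X.property
      ((Y.property.1.prod X.property.1).of_surjective
        (N := ModuleCat.of Ghost (Y.obj × X.obj)) LinearMap.id Function.surjective_id)⟩
  i := LinearMap.inl Ghost Y.obj X.obj
  p := LinearMap.snd Ghost Y.obj X.obj
  injective := LinearMap.inl_injective
  exact := .inl_snd
  surjective := LinearMap.snd_surjective

section Baer

variable (e e' : Extn X Y)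

/-- The fibre product of the middle terms over `X`. -/
def fibre : Submodule Ghost (e.E.obj × e'.E.obj) :=
  LinearMap.eqLocus (e.p ∘ₗ LinearMap.fst Ghost _ _) (e'.p ∘ₗ LinearMap.snd Ghost _ _)

theorem mem_fibre (v : e.E.obj × e'.E.obj) : v ∈ fibre e e' ↔ e.p v.1 = e'.p v.2 := Iff.rfl

theorem p_i (y : Y.obj) : e.p (e.i y) = 0 := (e.exact _).2 ⟨y, rfl⟩

/-- The antidiagonal embedding `y ↦ (y, -y)` of `Y` into the fibre product. -/
def antidiagonal : Y.obj →ₗ[Ghost] fibre e e' :=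
  (e.i.prod (-e'.i)).codRestrict _ fun y => by
    simp [mem_fibre, p_i]

/-- The middle term of the Baer sum. -/
abbrev BaerObj : Type := fibre e e' ⧸ LinearMap.range (antidiagonal e e')

/-- The inclusion of `Y` into the Baer sum, `y ↦ [(y, 0)] = [(0, y)]`. -/
def baerI : Y.obj →ₗ[Ghost] BaerObj e e' :=
  (LinearMap.range (antidiagonal e e')).mkQ ∘ₗ
    (e.i.prod 0).codRestrict (fibre e e') fun y => by simp [mem_fibre, p_i]

/-- The projection of the Baer sum onto `X`. -/
def baerP : BaerObj e e' →ₗ[Ghost] X.obj :=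
  (LinearMap.range (antidiagonal e e')).liftQ
    (e.p ∘ₗ LinearMap.fst Ghost _ _ ∘ₗ (fibre e e').subtype) (by
      rintro _ ⟨y, rfl⟩
      exact e.p_i y)

theorem baerI_injective : Function.Injective (baerI e e') := by
  rw [injective_iff_map_eq_zero]
  intro y hy
  obtain ⟨z, hz⟩ := (Submodule.Quotient.mk_eq_zero _).1 hy
  have h1 : e.i z = e.i y := congrArg (fun v => v.1.1) hz
  have h2 : -e'.i z = 0 := congrArg (fun v => v.1.2) hz
  have h3 : z = 0 := e'.injective (by rw [map_zero]; exact neg_eq_zero.1 h2)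
  rw [← e.injective h1, h3]

theorem baer_exact : Function.Exact (baerI e e') (baerP e e') := by
  intro v
  obtain ⟨⟨⟨a, b⟩, hab⟩, rfl⟩ := Submodule.Quotient.mk_surjective _ v
  have hab' : e.p a = e'.p b := hab
  constructor
  · intro h
    have ha : e.p a = 0 := h
    obtain ⟨y, rfl⟩ := (e.exact a).1 ha
    obtain ⟨z, rfl⟩ := (e'.exact b).1 (hab' ▸ ha)
    refine ⟨y + z, (Submodule.Quotient.eq _).2 ⟨z, Subtype.ext (Prod.ext ?_ ?_)⟩⟩
    · change e.i z = e.i (y + z) - e.i y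
      rw [map_add]; abel
    · change -e'.i z = 0 - e'.i z
      abel
  · rintro ⟨y, hy⟩
    rw [← hy]
    exact e.p_i y

theorem baerP_surjective : Function.Surjective (baerP e e') := by
  intro x
  obtain ⟨a, ha⟩ := e.surjective x
  obtain ⟨b, hb⟩ := e'.surjective x
  exact ⟨Submodule.Quotient.mk ⟨(a, b), ha.trans hb.symm⟩, ha⟩

/-- The Baer sum of two extensions. -/
def baerSum : Extn X Y where
  E := ⟨ModuleCat.of Ghost (BaerObj e e'),
    isF_of_exact (M := ModuleCat.of Ghost (BaerObj e e')) (baerI e e') (baerP e e')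
      (baerI_injective e e') (baer_exact e e') (baerP_surjective e e') Y.property X.property
      (((e.E.property.1.prod e'.E.property.1).of_injective (fibre e e').subtype
        Subtype.val_injective).of_surjective (N := ModuleCat.of Ghost (BaerObj e e'))
        (LinearMap.range (antidiagonal e e')).mkQ (Submodule.mkQ_surjective _))⟩
  i := baerI e e'
  p := baerP e e'
  injective := baerI_injective e e'
  exact := baer_exact e e'
  surjective := baerP_surjective e e'

end Baer

section Scale

variable (t : ℂ) (e : Extn X Y)

/-- The embedding `y ↦ (y, -t y)` of `Y` into `E × Y`. -/
def scaleMap : Y.obj →ₗ[Ghost] e.E.obj × Y.obj := e.i.prod (-(t • LinearMap.id))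

/-- The pushout of the middle term along multiplication by `t` on `Y`. -/
abbrev ScaleObj : Type := (e.E.obj × Y.obj) ⧸ LinearMap.range (scaleMap t e)

/-- The inclusion `y ↦ [(0, y)]`. -/
def scaleI : Y.obj →ₗ[Ghost] ScaleObj t e :=
  (LinearMap.range (scaleMap t e)).mkQ ∘ₗ LinearMap.inr Ghost _ _

/-- The projection `[(v, y)] ↦ p v`. -/
def scaleP : ScaleObj t e →ₗ[Ghost] X.obj :=
  (LinearMap.range (scaleMap t e)).liftQ (e.p ∘ₗ LinearMap.fst Ghost _ _) (by
    rintro _ ⟨y, rfl⟩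
    exact e.p_i y)

theorem scaleI_injective : Function.Injective (scaleI t e) := by
  rw [injective_iff_map_eq_zero]
  intro y hy
  obtain ⟨z, hz⟩ := (Submodule.Quotient.mk_eq_zero _).1 hy
  have h1 : e.i z = 0 := congrArg (fun v => v.1) hz
  have h2 : -(t • z) = y := congrArg (fun v => v.2) hz
  have h3 : z = 0 := e.injective (by rw [map_zero]; exact h1)
  rw [← h2, h3, smul_zero, neg_zero]

theorem scale_exact : Function.Exact (scaleI t e) (scaleP t e) := by
  intro v
  obtain ⟨⟨a, b⟩, rfl⟩ := Submodule.Quotient.mk_surjective _ v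
  constructor
  · intro h
    obtain ⟨y, rfl⟩ := (e.exact a).1 h
    refine ⟨b + t • y, (Submodule.Quotient.eq _).2 ⟨-y, Prod.ext ?_ ?_⟩⟩
    · change e.i (-y) = 0 - e.i y
      rw [map_neg, zero_sub]
    · change -(t • -y) = b + t • y - b
      rw [smul_neg]; abel
  · rintro ⟨y, hy⟩
    rw [← hy]
    exact map_zero e.p

theorem scaleP_surjective : Function.Surjective (scaleP t e) := by
  intro x
  obtain ⟨a, ha⟩ := e.surjective x
  exact ⟨Submodule.Quotient.mk (a, 0), ha⟩

/-- The multiple of an extension by a scalar: the pushout along multiplication by `t` on `Y`. -/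
def scale : Extn X Y where
  E := ⟨ModuleCat.of Ghost (ScaleObj t e),
    isF_of_exact (M := ModuleCat.of Ghost (ScaleObj t e)) (scaleI t e) (scaleP t e)
      (scaleI_injective t e) (scale_exact t e) (scaleP_surjective t e) Y.property X.property
      ((e.E.property.1.prod Y.property.1).of_surjective (N := ModuleCat.of Ghost (ScaleObj t e))
        (LinearMap.range (scaleMap t e)).mkQ (Submodule.mkQ_surjective _))⟩
  i := scaleI t e
  p := scaleP t e
  injective := scaleI_injective t e
  exact := scale_exact t e
  surjective := scaleP_surjective t e

end Scale

/-! The vector space axioms for the Baer sum are checked on the cocycles of extensions. -/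

section Cocycle

/-- Inner cocycles. -/
def innerCocycle (X Y : CatF) : (X.obj →ₗ[ℂ] Y.obj) →ₗ[ℂ] (Ghost → X.obj → Y.obj) where
  toFun h a x := a • h x - h (a • x)
  map_add' h h' := by
    funext a x
    simp only [LinearMap.add_apply, smul_add, Pi.add_apply]
    abel
  map_smul' c h := by
    funext a x
    simp only [LinearMap.smul_apply, RingHom.id_apply, Pi.smul_apply, smul_sub, smul_comm a c]

/-- Functions modulo inner cocycles. -/
abbrev CocycleQuot (X Y : CatF) : Type :=
  (Ghost → X.obj → Y.obj) ⧸ LinearMap.range (innerCocycle X Y)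

/-- `c` is the cocycle of `e` with respect to the linear section `s`. -/
def IsCocycle (e : Extn X Y) (s : X.obj →ₗ[ℂ] e.E.obj) (c : Ghost → X.obj → Y.obj) : Prop :=
  (∀ x, e.p (s x) = x) ∧ ∀ a x, e.i (c a x) = a • s x - s (a • x)

theorem exists_isCocycle (e : Extn X Y) : ∃ s c, IsCocycle e s c := by
  obtain ⟨s, hs⟩ := LinearMap.exists_rightInverse_of_surjective (toC e.p)
    (LinearMap.range_eq_top.2 e.surjective)
  have hs' : ∀ x, e.p (s x) = x := fun x => LinearMap.congr_fun hs x
  have : ∀ (a : Ghost) (x : X.obj), ∃ y, e.i y = a • s x - s (a • x) := fun a x =>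
    (e.exact _).1 (by rw [map_sub, map_smul e.p, hs', hs', sub_self])
  choose c hc using this
  exact ⟨s, c, hs', hc⟩

theorem IsCocycle.unique {e : Extn X Y} {s s' : X.obj →ₗ[ℂ] e.E.obj}
    {c c' : Ghost → X.obj → Y.obj} (h : IsCocycle e s c) (h' : IsCocycle e s' c') :
    (Submodule.Quotient.mk c : CocycleQuot X Y) = Submodule.Quotient.mk c' := by
  have : ∀ x, ∃ y, e.i y = s x - s' x := fun x =>
    (e.exact _).1 (by rw [map_sub, h.1, h'.1, sub_self])
  choose u hu using this
  refine (Submodule.Quotient.eq _).2 ⟨⟨⟨u, fun x x' => e.injective ?_⟩, fun t x => e.injective ?_⟩, ?_⟩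
  · rw [map_add, hu, hu, hu, map_add, map_add]; abel
  · change e.i (u (t • x)) = e.i (t • u x)
    rw [map_complex_smul, hu, hu, map_smul, map_smul, smul_sub]
  · funext a x
    apply e.injective
    change e.i (a • u x - u (a • x)) = e.i (c a x - c' a x)
    rw [map_sub, map_sub, map_smul, hu, hu, h.2, h'.2, smul_sub]
    abel

/-- The cocycle class of an extension. -/
def cls (e : Extn X Y) : CocycleQuot X Y :=
  Submodule.Quotient.mk (exists_isCocycle e).choose_spec.choose

theorem IsCocycle.cls_eq {e : Extn X Y} {s : X.obj →ₗ[ℂ] e.E.obj}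
    {c : Ghost → X.obj → Y.obj} (h : IsCocycle e s c) : cls e = Submodule.Quotient.mk c :=
  (exists_isCocycle e).choose_spec.choose_spec.unique h

theorem cls_eq_of_equivalent {e e' : Extn X Y} (h : Equivalent e e') : cls e = cls e' := by
  obtain ⟨φ, h1, h2⟩ := h
  obtain ⟨s, c, hs, hc⟩ := exists_isCocycle e
  have : IsCocycle e' (toC φ.toLinearMap ∘ₗ s) c := by
    refine ⟨fun x => (h2 _).trans (hs x), fun a x => ?_⟩
    change e'.i (c a x) = a • φ (s x) - φ (s (a • x))
    rw [← h1, hc, map_sub, map_smul]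
  rw [this.cls_eq, (show IsCocycle e s c from ⟨hs, hc⟩).cls_eq]

theorem equivalent_of_cls_eq {e e' : Extn X Y} (h : cls e = cls e') : Equivalent e e' := by
  obtain ⟨s, c, hs, hc⟩ := exists_isCocycle e
  obtain ⟨s', c', hs', hc'⟩ := exists_isCocycle e'
  rw [(show IsCocycle e s c from ⟨hs, hc⟩).cls_eq,
    (show IsCocycle e' s' c' from ⟨hs', hc'⟩).cls_eq] at h
  obtain ⟨u, hu⟩ := (Submodule.Quotient.eq _).1 h
  have hu' : ∀ a x, a • u x - u (a • x) = c a x - c' a x := fun a x =>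
    congrFun (congrFun hu a) x
  -- the section of `e'` with the same cocycle as `s`
  have hs2 : ∀ x, e'.p (s' x + e'.i (u x)) = x := fun x => by
    rw [map_add, hs', p_i, add_zero]
  have hc2 : ∀ a x, e'.i (c a x) = a • (s' x + e'.i (u x)) - (s' (a • x) + e'.i (u (a • x))) := by
    intro a x
    have h3 : c a x = c' a x + (a • u x - u (a • x)) := by rw [hu']; abel
    rw [h3, map_add, hc', map_sub, map_smul e'.i, smul_add]
    abel
  have hr : ∀ v, ∃ y, e.i y = v - s (e.p v) := fun v =>
    (e.exact _).1 (by rw [map_sub, hs, sub_self])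
  choose r hr using hr
  have hradd : ∀ v w, r (v + w) = r v + r w := fun v w => e.injective (by
    rw [map_add, hr, hr, hr, map_add, map_add]; abel)
  have hrsmul : ∀ (a : Ghost) v, r (a • v) = a • r v + c a (e.p v) := fun a v => e.injective (by
    rw [map_add, map_smul, hr, hr, map_smul, hc, smul_sub]; abel)
  have hri : ∀ y, r (e.i y) = y := fun y => e.injective (by
    rw [hr, p_i, map_zero, sub_zero])
  let φ : e.E.obj →ₗ[Ghost] e'.E.obj :=
    { toFun := fun v => e'.i (r v) + (s' (e.p v) + e'.i (u (e.p v)))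
      map_add' := fun v w => by
        simp only [hradd, map_add]; abel
      map_smul' := fun a v => by
        simp only [hrsmul, map_add, hc2, map_smul, RingHom.id_apply, smul_add]
        abel }
  have hφ : ∀ v, φ v = e'.i (r v) + (s' (e.p v) + e'.i (u (e.p v))) := fun _ => rfl
  have hφp : ∀ v, e'.p (φ v) = e.p v := fun v => by rw [hφ, map_add, p_i, hs2, zero_add]
  have hφi : ∀ y, φ (e.i y) = e'.i y := fun y => by
    rw [hφ, hri, p_i]; simp only [map_zero, add_zero]
  refine ⟨LinearEquiv.ofBijective φ ⟨?_, fun w => ?_⟩, hφi, hφp⟩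
  · rw [injective_iff_map_eq_zero]
    intro v hv
    have hpv : e.p v = 0 := by rw [← hφp, hv, map_zero]
    obtain ⟨y, rfl⟩ := (e.exact v).1 hpv
    rw [hφi] at hv
    rw [e'.injective (hv.trans (map_zero e'.i).symm), map_zero]
  · obtain ⟨v, hv⟩ := e.surjective (e'.p w)
    obtain ⟨y, hy⟩ := (e'.exact (w - φ v)).1 (by rw [map_sub, hφp, hv, sub_self])
    exact ⟨v + e.i y, by rw [map_add, hφi, hy]; abel⟩

theorem cls_split : cls (split X Y) = 0 := by
  let q : Y.obj × X.obj →ₗ[Ghost] (split X Y).E.obj := LinearMap.id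
  have : IsCocycle (split X Y) (toC q ∘ₗ LinearMap.inr ℂ Y.obj X.obj) 0 := by
    refine ⟨fun x => rfl, fun a x => Prod.ext ?_ ?_⟩
    · change (0 : Y.obj) = a • 0 - 0
      simp
    · change (0 : X.obj) = a • x - a • x
      simp
  rw [this.cls_eq]
  rfl

theorem cls_baerSum (e e' : Extn X Y) : cls (baerSum e e') = cls e + cls e' := by
  obtain ⟨s, c, hs, hc⟩ := exists_isCocycle e
  obtain ⟨s', c', hs', hc'⟩ := exists_isCocycle e'
  have hmem : ∀ x, (s x, s' x) ∈ fibre e e' := fun x => (hs x).trans (hs' x).symm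
  let q : fibre e e' →ₗ[Ghost] (baerSum e e').E.obj := (LinearMap.range (antidiagonal e e')).mkQ
  have : IsCocycle (baerSum e e')
      (toC q ∘ₗ LinearMap.mk (AddHom.mk (fun x => (⟨(s x, s' x), hmem x⟩ : fibre e e'))
        fun x x' => Subtype.ext (Prod.ext (map_add s x x') (map_add s' x x')))
        fun t x => Subtype.ext (Prod.ext (map_smul s t x) (map_smul s' t x))) (c + c') := by
    refine ⟨fun x => hs x, fun a x => ?_⟩
    refine (Submodule.Quotient.eq _).2 ⟨c' a x, Subtype.ext (Prod.ext ?_ ?_)⟩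
    · change e.i (c' a x) = e.i (c a x + c' a x) - (a • s x - s (a • x))
      rw [map_add, hc]; abel
    · change -e'.i (c' a x) = 0 - (a • s' x - s' (a • x))
      rw [hc']; abel
  rw [this.cls_eq, (show IsCocycle e s c from ⟨hs, hc⟩).cls_eq,
    (show IsCocycle e' s' c' from ⟨hs', hc'⟩).cls_eq]
  rfl

theorem cls_scale (t : ℂ) (e : Extn X Y) : cls (scale t e) = t • cls e := by
  obtain ⟨s, c, hs, hc⟩ := exists_isCocycle e
  let q : e.E.obj × Y.obj →ₗ[Ghost] (scale t e).E.obj := (LinearMap.range (scaleMap t e)).mkQ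
  have : IsCocycle (scale t e) (toC q ∘ₗ LinearMap.inl ℂ e.E.obj Y.obj ∘ₗ s) (t • c) := by
    refine ⟨fun x => hs x, fun a x => ?_⟩
    refine (Submodule.Quotient.eq _).2 ⟨-c a x, Prod.ext ?_ ?_⟩
    · change e.i (-c a x) = 0 - (a • s x - s (a • x))
      rw [map_neg, hc, zero_sub]
    · change -(t • -c a x) = t • c a x - (a • 0 - 0)
      simp
  rw [this.cls_eq, (show IsCocycle e s c from ⟨hs, hc⟩).cls_eq]
  rfl

end Cocycle

end Extn

/-- The first extension group `Ext¹(X, Y)` in the category `F`: equivalence classes of short exact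
sequences `0 ⟶ Y ⟶ E ⟶ X ⟶ 0` in `F`. -/
def Ext1 (X Y : CatF) : Type 1 := Quotient (Extn.setoid X Y)

namespace Ext1

variable {X Y : CatF}

/-- The class of an extension. -/
def mk (e : Extn X Y) : Ext1 X Y := Quotient.mk _ e

/-- The cocycle class, as a function on equivalence classes of extensions. -/
def cls : Ext1 X Y → Extn.CocycleQuot X Y :=
  Quotient.lift Extn.cls fun _ _ h => Extn.cls_eq_of_equivalent h

theorem cls_injective : Function.Injective (cls : Ext1 X Y → Extn.CocycleQuot X Y) := by
  rintro ⟨e⟩ ⟨e'⟩ h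
  exact Quotient.sound (Extn.equivalent_of_cls_eq h)

/-- The zero class is the class of the split extension. -/
instance : Zero (Ext1 X Y) := ⟨mk (Extn.split X Y)⟩

/-- Addition is the Baer sum. -/
instance : Add (Ext1 X Y) :=
  ⟨Quotient.map₂ Extn.baerSum fun _ _ h _ _ h' => Extn.equivalent_of_cls_eq (by
    rw [Extn.cls_baerSum, Extn.cls_baerSum, Extn.cls_eq_of_equivalent h,
      Extn.cls_eq_of_equivalent h'])⟩

/-- Scalars act by pushout along the multiplication by the scalar. -/
instance : SMul ℂ (Ext1 X Y) :=
  ⟨fun t => Quotient.map (Extn.scale t) fun _ _ h => Extn.equivalent_of_cls_eq (by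
    rw [Extn.cls_scale, Extn.cls_scale, Extn.cls_eq_of_equivalent h])⟩

instance : Neg (Ext1 X Y) := ⟨fun x => (-1 : ℂ) • x⟩

instance : Sub (Ext1 X Y) := ⟨fun x y => x + -y⟩

instance : SMul ℕ (Ext1 X Y) := ⟨fun n x => (n : ℂ) • x⟩

instance : SMul ℤ (Ext1 X Y) := ⟨fun n x => (n : ℂ) • x⟩

theorem cls_zero : cls (0 : Ext1 X Y) = 0 := Extn.cls_split

theorem cls_add (x y : Ext1 X Y) : cls (x + y) = cls x + cls y := by
  obtain ⟨e⟩ := x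
  obtain ⟨e'⟩ := y
  exact Extn.cls_baerSum e e'

theorem cls_smul (t : ℂ) (x : Ext1 X Y) : cls (t • x) = t • cls x := by
  obtain ⟨e⟩ := x
  exact Extn.cls_scale t e

theorem cls_neg (x : Ext1 X Y) : cls (-x) = -cls x :=
  (cls_smul _ _).trans (neg_one_smul ℂ (cls x))

instance : AddCommGroup (Ext1 X Y) :=
  cls_injective.addCommGroup cls cls_zero cls_add cls_neg
    (fun x y => (cls_add x (-y)).trans (by rw [cls_neg, sub_eq_add_neg]))
    (fun x n => (cls_smul _ x).trans (Nat.cast_smul_eq_nsmul ℂ n _))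
    (fun x n => (cls_smul _ x).trans (Int.cast_smul_eq_zsmul ℂ n _))

instance : Module ℂ (Ext1 X Y) :=
  cls_injective.module ℂ ⟨⟨cls, cls_zero⟩, cls_add⟩ cls_smul

end Ext1

/-! ### Induced modules -/

section Induced

variable {V : Type} [AddCommGroup V] [Module ℂ V]

/-- The space on which the negative modes act freely: polynomials in the negative modes with
coefficients in `V`. The variable `X (inl n)` stands for `β_{-(n+1)}` and `X (inr n)` stands for
`γ_{-(n+1)}`. -/
def FockSpace (V : Type) [AddCommGroup V] [Module ℂ V] : Type :=
  MvPolynomial (ℕ ⊕ ℕ) ℂ ⊗[ℂ] V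

instance : AddCommGroup (FockSpace V) :=
  inferInstanceAs (AddCommGroup (MvPolynomial (ℕ ⊕ ℕ) ℂ ⊗[ℂ] V))

instance : Module ℂ (FockSpace V) :=
  inferInstanceAs (Module ℂ (MvPolynomial (ℕ ⊕ ℕ) ℂ ⊗[ℂ] V))

/-- The vector `a ⊗ v` of the Fock space. -/
def vec (a : MvPolynomial (ℕ ⊕ ℕ) ℂ) (v : V) : FockSpace V := a ⊗ₜ[ℂ] v

theorem end_ext {f g : Module.End ℂ (FockSpace V)} (h : ∀ a v, f (vec a v) = g (vec a v)) :
    f = g := TensorProduct.ext' (M := MvPolynomial (ℕ ⊕ ℕ) ℂ) (N := V) h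

/-- The action of a polynomial operator on the Fock space. -/
def polyOp (f : Module.End ℂ (MvPolynomial (ℕ ⊕ ℕ) ℂ)) : Module.End ℂ (FockSpace V) :=
  LinearMap.rTensor (N := MvPolynomial (ℕ ⊕ ℕ) ℂ) (P := MvPolynomial (ℕ ⊕ ℕ) ℂ) V f

/-- The action of an operator on coefficients. -/
def coeffOp (f : Module.End ℂ V) : Module.End ℂ (FockSpace V) :=
  LinearMap.lTensor (MvPolynomial (ℕ ⊕ ℕ) ℂ) f

/-- Multiplication by a variable. -/
def mulX (i : ℕ ⊕ ℕ) : Module.End ℂ (MvPolynomial (ℕ ⊕ ℕ) ℂ) :=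
  LinearMap.mulLeft ℂ (MvPolynomial.X i)

/-- The derivative with respect to a variable. -/
def dX (i : ℕ ⊕ ℕ) : Module.End ℂ (MvPolynomial (ℕ ⊕ ℕ) ℂ) :=
  (MvPolynomial.pderiv i).toLinearMap

/-- The modes `β_n`: `β_0` acts as `-p`, the negative modes act by multiplication, and the positive
modes annihilate `V`. -/
def betaOp (p : Module.End ℂ V) : ℤ → Module.End ℂ (FockSpace V)
  | .ofNat 0 => -coeffOp p
  | .ofNat (n + 1) => -polyOp (dX (.inr n))
  | .negSucc n => polyOp (mulX (.inl n))

/-- The modes `γ_n`: `γ_0` acts as `q`, the negative modes act by multiplication, and the positive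
modes annihilate `V`. -/
def gammaOp (q : Module.End ℂ V) : ℤ → Module.End ℂ (FockSpace V)
  | .ofNat 0 => coeffOp q
  | .ofNat (n + 1) => polyOp (dX (.inl n))
  | .negSucc n => polyOp (mulX (.inr n))

theorem polyOp_vec (f : Module.End ℂ (MvPolynomial (ℕ ⊕ ℕ) ℂ)) (a : MvPolynomial (ℕ ⊕ ℕ) ℂ)
    (v : V) : polyOp f (vec a v) = vec (f a) v := rfl

theorem coeffOp_vec (f : Module.End ℂ V) (a : MvPolynomial (ℕ ⊕ ℕ) ℂ) (v : V) :
    coeffOp f (vec a v) = vec a (f v) := rfl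

theorem polyOp_mul_coeffOp (f : Module.End ℂ (MvPolynomial (ℕ ⊕ ℕ) ℂ)) (g : Module.End ℂ V) :
    polyOp f * coeffOp g = coeffOp g * polyOp f :=
  end_ext fun _ _ => rfl

theorem polyOp_mul (f g : Module.End ℂ (MvPolynomial (ℕ ⊕ ℕ) ℂ)) :
    (polyOp f * polyOp g : Module.End ℂ (FockSpace V)) = polyOp (f * g) :=
  end_ext fun _ _ => rfl

theorem polyOp_comm {f g : Module.End ℂ (MvPolynomial (ℕ ⊕ ℕ) ℂ)} (h : f * g = g * f) :
    (polyOp f * polyOp g : Module.End ℂ (FockSpace V)) = polyOp g * polyOp f := by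
  rw [polyOp_mul, polyOp_mul, h]

theorem mulX_comm (i j : ℕ ⊕ ℕ) : mulX i * mulX j = mulX j * mulX i := by
  refine LinearMap.ext fun f => ?_
  simp only [mulX, Module.End.mul_apply, LinearMap.mulLeft_apply]
  ring

theorem dX_comm (i j : ℕ ⊕ ℕ) : dX i * dX j = dX j * dX i := by
  refine LinearMap.ext fun f => ?_
  have h : ⁅MvPolynomial.pderiv (R := ℂ) i, MvPolynomial.pderiv (R := ℂ) j⁆ = 0 := by
    refine MvPolynomial.derivation_ext fun k => ?_
    classical
    rw [Derivation.commutator_apply, MvPolynomial.pderiv_X, MvPolynomial.pderiv_X]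
    simp [Pi.single_apply, apply_ite]
  have h' := congrArg (fun D => D f) h
  simp only [Derivation.commutator_apply, Derivation.zero_apply] at h'
  exact sub_eq_zero.1 h'

theorem dX_mul_mulX (i j : ℕ ⊕ ℕ) : dX i * mulX j = mulX j * dX i + if i = j then 1 else 0 := by
  classical
  refine LinearMap.ext fun f => ?_
  by_cases h : i = j
  · subst h
    simp [dX, mulX]
  · simp [dX, mulX, MvPolynomial.pderiv_X, h, Ne.symm h]

theorem polyOp_dX_mul_mulX (i j : ℕ ⊕ ℕ) :
    (polyOp (dX i) * polyOp (mulX j) : Module.End ℂ (FockSpace V)) =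
      polyOp (mulX j) * polyOp (dX i) + if i = j then 1 else 0 := by
  rw [polyOp_mul, polyOp_mul, dX_mul_mulX]
  refine end_ext fun a v => ?_
  split_ifs
  · exact TensorProduct.add_tmul _ _ _
  · rw [add_zero, add_zero]

theorem betaOp_comm (p : Module.End ℂ V) (m n : ℤ) :
    betaOp p m * betaOp p n = betaOp p n * betaOp p m := by
  rcases m with (_ | m) | m <;> rcases n with (_ | n) | n <;>
    simp only [betaOp, neg_mul, mul_neg, neg_neg, polyOp_mul_coeffOp]
  · exact polyOp_comm (dX_comm _ _)
  · rw [polyOp_dX_mul_mulX, if_neg (by simp), add_zero]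
  · rw [polyOp_dX_mul_mulX, if_neg (by simp), add_zero]
  · exact polyOp_comm (mulX_comm _ _)

theorem gammaOp_comm (q : Module.End ℂ V) (m n : ℤ) :
    gammaOp q m * gammaOp q n = gammaOp q n * gammaOp q m := by
  rcases m with (_ | m) | m <;> rcases n with (_ | n) | n <;>
    simp only [gammaOp, polyOp_mul_coeffOp]
  · exact polyOp_comm (dX_comm _ _)
  · rw [polyOp_dX_mul_mulX, if_neg (by simp), add_zero]
  · rw [polyOp_dX_mul_mulX, if_neg (by simp), add_zero]
  · exact polyOp_comm (mulX_comm _ _)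

theorem gammaOp_mul_betaOp (p q : Module.End ℂ V) (hpq : p * q - q * p = 1) (m n : ℤ) :
    gammaOp q m * betaOp p n = betaOp p n * gammaOp q m + if m + n = 0 then 1 else 0 := by
  rcases m with (_ | m) | m <;> rcases n with (_ | n) | n <;>
    simp only [gammaOp, betaOp, neg_mul, mul_neg, polyOp_mul_coeffOp]
  · have h : coeffOp p * coeffOp q - coeffOp q * coeffOp p = 1 := by
      refine end_ext fun a v => ?_
      have := LinearMap.congr_fun hpq v
      simp only [LinearMap.sub_apply, Module.End.mul_apply, Module.End.one_apply] at this ⊢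
      simp only [coeffOp_vec]
      exact (TensorProduct.tmul_sub _ _ _).symm.trans (congrArg _ this)
    rw [if_pos (by simp), ← h]
    abel
  · rw [if_neg (by simp; omega), add_zero]
  · rw [if_neg (by simp), add_zero]
  · rw [if_neg (by simp; omega), add_zero]
  · rw [if_neg (by simp; omega), add_zero]
    exact congrArg Neg.neg (polyOp_comm (dX_comm _ _))
  · rw [polyOp_dX_mul_mulX]
    congr 1
    refine if_congr ?_ rfl rfl
    rw [Sum.inl.injEq, show Int.ofNat (m + 1) = (m : ℤ) + 1 from rfl]
    omega
  · rw [if_neg (by simp), add_zero]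
  · rw [polyOp_dX_mul_mulX, neg_add, add_assoc]
    have hn : Int.ofNat (n + 1) = (n : ℤ) + 1 := rfl
    have : (-if (Sum.inr n : ℕ ⊕ ℕ) = Sum.inr m then (1 : Module.End ℂ (FockSpace V)) else 0) +
        (if Int.negSucc m + Int.ofNat (n + 1) = 0 then 1 else 0) = 0 := by
      by_cases h : n = m
      · subst h
        rw [if_pos rfl, if_pos (by omega), neg_add_cancel]
      · rw [if_neg (by simpa using h), if_neg (by omega), neg_zero, zero_add]
    rw [this, add_zero]
  · rw [if_neg (by omega), add_zero]
    exact polyOp_comm (mulX_comm _ _)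

/-- The module induced from a module `V` over the Weyl algebra `[p, q] = 1`: the positive modes
annihilate `V`, the zero modes `β_0` and `γ_0` act on `V` as `-p` and `q`, and the negative modes
act freely. -/
def induced (p q : Module.End ℂ V) (hpq : p * q - q * p = 1) : ModuleCat.{0} Ghost :=
  letI : Module Ghost (FockSpace V) := Module.compHom (FockSpace V)
    (liftModes (betaOp p) (gammaOp q) (gammaOp_mul_betaOp p q hpq) (betaOp_comm p)
      (gammaOp_comm q)).toRingHom
  ModuleCat.of Ghost (FockSpace V)

end Induced

/-! ### The vacuum module and the modules `W_μ` -/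

/-- The vacuum module, induced from the module `ℂ[x]` over the Weyl algebra, on which `p` acts as
the derivative and `q` as multiplication by `x`. -/
def vacuum : ModuleCat.{0} Ghost :=
  induced (V := Polynomial ℂ) Polynomial.derivative (LinearMap.mulLeft ℂ Polynomial.X) (by
    refine LinearMap.ext fun f => ?_
    simp)

/-- The derivative on `ℂ[x, x⁻¹] x^μ`, where the basis vector with index `n` of the space of
finitely supported functions `ℤ →₀ ℂ` stands for `x^{μ+n}`. -/
def denseP (μ : ℂ) : Module.End ℂ (ℤ →₀ ℂ) :=
  Finsupp.lsum ℂ fun n : ℤ => (μ + n) • Finsupp.lsingle (n - 1)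

/-- Multiplication by `x` on `ℂ[x, x⁻¹] x^μ`. -/
def denseQ : Module.End ℂ (ℤ →₀ ℂ) :=
  Finsupp.lsum ℂ fun n : ℤ => Finsupp.lsingle (n + 1)

/-- The module `W_μ`, induced from the module `ℂ[x, x⁻¹] x^μ` over the Weyl algebra, on which `p`
acts as the derivative and `q` as multiplication by `x`. Up to isomorphism it only depends on the
coset `μ + ℤ`. -/
def typical (μ : ℂ) : ModuleCat.{0} Ghost :=
  induced (V := ℤ →₀ ℂ) (denseP μ) denseQ (by
    refine Finsupp.lhom_ext fun n a => ?_
    simp only [denseP, denseQ, LinearMap.sub_apply, Module.End.mul_apply, Finsupp.lsum_single,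
      Finsupp.lsingle_apply, LinearMap.smul_apply, map_smul, Module.End.one_apply,
      add_sub_cancel_right, sub_add_cancel]
    rw [← sub_smul]
    push_cast
    rw [show μ + (n + 1) - (μ + n) = (1 : ℂ) by ring, one_smul])

/-! ### The spectral flows of the vacuum module and of the modules `W_μ` are objects of `F` -/

section ZeroMode

theorem sum_delta {M : Type} [AddCommGroup M] (n : ℤ) (a b : ℕ) (ha : n.natAbs ≤ a) (hb : n.natAbs ≤ b) (w : M) :
    ∑ k ∈ Finset.range b, (if (k : ℤ) + 1 + n = 0 then w else 0) + (if 0 + n = 0 then w else 0) +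
      ∑ k ∈ Finset.range a, (if -((k : ℤ) + 1) + n = 0 then w else 0) = w := by
  rcases lt_trichotomy n 0 with h | h | h
  · obtain ⟨m, rfl⟩ : ∃ m : ℕ, n = -((m : ℤ) + 1) := ⟨(-n - 1).toNat, by omega⟩
    rw [Finset.sum_eq_single_of_mem m (Finset.mem_range.2 (by omega))
      (fun k _ hk => if_neg (by omega)), if_pos (by omega), if_neg (by omega),
      Finset.sum_eq_zero fun k _ => if_neg (by omega)]
    simp
  · subst h
    rw [Finset.sum_eq_zero fun k _ => if_neg (by omega),
      Finset.sum_eq_zero fun k _ => if_neg (by omega)]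
    simp
  · obtain ⟨m, rfl⟩ : ∃ m : ℕ, n = (m : ℤ) + 1 := ⟨(n - 1).toNat, by omega⟩
    rw [Finset.sum_eq_zero fun k _ => if_neg (by omega), if_neg (by omega),
      Finset.sum_eq_single_of_mem m (Finset.mem_range.2 (by omega))
      (fun k _ hk => if_neg (by omega)), if_pos (by omega)]
    simp

variable {M : Type} [AddCommGroup M] [Module Ghost M]

/-- The summand `β_{-m} γ_m`. -/
def bTerm (m : ℤ) (v : M) : M := beta (-m) • gamma m • v

theorem gamma_smul_beta_smul (m n : ℤ) (v : M) :
    gamma m • beta n • v = beta n • gamma m • v + if m + n = 0 then v else 0 := by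
  rw [smul_smul, gamma_mul_beta, add_smul, mul_smul]
  split_ifs <;> simp

theorem beta_smul_comm (m n : ℤ) (v : M) : beta m • beta n • v = beta n • beta m • v := by
  rw [smul_smul, beta_mul_beta, mul_smul]

theorem gamma_smul_comm (m n : ℤ) (v : M) : gamma m • gamma n • v = gamma n • gamma m • v := by
  rw [smul_smul, gamma_mul_gamma, mul_smul]

theorem jTerm_eq (n : ℕ) (v : M) : jTerm n v = bTerm (n + 1) v + (bTerm (-(n + 1)) v + v) := by
  simp only [jTerm, bTerm, neg_neg]
  rw [gamma_smul_beta_smul, if_pos (by ring)]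

/-- The symmetric partial sums of `J_0`, up to normal ordering. -/
def partialJ (a b : ℕ) (v : M) : M :=
  ∑ n ∈ Finset.range b, bTerm (n + 1) v + bTerm 0 v +
    ∑ n ∈ Finset.range a, (bTerm (-(n + 1)) v + v) + v

/-- The partial sums of `J_0` on the twist by `σ^l`. -/
def shiftedJ (l : ℤ) (a b : ℕ) (v : M) : M :=
  ∑ n ∈ Finset.range b, bTerm (n + 1 - l) v + bTerm (-l) v +
    ∑ n ∈ Finset.range a, (bTerm (-(n + 1) - l) v + v) + v

theorem shiftedJ_succ (l : ℤ) (a b : ℕ) (v : M) :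
    shiftedJ (l + 1) a (b + 1) v + v = shiftedJ l (a + 1) b v := by
  simp only [shiftedJ, Finset.sum_range_succ', Nat.cast_add, Nat.cast_one, Nat.cast_zero]
  have h1 : ∀ n : ℕ, ((n : ℤ) + 1 + 1 - (l + 1)) = n + 1 - l := fun n => by ring
  have h2 : ∀ n : ℕ, (-((n : ℤ) + 1) - (l + 1)) = -((n : ℤ) + 1 + 1) - l := fun n => by ring
  have h3 : ((0 : ℤ) + 1 - (l + 1)) = -l := by ring
  have h4 : (-(l + 1)) = -((0 : ℤ) + 1) - l := by ring
  simp only [h1, h2, h3, h4]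
  abel

variable [Module ℂ M] [IsScalarTower ℂ Ghost M]

theorem J0_eq_partialJ (h : Smooth M) (v : M) :
    ∃ N : ℕ, ∀ a b, N ≤ a → N ≤ b → J0 h v = partialJ a b v := by
  obtain ⟨K, hK⟩ := h v
  refine ⟨K.toNat, fun a b ha hb => ?_⟩
  have h1 : ∀ n : ℕ, K.toNat ≤ n → bTerm (n + 1) v = 0 := fun n hn => by
    rw [bTerm, (hK (n + 1) (by omega)).2, smul_zero]
  have h2 : ∀ n : ℕ, K.toNat ≤ n → bTerm (-(n + 1)) v + v = 0 := fun n hn => by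
    have := gamma_smul_beta_smul (-(n + 1)) (n + 1) v
    rw [(hK (n + 1) (by omega)).1, smul_zero, if_pos (by ring)] at this
    rw [bTerm, neg_neg, ← this]
  have e1 : ∀ c : ℕ, K.toNat ≤ c → ∑ n ∈ Finset.range c, bTerm ((n : ℤ) + 1) v =
      ∑ n ∈ Finset.range K.toNat, bTerm ((n : ℤ) + 1) v := fun c hc => by
    refine (Finset.sum_subset (Finset.range_mono hc) fun n _ hn => h1 n ?_).symm
    simpa using hn
  have e2 : ∀ c : ℕ, K.toNat ≤ c → ∑ n ∈ Finset.range c, (bTerm (-((n : ℤ) + 1)) v + v) =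
      ∑ n ∈ Finset.range K.toNat, (bTerm (-((n : ℤ) + 1)) v + v) := fun c hc => by
    refine (Finset.sum_subset (Finset.range_mono hc) fun n _ hn => h2 n ?_).symm
    simpa using hn
  have e3 : ∑ᶠ n : ℕ, jTerm n v = ∑ n ∈ Finset.range K.toNat, jTerm n v := by
    refine finsum_eq_sum_of_support_subset _ fun n hn => ?_
    by_contra hlt
    simp only [Finset.coe_range, Set.mem_Iio, not_lt] at hlt
    refine hn ?_
    change jTerm n v = 0
    rw [jTerm_eq, h1 n hlt, h2 n hlt, add_zero]
  simp only [J0, LinearMap.coe_mk, AddHom.coe_mk, partialJ, e1 b hb, e2 a ha, e3]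
  simp only [jTerm_eq]
  rw [Finset.sum_add_distrib, gamma_smul_beta_smul, if_pos (by ring)]
  simp only [bTerm, neg_zero]
  abel

theorem J0_sub_eq_shiftedJ (h : Smooth M) (v : M) (l : ℤ) :
    ∃ N : ℕ, ∀ a b, N ≤ a → N ≤ b → J0 h v - (l : ℂ) • v = shiftedJ l a b v := by
  induction l using Int.induction_on with
  | zero =>
    obtain ⟨N, hN⟩ := J0_eq_partialJ h v
    refine ⟨N, fun a b ha hb => ?_⟩
    rw [hN a b ha hb]
    simp [partialJ, shiftedJ]
  | succ i ih =>
    obtain ⟨N, hN⟩ := ih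
    refine ⟨N + 1, fun a b ha hb => ?_⟩
    obtain ⟨b, rfl⟩ : ∃ c, b = c + 1 := ⟨b - 1, by omega⟩
    have := shiftedJ_succ i a b v
    rw [← hN (a + 1) b (by omega) (by omega)] at this
    rw [← eq_sub_iff_add_eq] at this
    rw [this]
    push_cast
    rw [add_smul, one_smul]
    abel
  | pred i ih =>
    obtain ⟨N, hN⟩ := ih
    refine ⟨N + 1, fun a b ha hb => ?_⟩
    obtain ⟨a, rfl⟩ : ∃ c, a = c + 1 := ⟨a - 1, by omega⟩
    have := shiftedJ_succ (-(i : ℤ) - 1) a b v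
    rw [sub_add_cancel, ← hN a (b + 1) (by omega) (by omega)] at this
    rw [← this]
    push_cast
    rw [sub_smul, one_smul]
    abel

theorem J0_beta (h : Smooth M) (n : ℤ) (v : M) :
    J0 h (beta n • v) = beta n • J0 h v + beta n • v := by
  obtain ⟨N, hN⟩ := J0_eq_partialJ h v
  obtain ⟨N', hN'⟩ := J0_eq_partialJ h (beta n • v)
  let a := N + N' + n.natAbs
  rw [hN a a (by omega) (by omega), hN' a a (by omega) (by omega)]
  have hb : ∀ m : ℤ, bTerm m (beta n • v) =
      beta n • bTerm m v + if m + n = 0 then beta n • v else 0 := fun m => by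
    simp only [bTerm]
    rw [gamma_smul_beta_smul, smul_add, beta_smul_comm]
    congr 1
    split_ifs with h0
    · rw [show -m = n by omega]
    · exact smul_zero _
  have hd := sum_delta n a a (by omega) (by omega) (beta n • v)
  refine Eq.trans ?_ (congrArg (fun w => beta n • partialJ a a v + w) hd)
  simp only [partialJ, hb, smul_add, Finset.smul_sum, Finset.sum_add_distrib]
  abel

theorem J0_gamma (h : Smooth M) (n : ℤ) (v : M) :
    J0 h (gamma n • v) = gamma n • J0 h v - gamma n • v := by
  obtain ⟨N, hN⟩ := J0_eq_partialJ h v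
  obtain ⟨N', hN'⟩ := J0_eq_partialJ h (gamma n • v)
  let a := N + N' + n.natAbs
  rw [hN a a (by omega) (by omega), hN' a a (by omega) (by omega), eq_sub_iff_add_eq]
  have hb : ∀ m : ℤ, gamma n • bTerm m v =
      bTerm m (gamma n • v) + if m + -n = 0 then gamma n • v else 0 := fun m => by
    simp only [bTerm]
    rw [gamma_smul_beta_smul, gamma_smul_comm]
    congr 1
    split_ifs with h0 h1 h1
    · rw [show m = n by omega]
    · omega
    · omega
    · rfl
  have hd := sum_delta (-n) a a (by omega) (by omega) (gamma n • v)
  refine (congrArg (fun w => partialJ a a (gamma n • v) + w) hd).symm.trans ?_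
  simp only [partialJ, hb, smul_add, Finset.smul_sum, Finset.sum_add_distrib]
  abel

end ZeroMode

section Generation

variable {M : Type} [AddCommGroup M] [Module Ghost M] [Module ℂ M] [IsScalarTower ℂ Ghost M]

/-- A subspace that is stable under all modes is a submodule. -/
theorem smul_mem_of_stable (N : Submodule ℂ M) (hb : ∀ n, ∀ v ∈ N, beta n • v ∈ N)
    (hc : ∀ n, ∀ v ∈ N, gamma n • v ∈ N) (a : Ghost) : ∀ v ∈ N, a • v ∈ N := by
  let π : FreeAlgebra ℂ Mode →ₐ[ℂ] Ghost := RingQuot.mkAlgHom ℂ ModeRel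
  obtain ⟨a, rfl⟩ : ∃ a', π a' = a := RingQuot.mkAlgHom_surjective ℂ ModeRel a
  induction a using FreeAlgebra.induction with
  | grade0 r =>
    intro v hv
    rw [AlgHom.commutes, algebraMap_smul]
    exact N.smul_mem r hv
  | grade1 x =>
    cases x with
    | beta n => exact hb n
    | gamma n => exact hc n
  | mul a b ha hb' =>
    intro v hv
    rw [map_mul, mul_smul]
    exact ha _ (hb' v hv)
  | add a b ha hb' =>
    intro v hv
    rw [map_add, add_smul]
    exact N.add_mem (ha v hv) (hb' v hv)

theorem eq_top_of_stable {v0 : M} (hv0 : ∀ v : M, ∃ a : Ghost, a • v0 = v) (N : Submodule ℂ M)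
    (h0 : v0 ∈ N) (hb : ∀ n, ∀ v ∈ N, beta n • v ∈ N) (hc : ∀ n, ∀ v ∈ N, gamma n • v ∈ N) :
    N = ⊤ := by
  refine eq_top_iff.2 fun v _ => ?_
  obtain ⟨a, rfl⟩ := hv0 v
  exact smul_mem_of_stable N hb hc a v0 h0

theorem smul_complex_comm (a : Ghost) (c : ℂ) (v : M) : a • c • v = c • a • v := by
  rw [← algebraMap_smul Ghost c v, ← algebraMap_smul Ghost c (a • v), smul_smul, smul_smul,
    Algebra.commutes]

theorem smooth_of_generator {v0 : M} (hv0 : ∀ v : M, ∃ a : Ghost, a • v0 = v)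
    (hpos : ∀ n : ℤ, 1 ≤ n → beta n • v0 = 0 ∧ gamma n • v0 = 0) : Smooth M := by
  let N : Submodule ℂ M :=
    { carrier := {v | ∃ N : ℤ, ∀ n, N ≤ n → beta n • v = 0 ∧ gamma n • v = 0}
      zero_mem' := ⟨0, fun n _ => ⟨smul_zero _, smul_zero _⟩⟩
      add_mem' := by
        rintro v w ⟨K, hK⟩ ⟨L, hL⟩
        refine ⟨max K L, fun n hn => ?_⟩
        obtain ⟨h1, h2⟩ := hK n (le_trans (le_max_left _ _) hn)
        obtain ⟨h3, h4⟩ := hL n (le_trans (le_max_right _ _) hn)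
        exact ⟨by rw [smul_add, h1, h3, add_zero], by rw [smul_add, h2, h4, add_zero]⟩
      smul_mem' := by
        rintro c v ⟨K, hK⟩
        refine ⟨K, fun n hn => ⟨?_, ?_⟩⟩
        · rw [smul_complex_comm, (hK n hn).1, smul_zero]
        · rw [smul_complex_comm, (hK n hn).2, smul_zero] }
  have hN : N = ⊤ := by
    refine eq_top_of_stable hv0 N ⟨1, hpos⟩ ?_ ?_
    · rintro m v ⟨K, hK⟩
      refine ⟨max K (1 - m), fun n hn => ?_⟩
      obtain ⟨h1, h2⟩ := hK n (le_trans (le_max_left _ _) hn)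
      have h3 := le_trans (le_max_right K (1 - m)) hn
      refine ⟨by rw [beta_smul_comm, h1, smul_zero], ?_⟩
      rw [gamma_smul_beta_smul, h2, smul_zero, if_neg (by omega), add_zero]
    · rintro m v ⟨K, hK⟩
      refine ⟨max K (1 - m), fun n hn => ?_⟩
      obtain ⟨h1, h2⟩ := hK n (le_trans (le_max_left _ _) hn)
      have h3 := le_trans (le_max_right K (1 - m)) hn
      refine ⟨?_, by rw [gamma_smul_comm, h2, smul_zero]⟩
      have h4 := gamma_smul_beta_smul m n v
      rw [h1, smul_zero, if_neg (by omega), add_zero] at h4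
      exact h4.symm
  intro v
  exact (hN ▸ Submodule.mem_top : v ∈ N)

/-- In a module generated by a vector of weight `j`, all weights lie in `j + ℤ`. -/
theorem iSup_eigenspace_of_generator {v0 : M} (hv0 : ∀ v : M, ∃ a : Ghost, a • v0 = v)
    (h : Smooth M) (j : ℂ) (hj : J0 h v0 = j • v0) :
    ⨆ k : ℤ, Module.End.eigenspace (J0 h) (j + k) = ⊤ := by
  refine eq_top_of_stable hv0 _ ?_ ?_ ?_
  · refine Submodule.mem_iSup_of_mem 0 ?_
    rw [Module.End.mem_eigenspace_iff, hj]
    simp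
  · intro n v hv
    induction hv using Submodule.iSup_induction' with
    | mem k v hv =>
      rw [Module.End.mem_eigenspace_iff] at hv
      refine Submodule.mem_iSup_of_mem (k + 1) ?_
      rw [Module.End.mem_eigenspace_iff, J0_beta, hv, smul_complex_comm]
      push_cast
      rw [← add_assoc, add_smul (j + k), one_smul]
    | zero => rw [smul_zero]; exact Submodule.zero_mem _
    | add v w _ _ h1 h2 => rw [smul_add]; exact Submodule.add_mem _ h1 h2
  · intro n v hv
    induction hv using Submodule.iSup_induction' with
    | mem k v hv =>
      rw [Module.End.mem_eigenspace_iff] at hv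
      refine Submodule.mem_iSup_of_mem (k - 1) ?_
      rw [Module.End.mem_eigenspace_iff, J0_gamma, hv, smul_complex_comm]
      push_cast
      rw [← add_sub_assoc, sub_smul (j + k), one_smul]
    | zero => rw [smul_zero]; exact Submodule.zero_mem _
    | add v w _ _ h1 h2 => rw [smul_add]; exact Submodule.add_mem _ h1 h2

theorem isWeightModule_of_iSup (h : Smooth M) (j : ℂ)
    (hj : ⨆ k : ℤ, Module.End.eigenspace (J0 h) (j + k) = ⊤) : IsWeightModule M where
  smooth := h
  semisimple := eq_top_iff.2 (hj ▸ iSup_le fun k =>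
    le_iSup (fun i : ℂ => Module.End.eigenspace (J0 h) i) (j + k))

theorem hasRealWeights_of_iSup (h : Smooth M) (j : ℂ) (hreal : j.im = 0)
    (hj : ⨆ k : ℤ, Module.End.eigenspace (J0 h) (j + k) = ⊤) : HasRealWeights M := by
  refine ⟨h, fun i hi => ?_⟩
  by_contra hne
  have hdis := Module.End.eigenspaces_iSupIndep (J0 h) i
  have hle : (⊤ : Submodule ℂ M) ≤ ⨆ (i') (_ : i' ≠ i), Module.End.eigenspace (J0 h) i' := by
    rw [← hj]
    refine iSup_le fun k => le_iSup₂_of_le (j + k) ?_ le_rfl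
    rintro rfl
    exact hne (by simp [hreal])
  rw [top_le_iff.1 hle, disjoint_top] at hdis
  exact hi hdis

/-- The space `U v` generated from a vector by the positive modes. -/
def positiveSpan (v : M) : Submodule ℂ M :=
  (Subalgebra.toSubmodule positiveModes).map
    ((LinearMap.toSpanSingleton Ghost M v).restrictScalars ℂ)

theorem mem_positiveSpan {v w : M} : w ∈ positiveSpan v ↔ ∃ a ∈ positiveModes, a • v = w := Iff.rfl

theorem positiveSpan_le_of_commutator {v : M} (x : Ghost)
    (hx : ∀ a ∈ positiveModes, a * x - x * a ∈ positiveModes) :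
    positiveSpan (x • v) ≤ (positiveSpan v).map
      (Module.toModuleEnd ℂ (S := Ghost) M x : M →ₗ[ℂ] M) ⊔ positiveSpan v := by
  rintro _ ⟨a, ha, rfl⟩
  change a • x • v ∈ _
  have : a • x • v = x • a • v + (a * x - x * a) • v := by
    rw [sub_smul, mul_smul, mul_smul]; abel
  rw [this]
  exact Submodule.add_mem_sup ⟨a • v, ⟨a, ha, rfl⟩, rfl⟩ ⟨_, hx a ha, rfl⟩

theorem commutator_mem (x : Ghost)
    (hb : ∀ n : ℤ, 1 ≤ n → beta n * x - x * beta n ∈ positiveModes)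
    (hc : ∀ n : ℤ, 1 ≤ n → gamma n * x - x * gamma n ∈ positiveModes) :
    ∀ a ∈ positiveModes, a * x - x * a ∈ positiveModes := by
  intro a ha
  induction ha using Algebra.adjoin_induction with
  | mem a ha =>
    rcases ha with ⟨n, hn, rfl⟩ | ⟨n, hn, rfl⟩
    · exact hb n hn
    · exact hc n hn
  | algebraMap r =>
    rw [Algebra.commutes, sub_self]
    exact Subalgebra.zero_mem _
  | add a b _ _ h1 h2 =>
    have : (a + b) * x - x * (a + b) = (a * x - x * a) + (b * x - x * b) := by
      rw [add_mul, mul_add]; abel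
    rw [this]
    exact Subalgebra.add_mem _ h1 h2
  | mul a b ha hb h1 h2 =>
    have : a * b * x - x * (a * b) = a * (b * x - x * b) + (a * x - x * a) * b := by
      rw [mul_sub, sub_mul, mul_assoc, mul_assoc, mul_assoc]; abel
    rw [this]
    exact Subalgebra.add_mem _ (Subalgebra.mul_mem _ ha h2) (Subalgebra.mul_mem _ h1 hb)

theorem ite_mem_positiveModes (p : Prop) [Decidable p] :
    (if p then 1 else 0 : Ghost) ∈ positiveModes := by
  split_ifs
  · exact Subalgebra.one_mem _
  · exact Subalgebra.zero_mem _

theorem positiveSpan_finite {v0 : M} (hv0 : ∀ v : M, ∃ a : Ghost, a • v0 = v)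
    (hpos : ∀ n : ℤ, 1 ≤ n → beta n • v0 = 0 ∧ gamma n • v0 = 0) (v : M) :
    FiniteDimensional ℂ (positiveSpan v) := by
  have hstep : ∀ (x : Ghost), (∀ a ∈ positiveModes, a * x - x * a ∈ positiveModes) → ∀ v : M,
      FiniteDimensional ℂ (positiveSpan v) → FiniteDimensional ℂ (positiveSpan (x • v)) :=
    fun x hx v _ => Submodule.finiteDimensional_of_le (positiveSpan_le_of_commutator x hx)
  let N : Submodule ℂ M :=
    { carrier := {v | FiniteDimensional ℂ (positiveSpan v)}
      zero_mem' := by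
        refine Submodule.finiteDimensional_of_le (S₂ := ⊥) ?_
        rintro _ ⟨a, _, rfl⟩
        exact smul_zero a
      add_mem' := by
        intro v w (hv : FiniteDimensional ℂ _) (hw : FiniteDimensional ℂ _)
        refine Submodule.finiteDimensional_of_le (S₂ := positiveSpan v ⊔ positiveSpan w) ?_
        rintro _ ⟨a, ha, rfl⟩
        change a • (v + w) ∈ _
        rw [smul_add]
        exact Submodule.add_mem_sup ⟨a, ha, rfl⟩ ⟨a, ha, rfl⟩
      smul_mem' := by
        intro c v (hv : FiniteDimensional ℂ _)
        refine Submodule.finiteDimensional_of_le (S₂ := positiveSpan v) ?_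
        rintro _ ⟨a, ha, rfl⟩
        change a • c • v ∈ _
        rw [smul_complex_comm]
        exact Submodule.smul_mem _ c ⟨a, ha, rfl⟩ }
  have hN : N = ⊤ := by
    refine eq_top_of_stable hv0 N ?_ ?_ ?_
    · have hle : positiveSpan v0 ≤ Submodule.span ℂ {v0} := by
        rintro _ ⟨a, ha, rfl⟩
        change a • v0 ∈ _
        induction ha using Algebra.adjoin_induction with
        | mem a ha =>
          rcases ha with ⟨n, hn, rfl⟩ | ⟨n, hn, rfl⟩
          · rw [(hpos n hn).1]; exact Submodule.zero_mem _
          · rw [(hpos n hn).2]; exact Submodule.zero_mem _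
        | algebraMap r =>
          rw [algebraMap_smul]
          exact Submodule.smul_mem _ _ (Submodule.mem_span_singleton_self v0)
        | add a b _ _ h1 h2 => rw [add_smul]; exact Submodule.add_mem _ h1 h2
        | mul a b _ _ h1 h2 =>
          obtain ⟨c, hc⟩ := Submodule.mem_span_singleton.1 h2
          rw [mul_smul, ← hc, smul_complex_comm]
          exact Submodule.smul_mem _ _ h1
      exact Submodule.finiteDimensional_of_le hle
    · refine fun n v hv => hstep (beta n) (commutator_mem _ (fun m _ => ?_) fun m _ => ?_) v hv
      · rw [beta_mul_beta, sub_self]; exact Subalgebra.zero_mem _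
      · rw [gamma_mul_beta, add_sub_cancel_left]; exact ite_mem_positiveModes _
    · refine fun n v hv => hstep (gamma n) (commutator_mem _ (fun m _ => ?_) fun m _ => ?_) v hv
      · rw [gamma_mul_beta, sub_add_cancel_left]
        exact Subalgebra.neg_mem _ (ite_mem_positiveModes _)
      · rw [gamma_mul_gamma, sub_self]; exact Subalgebra.zero_mem _
  exact (hN ▸ Submodule.mem_top : v ∈ N)

theorem J0_generator (h : Smooth M) {v0 : M}
    (hpos : ∀ n : ℤ, 1 ≤ n → beta n • v0 = 0 ∧ gamma n • v0 = 0) :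
    J0 h v0 = gamma 0 • beta 0 • v0 := by
  have : ∀ n : ℕ, jTerm n v0 = 0 := fun n => by
    simp only [jTerm, (hpos (n + 1) (by omega)).1, (hpos (n + 1) (by omega)).2, smul_zero, add_zero]
  simp [J0, this]

end Generation

section Flow

variable (l : ℤ) (M : ModuleCat.{0} Ghost)

theorem flow_beta (n : ℤ) (v : M) :
    (beta n • (show flow l M from v) : flow l M) = (beta (n + l) • v : M) := by
  change (spectralFlow (-l) (beta n) • v : M) = _
  rw [spectralFlow, liftModes_beta, sub_neg_eq_add]

theorem flow_gamma (n : ℤ) (v : M) :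
    (gamma n • (show flow l M from v) : flow l M) = (gamma (n - l) • v : M) := by
  change (spectralFlow (-l) (gamma n) • v : M) = _
  rw [spectralFlow, liftModes_gamma, sub_eq_add_neg]

theorem flow_complex_smul (c : ℂ) (v : M) :
    (c • (show flow l M from v) : flow l M) = (c • v : M) := by
  change (spectralFlow (-l) (algebraMap ℂ Ghost c) • v : M) = algebraMap ℂ Ghost c • v
  rw [AlgHom.commutes]

variable {M}

theorem smooth_flow (h : Smooth M) : Smooth (flow l M) := fun v => by
  obtain ⟨N, hN⟩ := h v
  refine ⟨N + |l|, fun n hn => ⟨?_, ?_⟩⟩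
  · exact (flow_beta l M n v).trans (hN (n + l) (by have := neg_abs_le l; omega)).1
  · exact (flow_gamma l M n v).trans (hN (n - l) (by have := le_abs_self l; omega)).2

theorem bTerm_flow (m : ℤ) (v : M) :
    bTerm m (show flow l M from v) = (bTerm (m - l) v : M) := by
  have h := flow_gamma l M m v
  have h' := flow_beta l M (-m) (gamma (m - l) • v)
  simp only [bTerm]
  refine (congrArg _ h).trans (h'.trans ?_)
  rw [show -m + l = -(m - l) by ring]

theorem partialJ_flow (a b : ℕ) (v : M) :
    partialJ a b (show flow l M from v) = (shiftedJ l a b v : M) := by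
  simp only [partialJ, shiftedJ]
  have h0 := bTerm_flow l 0 v
  rw [zero_sub] at h0
  exact congrArg₂ (fun x y : M => x + y + v)
    (congrArg₂ (fun x y : M => x + y)
      (Finset.sum_congr rfl fun n _ => bTerm_flow l (n + 1) v) h0)
    (Finset.sum_congr rfl fun n _ =>
      congrArg (fun x : M => x + v) (bTerm_flow l (-(n + 1)) v))

/-- Spectral flow shifts the ghost weight: on the twist by `σ^l` the zero mode `J_0` acts as
`J_0 - l`. -/
theorem J0_flow (h : Smooth M) (v : M) :
    J0 (smooth_flow l h) (show flow l M from v) = (J0 h v - (l : ℂ) • v : M) := by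
  obtain ⟨N, hN⟩ := J0_sub_eq_shiftedJ h v l
  obtain ⟨N', hN'⟩ := J0_eq_partialJ (smooth_flow l h) (show flow l M from v)
  rw [hN (N + N') (N + N') (by omega) (by omega)]
  exact (hN' (N + N') (N + N') (by omega) (by omega)).trans (partialJ_flow l _ _ v)

theorem isF_flow (h : Smooth M) (j : ℂ) (hreal : j.im = 0)
    (hj : ⨆ k : ℤ, Module.End.eigenspace (J0 h) (j + k) = ⊤) (hR : IsR M) : IsF (flow l M) := by
  have key : ⨆ k : ℤ, Module.End.eigenspace (J0 (smooth_flow l h)) (j + k) = ⊤ := by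
    suffices hall : ∀ w : M, w ∈ ⨆ k : ℤ, Module.End.eigenspace (J0 h) (j + k) →
        (show flow l M from w) ∈
          ⨆ k : ℤ, Module.End.eigenspace (J0 (smooth_flow l h)) (j + k) from
      eq_top_iff.2 fun w _ => hall w (hj ▸ Submodule.mem_top)
    intro w hw
    induction hw using Submodule.iSup_induction' with
    | mem k v hv =>
      rw [Module.End.mem_eigenspace_iff] at hv
      refine Submodule.mem_iSup_of_mem (k - l) ?_
      rw [Module.End.mem_eigenspace_iff]
      refine (J0_flow l h v).trans (Eq.trans ?_ (flow_complex_smul l M _ v).symm)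
      rw [hv, ← sub_smul]
      push_cast
      rw [add_sub_assoc]
    | zero => exact Submodule.zero_mem _
    | add v w _ _ h1 h2 =>
      exact Submodule.add_mem _ h1 h2
  exact ⟨isWeightModule_of_iSup _ j key, hasRealWeights_of_iSup _ j hreal key, .flow l M hR⟩

/-- Modules generated by a vector of real weight which is annihilated by the positive modes. -/
theorem isF_flow_of_generator {v0 : M} (hv0 : ∀ v : M, ∃ a : Ghost, a • v0 = v)
    (hpos : ∀ n : ℤ, 1 ≤ n → beta n • v0 = 0 ∧ gamma n • v0 = 0) (j : ℂ) (hreal : j.im = 0)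
    (hj : gamma 0 • beta 0 • v0 = j • v0) : IsF (flow l M) := by
  have h := smooth_of_generator hv0 hpos
  have hw := iSup_eigenspace_of_generator hv0 h j ((J0_generator h hpos).trans hj)
  refine isF_flow l h j hreal hw ⟨isWeightModule_of_iSup h j hw, ?_, positiveSpan_finite hv0 hpos⟩
  refine ⟨⟨{v0}, ?_⟩⟩
  rw [Finset.coe_singleton, eq_top_iff]
  intro v _
  obtain ⟨a, rfl⟩ := hv0 v
  exact Submodule.smul_mem _ a (Submodule.mem_span_singleton_self v0)

end Flow

section Objects

variable {V : Type} [AddCommGroup V] [Module ℂ V] (p q : Module.End ℂ V) (hpq : p * q - q * p = 1)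

theorem induced_beta (n : ℤ) (v : FockSpace V) :
    (beta n • (show induced p q hpq from v) : induced p q hpq) = betaOp p n v := by
  change liftModes (betaOp p) (gammaOp q) _ _ _ (beta n) v = _
  rw [liftModes_beta]

theorem induced_gamma (n : ℤ) (v : FockSpace V) :
    (gamma n • (show induced p q hpq from v) : induced p q hpq) = gammaOp q n v := by
  change liftModes (betaOp p) (gammaOp q) _ _ _ (gamma n) v = _
  rw [liftModes_gamma]

theorem induced_complex_smul (c : ℂ) (v : FockSpace V) :
    (c • (show induced p q hpq from v) : induced p q hpq) = (c • v : FockSpace V) := by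
  change liftModes (betaOp p) (gammaOp q) _ _ _ (algebraMap ℂ Ghost c) v = _
  rw [AlgHom.commutes]
  rfl

/-- An induced module is generated by any generator of the module over the Weyl algebra. -/
theorem induced_generator (v0 : V)
    (hV : ∀ N : Submodule ℂ V, v0 ∈ N → (∀ v ∈ N, p v ∈ N) → (∀ v ∈ N, q v ∈ N) → N = ⊤)
    (v : induced p q hpq) : ∃ a : Ghost, a • (show induced p q hpq from vec 1 v0) = v := by
  let S : Submodule Ghost (induced p q hpq) :=
    Submodule.span Ghost {(show induced p q hpq from vec 1 v0)}
  suffices h : v ∈ S from Submodule.mem_span_singleton.1 h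
  have hc : ∀ (c : ℂ) (w : FockSpace V), (show induced p q hpq from w) ∈ S →
      (show induced p q hpq from (c • w : FockSpace V)) ∈ S := fun c w hw => by
    rw [← induced_complex_smul p q hpq]
    exact S.smul_mem (algebraMap ℂ Ghost c) hw
  have hβ : ∀ (n : ℤ) (w : FockSpace V), (show induced p q hpq from w) ∈ S →
      (show induced p q hpq from betaOp p n w) ∈ S := fun n w hw => by
    rw [← induced_beta p q hpq]
    exact S.smul_mem (beta n) hw
  have hγ : ∀ (n : ℤ) (w : FockSpace V), (show induced p q hpq from w) ∈ S →
      (show induced p q hpq from gammaOp q n w) ∈ S := fun n w hw => by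
    rw [← induced_gamma p q hpq]
    exact S.smul_mem (gamma n) hw
  let N : Submodule ℂ V :=
    { carrier := {u | (show induced p q hpq from vec 1 u) ∈ S}
      zero_mem' := by
        have : (vec 1 (0 : V) : FockSpace V) = 0 := TensorProduct.tmul_zero _ _
        exact (congrArg (· ∈ S) this).mpr S.zero_mem
      add_mem' := fun {u w} hu hw => by
        have : (vec 1 (u + w) : FockSpace V) = vec 1 u + vec 1 w := TensorProduct.tmul_add _ _ _
        exact (congrArg (· ∈ S) this).mpr (S.add_mem hu hw)
      smul_mem' := fun c u hu => by
        have : (vec 1 (c • u) : FockSpace V) = c • vec 1 u := TensorProduct.tmul_smul _ _ _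
        exact (congrArg (· ∈ S) this).mpr (hc c _ hu) }
  have hN : N = ⊤ := by
    refine hV N (Submodule.mem_span_singleton_self _) (fun u hu => ?_) fun u hu => ?_
    · have h1 := S.neg_mem (hβ 0 _ hu)
      have h2 : -(betaOp p 0 (vec 1 u)) = vec 1 (p u) := by
        change -((-coeffOp p) (vec 1 u)) = _
        rw [LinearMap.neg_apply, neg_neg]
        rfl
      exact (congrArg (· ∈ S) h2).mp h1
    · exact hγ 0 _ hu
  have hpoly : ∀ (f : MvPolynomial (ℕ ⊕ ℕ) ℂ) (u : V), (show induced p q hpq from vec f u) ∈ S := by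
    intro f
    induction f using MvPolynomial.induction_on with
    | C c =>
      intro u
      have h1 : (vec (MvPolynomial.C c) u : FockSpace V) = c • vec 1 u := by
        rw [← mul_one (MvPolynomial.C c), ← MvPolynomial.smul_eq_C_mul]
        exact TensorProduct.smul_tmul' c _ _
      have h2 : u ∈ N := hN ▸ Submodule.mem_top
      exact (congrArg (· ∈ S) h1).mpr (hc c _ h2)
    | add f g hf hg =>
      intro u
      have : (vec (f + g) u : FockSpace V) = vec f u + vec g u := TensorProduct.add_tmul _ _ _
      exact (congrArg (· ∈ S) this).mpr (S.add_mem (hf u) (hg u))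
    | mul_X f i hf =>
      intro u
      rw [mul_comm]
      rcases i with n | n
      · exact hβ (Int.negSucc n) _ (hf u)
      · exact hγ (Int.negSucc n) _ (hf u)
  have hall : ∀ w : MvPolynomial (ℕ ⊕ ℕ) ℂ ⊗[ℂ] V, (show induced p q hpq from w) ∈ S := by
    intro w
    induction w using TensorProduct.induction_on with
    | zero => exact S.zero_mem
    | tmul f u => exact hpoly f u
    | add x y hx hy => exact S.add_mem hx hy
  exact hall v

theorem induced_positive (v0 : V) (n : ℤ) (hn : 1 ≤ n) :
    beta n • (show induced p q hpq from vec 1 v0) = 0 ∧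
      gamma n • (show induced p q hpq from vec 1 v0) = 0 := by
  obtain ⟨m, rfl⟩ : ∃ m : ℕ, n = Int.ofNat (m + 1) :=
    ⟨(n - 1).toNat, by rw [show Int.ofNat ((n - 1).toNat + 1) = ((n - 1).toNat : ℤ) + 1 from rfl]
                       omega⟩
  have h0 : ∀ i, dX i 1 = 0 := fun i => by simp [dX]
  have hz : (vec (0 : MvPolynomial (ℕ ⊕ ℕ) ℂ) v0 : FockSpace V) = 0 := TensorProduct.zero_tmul _ _
  constructor
  · refine (induced_beta p q hpq _ _).trans ?_
    change -(vec (dX (.inr m) 1) v0 : FockSpace V) = 0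
    rw [h0, hz, neg_zero]
  · refine (induced_gamma p q hpq _ _).trans ?_
    change (vec (dX (.inl m) 1) v0 : FockSpace V) = 0
    rw [h0, hz]

theorem isF_flow_induced (v0 : V)
    (hV : ∀ N : Submodule ℂ V, v0 ∈ N → (∀ v ∈ N, p v ∈ N) → (∀ v ∈ N, q v ∈ N) → N = ⊤)
    (j : ℂ) (hreal : j.im = 0) (hj : q (p v0) = -(j • v0)) (l : ℤ) :
    IsF (flow l (induced p q hpq)) := by
  refine isF_flow_of_generator l (induced_generator p q hpq v0 hV)
    (induced_positive p q hpq v0) j hreal ?_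
  have h1 : (vec 1 (q (p v0)) : FockSpace V) = -(j • vec 1 v0) := by
    rw [hj]
    exact (TensorProduct.tmul_neg _ _).trans (congrArg Neg.neg (TensorProduct.tmul_smul _ _ _))
  rw [induced_complex_smul, induced_beta, induced_gamma]
  change coeffOp q ((-coeffOp p) (vec 1 v0)) = (j • vec 1 v0 : FockSpace V)
  rw [LinearMap.neg_apply, map_neg, coeffOp_vec, coeffOp_vec, h1, neg_neg]

end Objects

theorem isF_vacuum (k : ℤ) : IsF (flow k vacuum) := by
  refine isF_flow_induced (V := Polynomial ℂ) _ _ _ 1 (fun N h1 _ hq => ?_) 0 rfl ?_ k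
  · refine eq_top_iff.2 fun f _ => ?_
    induction f using Polynomial.induction_on' with
    | add f g hf hg => exact N.add_mem (hf Submodule.mem_top) (hg Submodule.mem_top)
    | monomial n a =>
      have : ∀ n : ℕ, (Polynomial.X ^ n : Polynomial ℂ) ∈ N := fun n => by
        induction n with
        | zero => simpa using h1
        | succ n ih => rw [pow_succ']; exact hq _ ih
      rw [← Polynomial.smul_X_eq_monomial]
      exact N.smul_mem a (this n)
  · simp

theorem isF_typical (μ : ℝ) (hμ : ∀ n : ℤ, μ ≠ n) (k : ℤ) : IsF (flow k (typical μ)) := by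
  have hp : ∀ (n : ℤ) (a : ℂ), denseP μ (Finsupp.single n a) =
      ((μ : ℂ) + n) • Finsupp.single (n - 1) a := fun n a => by simp [denseP]
  have hq : ∀ (n : ℤ) (a : ℂ), denseQ (Finsupp.single n a) = Finsupp.single (n + 1) a :=
    fun n a => by simp [denseQ]
  have hne : ∀ n : ℤ, (μ : ℂ) + n ≠ 0 := fun n h => hμ (-n) (by
    have h' : ((μ + n : ℝ) : ℂ) = 0 := by push_cast; exact h
    have h'' : μ + n = 0 := by exact_mod_cast h'
    push_cast
    linarith)
  refine isF_flow_induced (V := ℤ →₀ ℂ) _ _ _ (Finsupp.single 0 1) (fun N h0 hpN hqN => ?_)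
    (-(μ : ℂ)) (by simp) ?_ k
  · have hall : ∀ n : ℤ, (Finsupp.single n 1 : ℤ →₀ ℂ) ∈ N := fun n => by
      induction n using Int.induction_on with
      | zero => exact h0
      | succ i ih =>
        have := hqN _ ih
        rwa [hq] at this
      | pred i ih =>
        have := N.smul_mem ((μ : ℂ) + (-(i : ℤ) : ℤ))⁻¹ (hpN _ ih)
        rwa [hp, smul_smul, inv_mul_cancel₀ (hne _), one_smul] at this
    refine eq_top_iff.2 fun f _ => ?_
    induction f using Finsupp.induction_linear with
    | zero => exact N.zero_mem
    | add f g hf hg => exact N.add_mem (hf Submodule.mem_top) (hg Submodule.mem_top)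
    | single n a =>
      have := N.smul_mem a (hall n)
      simpa using this
  · rw [hp, map_smul, hq]
    simp

/-- The object `σ^k V` of the category `F`. -/
def vacuumF (k : ℤ) : CatF := ⟨flow k vacuum, isF_vacuum k⟩

/-- The object `σ^k W_μ` of the category `F`, for a real number `μ` that is not an integer. -/
def typicalF (μ : ℝ) (hμ : ∀ n : ℤ, μ ≠ n) (k : ℤ) : CatF := ⟨flow k (typical μ), isF_typical μ hμ k⟩

end

end BosonicGhost

/-! Everything is governed by the commuting number operators `number n` = γ_{-n} β_n. The mode β_n
raises the eigenvalue of `number n` by one, γ_{-n} lowers it by one, and all other modes preserve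
it. Hence the generalized eigenvalues of `number n` are 0, -1, -2, … where β_n is locally nilpotent
(`eq_zero_of_beta`) and 1, 2, 3, … where γ_{-n} is (`eq_zero_of_gamma`), so these spectra detect
spectral flow. Generalized eigenvectors are needed because in F only J_0 is assumed semisimple.

The modules W_μ. An object of F has a finite filtration whose subquotients satisfy `NilAt l` for
various l. Dévissage and a twist reduce to splitting an extension of the untwisted W_μ and one such
module. If l ≠ 0, then β_0 or γ_0 is locally nilpotent on that module, so `number 0` has integral
generalized eigenvalues there; on W_μ they lie in -μ + ℤ, and a Bézout identity between annihilating
polynomials splits the sequence (`exists_isCompl_of_disjoint`). If l = 0, all positive modes are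
locally nilpotent on the middle term, and the semisimplicity of J_0 makes the middle term generated
by vacuum vectors (`span_isVacuumVector`). For W_μ as quotient, some vacuum vector maps to a
non-zero multiple of a generator of W_μ, and the universal property `exists_hom_of_typical` gives a
section. For W_μ as submodule, dividing out the vacuum vectors of foreign weight leaves a sum of
images of the simple module W_μ; this is semisimple, so W_μ is a direct summand. Projectivity and
injectivity follow by pullback and pushout, once epimorphisms of F are known to be surjective and
monomorphisms injective.

The vacuum modules. In an extension of σ^k V by σ^l V the generating vector of σ^k V lifts to a
joint generalized eigenvector v of all number operators (`exists_joint_isGenEigen`). A mode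
annihilating the generating vector sends v into σ^l V, with a shifted joint weight. Such a weight
does not occur in σ^l V, except possibly for β_{-k} when l = k - 1 and for γ_{k+1} when l = k + 1.
Outside these cases v satisfies the defining relations of σ^k V and the sequence splits. In them the
mode maps v to c times the generating vector of σ^l V; c is compatible with Baer sums and scalars,
and c = 0 forces splitting, so the dimension is at most one. Twists of modules induced from ℂ[x,
x⁻¹] and from a variant of it provide non-split extensions. -/

namespace BosonicGhost

noncomputable section

/-! ### Locally finite and locally nilpotent elements -/

section LocallyFinite

open Polynomial

/-- The number operator `γ_{-n} β_n`. -/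
def number (n : ℤ) : Ghost := gamma (-n) * beta n

theorem number_mul_beta (m n : ℤ) :
    number m * beta n = beta n * (number m + algebraMap ℂ Ghost (if m = n then 1 else 0)) := by
  rw [number, mul_assoc, beta_mul_beta, ← mul_assoc, gamma_mul_beta, add_mul, mul_add, mul_assoc]
  congr 1
  by_cases h : m = n
  · subst h; simp
  · rw [if_neg (by omega), if_neg h]; simp

theorem number_mul_gamma (m n : ℤ) :
    number m * gamma n = gamma n * (number m + algebraMap ℂ Ghost (if m = -n then -1 else 0)) := by
  have h := gamma_mul_beta n m
  rw [← sub_eq_iff_eq_add] at h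
  rw [number, mul_assoc, ← h, mul_sub, ← mul_assoc, gamma_mul_gamma, mul_add, sub_eq_add_neg,
    mul_assoc]
  congr 1
  by_cases h : m = -n
  · subst h; simp
  · rw [if_neg (by omega), if_neg h]; simp

/-- The shifts of `number m` on passing γ_{-n} and on passing β_n are opposite, so they cancel in
the product. -/
theorem number_commute (m n : ℤ) : Commute (number m) (number n) := by
  change number m * number n = number n * number m
  conv_lhs => rw [number.eq_1 n, ← mul_assoc, number_mul_gamma, mul_assoc, add_mul,
    number_mul_beta, Algebra.commutes, ← mul_add, add_assoc, ← map_add]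
  have : (if m = n then (1 : ℂ) else 0) + (if m = - -n then -1 else 0) = 0 := by
    by_cases h : m = n <;> simp [h]
  rw [this, map_zero, add_zero, ← mul_assoc, number.eq_1 n]

theorem beta_mul_gamma_neg (n : ℤ) : beta n * gamma (-n) = number n - 1 := by
  rw [number, gamma_mul_beta, if_pos (by omega), add_sub_cancel_right]

variable {M : Type} [AddCommGroup M] [Module Ghost M]

/-- The vector `v` is annihilated by a non-zero polynomial in `b` with all its roots in `T`. -/
def LocallyFinite (T : Set ℂ) (b : Ghost) (v : M) : Prop :=
  ∃ f : ℂ[X], f ≠ 0 ∧ (∀ c, f.IsRoot c → c ∈ T) ∧ aeval b f • v = 0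

/-- The vector `v` is a generalized eigenvector of `b` for the eigenvalue `c`. -/
def IsGenEigen (c : ℂ) (b : Ghost) (v : M) : Prop :=
  ∃ a : ℕ, (b - algebraMap ℂ Ghost c) ^ a • v = 0

/-- The element `b` acts nilpotently on `v`. -/
def IsNilpotentOn (b : Ghost) (v : M) : Prop := ∃ r : ℕ, b ^ r • v = 0

theorem aeval_mul_comm (b : Ghost) (f g : ℂ[X]) (v : M) :
    aeval b f • aeval b g • v = aeval b g • aeval b f • v := by
  rw [smul_smul, smul_smul, ← map_mul, ← map_mul, mul_comm]

theorem aeval_mul_of_shift {b x : Ghost} {t : ℂ} (h : b * x = x * (b + algebraMap ℂ Ghost t))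
    (f : ℂ[X]) : aeval b f * x = x * aeval b (f.comp (X + C t)) := by
  induction f using Polynomial.induction_on' with
  | add f g hf hg => rw [map_add, add_mul, hf, hg, add_comp, map_add, mul_add]
  | monomial n a =>
    have hp : b ^ n * x = x * (b + algebraMap ℂ Ghost t) ^ n :=
      ((show SemiconjBy x (b + algebraMap ℂ Ghost t) b from h.symm).pow_right n).symm
    simp only [aeval_monomial, mul_assoc, hp, monomial_comp, map_mul, aeval_C, map_pow, map_add,
      aeval_X]
    rw [← mul_assoc, ← mul_assoc, Algebra.commutes]

theorem aeval_smul_of_eigen {b : Ghost} {c : ℂ} {v : M} (h : b • v = algebraMap ℂ Ghost c • v)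
    (f : ℂ[X]) : aeval b f • v = algebraMap ℂ Ghost (f.eval c) • v := by
  induction f using Polynomial.induction_on' with
  | add f g hf hg => simp only [map_add, add_smul, hf, hg, eval_add]
  | monomial n a =>
    have hp : b ^ n • v = algebraMap ℂ Ghost (c ^ n) • v := by
      induction n with
      | zero => simp
      | succ n ih =>
        rw [pow_succ, mul_smul, h, ← mul_smul, ← Algebra.commutes, mul_smul, ih, ← mul_smul,
          ← map_mul, pow_succ, mul_comm]
    rw [aeval_monomial, mul_smul, hp, eval_monomial, ← mul_smul, map_mul]

theorem LocallyFinite.zero (T : Set ℂ) (b : Ghost) : LocallyFinite T b (0 : M) :=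
  ⟨1, one_ne_zero, fun c hc => by simp at hc, smul_zero _⟩

theorem LocallyFinite.add {T : Set ℂ} {b : Ghost} {v w : M} (hv : LocallyFinite T b v)
    (hw : LocallyFinite T b w) : LocallyFinite T b (v + w) := by
  obtain ⟨f, h1, h2, h3⟩ := hv
  obtain ⟨g, h4, h5, h6⟩ := hw
  refine ⟨f * g, mul_ne_zero h1 h4, fun c hc => ?_, ?_⟩
  · rcases root_mul.1 hc with h | h
    · exact h2 c h
    · exact h5 c h
  · rw [smul_add, map_mul, mul_smul, mul_smul, h6, aeval_mul_comm, h3, smul_zero, smul_zero,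
      add_zero]

theorem LocallyFinite.smul_of_shift {T : Set ℂ} {b x : Ghost} {t : ℂ}
    (h : b * x = x * (b + algebraMap ℂ Ghost t)) (hT : ∀ c, c - t ∈ T → c ∈ T) {v : M}
    (hv : LocallyFinite T b v) : LocallyFinite T b (x • v) := by
  obtain ⟨f, h1, h2, h3⟩ := hv
  refine ⟨f.comp (X + C (-t)), comp_X_add_C_ne_zero_iff.2 h1, fun c hc => hT c (h2 _ ?_), ?_⟩
  · simpa [IsRoot, sub_eq_add_neg] using hc
  · rw [smul_smul, aeval_mul_of_shift h, comp_assoc]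
    simp [mul_smul, h3]

theorem LocallyFinite.of_aeval {T : Set ℂ} {b : Ghost} {v : M} {f : ℂ[X]} (hf : f ≠ 0)
    (hT : ∀ c, f.IsRoot c → c ∈ T) (h : LocallyFinite T b (aeval b f • v)) :
    LocallyFinite T b v := by
  obtain ⟨g, h1, h2, h3⟩ := h
  refine ⟨g * f, mul_ne_zero h1 hf, fun c hc => ?_, by rw [map_mul, mul_smul, h3]⟩
  rcases root_mul.1 hc with h | h
  · exact h2 c h
  · exact hT c h

theorem LocallyFinite.of_eigen {T : Set ℂ} {b : Ghost} {v : M} {c : ℂ} (hc : c ∈ T)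
    (h : b • v = algebraMap ℂ Ghost c • v) : LocallyFinite T b v := by
  refine ⟨X - C c, X_sub_C_ne_zero c, fun d hd => ?_, ?_⟩
  · rwa [root_X_sub_C.1 hd] at hc
  · simp [sub_smul, h]

theorem isCoprime_of_disjoint {S T : Set ℂ} (hST : Disjoint S T) {f g : ℂ[X]} (hf : f ≠ 0)
    (hfS : ∀ c, f.IsRoot c → c ∈ S) (hgT : ∀ c, g.IsRoot c → c ∈ T) : IsCoprime f g := by
  refine isCoprime_of_dvd _ _ (fun h => hf h.1) fun p hp _ hpf hpg => ?_
  obtain ⟨c, hc⟩ := IsAlgClosed.exists_root p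
    (fun h => hp (isUnit_iff_degree_eq_zero.2 h))
  exact Set.disjoint_left.1 hST (hfS c (hc.dvd hpf)) (hgT c (hc.dvd hpg))

/-- The two annihilating polynomials have no common root, so they are coprime over ℂ, and a Bézout
relation writes 1 as a combination of elements that kill the vector. -/
theorem LocallyFinite.eq_zero {S T : Set ℂ} (hST : Disjoint S T) {b : Ghost} {v : M}
    (h : LocallyFinite S b v) (h' : LocallyFinite T b v) : v = 0 := by
  obtain ⟨f, h1, h2, h3⟩ := h
  obtain ⟨g, h4, h5, h6⟩ := h'
  obtain ⟨r, s, hrs⟩ := isCoprime_of_disjoint hST h1 h2 h5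
  have := congrArg (fun p => aeval b p • v) hrs
  simpa [add_smul, mul_smul, h3, h6] using this.symm

theorem LocallyFinite.map {N : Type} [AddCommGroup N] [Module Ghost N] (φ : M →ₗ[Ghost] N)
    {T : Set ℂ} {b : Ghost} {v : M} (h : LocallyFinite T b v) : LocallyFinite T b (φ v) := by
  obtain ⟨f, h1, h2, h3⟩ := h
  exact ⟨f, h1, h2, by rw [← map_smul, h3, map_zero]⟩

theorem LocallyFinite.of_exact {L N : Type} [AddCommGroup L] [Module Ghost L] [AddCommGroup N]
    [Module Ghost N] {i : L →ₗ[Ghost] M} {p : M →ₗ[Ghost] N} (hip : Function.Exact i p)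
    {T : Set ℂ} {b : Ghost} (hL : ∀ y : L, LocallyFinite T b y) {v : M}
    (hv : LocallyFinite T b (p v)) : LocallyFinite T b v := by
  obtain ⟨f, h1, h2, h3⟩ := hv
  rw [← map_smul] at h3
  obtain ⟨y, hy⟩ := (hip _).1 h3
  exact .of_aeval h1 h2 (hy ▸ (hL y).map i)

theorem beta_mul_aeval (n : ℤ) (f : ℂ[X]) :
    aeval (number n) f * beta n = beta n * aeval (number n) (f.comp (X + C 1)) :=
  aeval_mul_of_shift (by rw [number_mul_beta, if_pos rfl]) f

theorem gamma_mul_aeval (n : ℤ) (f : ℂ[X]) :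
    aeval (number n) f * gamma (-n) = gamma (-n) * aeval (number n) (f.comp (X + C (-1))) :=
  aeval_mul_of_shift (by rw [number_mul_gamma, if_pos (by omega)]) f

/-- On vectors on which `β_n` or `γ_{-n}` is nilpotent, the number operator has integral
generalized eigenvalues. -/
theorem locallyFinite_of_beta {n : ℤ} {v : M} (h : IsNilpotentOn (beta n) v) :
    LocallyFinite (Set.range ((↑) : ℤ → ℂ)) (number n) v := by
  obtain ⟨r, hr⟩ := h
  induction r generalizing v with
  | zero =>
    rw [pow_zero, one_smul] at hr
    exact hr ▸ .zero _ _
  | succ r ih =>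
    rw [pow_succ, mul_smul] at hr
    obtain ⟨f, h1, h2, h3⟩ := ih hr
    rw [smul_smul, beta_mul_aeval, mul_smul] at h3
    -- Write N for the number operator. If f(N) kills β_n v, then β_n f(N + 1) v = 0, and applying
    -- γ_{-n} gives N f(N + 1) v = 0. The roots are 0 and those of f lowered by one.
    refine ⟨X * f.comp (X + C 1), mul_ne_zero X_ne_zero (comp_X_add_C_ne_zero_iff.2 h1),
      fun c hc => ?_, ?_⟩
    · rcases root_mul.1 hc with h | h
      · exact ⟨0, by simpa using h.symm⟩
      · obtain ⟨m, hm⟩ := h2 (c + 1) (by simpa [IsRoot] using h)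
        exact ⟨m - 1, by rw [Int.cast_sub, hm]; simp⟩
    · rw [map_mul, aeval_X, number, mul_assoc, mul_smul, mul_smul, ← number, h3, smul_zero]

theorem locallyFinite_of_gamma {n : ℤ} {v : M} (h : IsNilpotentOn (gamma (-n)) v) :
    LocallyFinite (Set.range ((↑) : ℤ → ℂ)) (number n) v := by
  obtain ⟨r, hr⟩ := h
  induction r generalizing v with
  | zero =>
    rw [pow_zero, one_smul] at hr
    exact hr ▸ .zero _ _
  | succ r ih =>
    rw [pow_succ, mul_smul] at hr
    obtain ⟨f, h1, h2, h3⟩ := ih hr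
    rw [smul_smul, gamma_mul_aeval, mul_smul] at h3
    -- The product in the other order is β_n γ_{-n} = N - 1, so the additional root is 1.
    refine ⟨(X - C 1) * f.comp (X + C (-1)),
      mul_ne_zero (X_sub_C_ne_zero 1) (comp_X_add_C_ne_zero_iff.2 h1), fun c hc => ?_, ?_⟩
    · rcases root_mul.1 hc with h | h
      · exact ⟨1, by simpa using (root_X_sub_C.1 h)⟩
      · obtain ⟨m, hm⟩ := h2 (c + -1) (by simpa [IsRoot] using h)
        exact ⟨m + 1, by rw [Int.cast_add, hm]; simp⟩
    · rw [map_mul, map_sub, aeval_X, aeval_C, map_one, ← beta_mul_gamma_neg, mul_assoc, mul_smul,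
        mul_smul, h3, smul_zero]

/-! ### Generalized eigenvectors -/

theorem IsGenEigen.smul_of_shift {b x : Ghost} {t c : ℂ}
    (h : b * x = x * (b + algebraMap ℂ Ghost t)) {v : M} (hv : IsGenEigen c b v) :
    IsGenEigen (c + t) b (x • v) := by
  obtain ⟨a, ha⟩ := hv
  have : SemiconjBy x (b - algebraMap ℂ Ghost c) (b - algebraMap ℂ Ghost (c + t)) := by
    change x * (b - algebraMap ℂ Ghost c) = (b - algebraMap ℂ Ghost (c + t)) * x
    rw [sub_mul, h, Algebra.commutes, ← mul_sub, map_add]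
    congr 1
    abel
  refine ⟨a, ?_⟩
  rw [smul_smul, ← (this.pow_right a).eq, mul_smul, ha, smul_zero]

theorem IsGenEigen.of_map {N : Type} [AddCommGroup N] [Module Ghost N] {φ : M →ₗ[Ghost] N}
    (hφ : Function.Injective φ) {c : ℂ} {b : Ghost} {v : M} (h : IsGenEigen c b (φ v)) :
    IsGenEigen c b v := by
  obtain ⟨a, ha⟩ := h
  exact ⟨a, hφ (by rw [map_smul, ha, map_zero])⟩

theorem IsGenEigen.of_eigen {c : ℂ} {b : Ghost} {v : M} (h : b • v = algebraMap ℂ Ghost c • v) :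
    IsGenEigen c b v := ⟨1, by rw [pow_one, sub_smul, h, sub_self]⟩

/-- As `b` kills `v`, the power acts on `v` as the invertible scalar (-c)^a. -/
theorem eq_zero_of_eigen {b : Ghost} {v : M} {c : ℂ} (hb : b • v = 0) (hc : c ≠ 0) {a : ℕ}
    (h : (b - algebraMap ℂ Ghost c) ^ a • v = 0) : v = 0 := by
  have h1 : (b - algebraMap ℂ Ghost c) ^ a = aeval b ((X - C c) ^ a) := by simp
  rw [h1, aeval_smul_of_eigen (c := 0) (by simpa using hb)] at h
  have h2 : ((X - C c) ^ a).eval 0 ≠ 0 := by simp [hc]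
  have h3 := congrArg (fun w => algebraMap ℂ Ghost (((X - C c) ^ a).eval 0)⁻¹ • w) h
  simpa only [smul_smul, ← map_mul, inv_mul_cancel₀ h2, map_one, one_smul, smul_zero] using h3

/-- If `β_n` is nilpotent, the generalized eigenvalues of the number operator are `0, -1, …`. -/
theorem eq_zero_of_beta {n : ℤ} {v : M} (h : IsNilpotentOn (beta n) v) {c : ℂ}
    (hc : ∀ m : ℕ, c ≠ -m) (hv : IsGenEigen c (number n) v) : v = 0 := by
  obtain ⟨r, hr⟩ := h
  induction r generalizing v c with
  | zero => rwa [pow_zero, one_smul] at hr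
  | succ r ih =>
    rw [pow_succ, mul_smul] at hr
    -- The vector β_n v has generalized eigenvalue c + 1, again not of the form -m, and a smaller
    -- nilpotency exponent. Once it vanishes, `number n` kills v, which is incompatible with c ≠ 0
    -- unless v = 0.
    have h1 : beta n • v = 0 := by
      refine ih (c := c + 1) (fun m h => hc (m + 1) ?_)
        (hv.smul_of_shift (by rw [number_mul_beta, if_pos rfl])) hr
      rw [eq_sub_of_add_eq h]; push_cast; ring
    obtain ⟨a, ha⟩ := hv
    refine eq_zero_of_eigen (b := number n) ?_ (by simpa using hc 0) ha
    rw [number, mul_smul, h1, smul_zero]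

/-- If `γ_{-n}` is nilpotent, the generalized eigenvalues of the number operator are
`1, 2, …`. -/
theorem eq_zero_of_gamma {n : ℤ} {v : M} (h : IsNilpotentOn (gamma (-n)) v) {c : ℂ}
    (hc : ∀ m : ℕ, c ≠ m + 1) (hv : IsGenEigen c (number n) v) : v = 0 := by
  obtain ⟨r, hr⟩ := h
  induction r generalizing v c with
  | zero => rwa [pow_zero, one_smul] at hr
  | succ r ih =>
    rw [pow_succ, mul_smul] at hr
    -- Here the eigenvalue drops to c - 1, and once γ_{-n} v = 0 it is `number n - 1` that kills v;
    -- the value c = 1 is the excluded case m = 0.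
    have h1 : gamma (-n) • v = 0 := by
      refine ih (c := c + -1) (fun m h => hc (m + 1) ?_)
        (hv.smul_of_shift (by rw [number_mul_gamma, if_pos (by omega)])) hr
      rw [eq_sub_of_add_eq h]; push_cast; ring
    obtain ⟨a, ha⟩ := hv
    refine eq_zero_of_eigen (b := number n - 1) (c := c - 1) ?_
      (by simpa [sub_eq_zero] using hc 0) (a := a) ?_
    · rw [← beta_mul_gamma_neg, mul_smul, h1, smul_zero]
    · rwa [map_sub, map_one, sub_sub_sub_cancel_right]

/-! ### Nilpotency is inherited by generated submodules -/

/-- The commutators of `x` with the modes are scalars. -/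
def HasScalarCommutators (x : Ghost) : Prop :=
  (∀ n, ∃ c : ℂ, x * beta n = beta n * x + algebraMap ℂ Ghost c) ∧
    ∀ n, ∃ c : ℂ, x * gamma n = gamma n * x + algebraMap ℂ Ghost c

theorem hasScalarCommutators_beta (m : ℤ) : HasScalarCommutators (beta m) := by
  refine ⟨fun n => ⟨0, by simp [beta_mul_beta]⟩, fun n => ⟨-(if n + m = 0 then 1 else 0), ?_⟩⟩
  rw [gamma_mul_beta, map_neg]
  split_ifs <;> simp

theorem hasScalarCommutators_gamma (m : ℤ) : HasScalarCommutators (gamma m) := by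
  refine ⟨fun n => ⟨if m + n = 0 then 1 else 0, ?_⟩, fun n => ⟨0, by simp [gamma_mul_gamma]⟩⟩
  rw [gamma_mul_beta]
  split_ifs <;> simp

theorem IsNilpotentOn.zero (x : Ghost) : IsNilpotentOn x (0 : M) := ⟨0, smul_zero _⟩

theorem pow_smul_eq_zero_of_le {x : Ghost} {v : M} {r s : ℕ} (hrs : r ≤ s) (h : x ^ r • v = 0) :
    x ^ s • v = 0 := by
  obtain ⟨t, rfl⟩ := Nat.exists_eq_add_of_le' hrs
  rw [pow_add, mul_smul, h, smul_zero]

theorem IsNilpotentOn.add {x : Ghost} {v w : M} (hv : IsNilpotentOn x v)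
    (hw : IsNilpotentOn x w) : IsNilpotentOn x (v + w) := by
  obtain ⟨r, hr⟩ := hv
  obtain ⟨s, hs⟩ := hw
  exact ⟨max r s, by rw [smul_add, pow_smul_eq_zero_of_le (le_max_left _ _) hr,
    pow_smul_eq_zero_of_le (le_max_right _ _) hs, add_zero]⟩

/-- Since the commutator is central, x^{r+1} y = y x^{r+1} + (r + 1) c x^r, so one additional power
of x suffices. -/
theorem IsNilpotentOn.smul_of_commutator {x y : Ghost} {c : ℂ}
    (h : x * y = y * x + algebraMap ℂ Ghost c) {v : M} (hv : IsNilpotentOn x v) :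
    IsNilpotentOn x (y • v) := by
  obtain ⟨r, hr⟩ := hv
  refine ⟨r + 1, ?_⟩
  induction r generalizing v with
  | zero =>
    rw [pow_zero, one_smul] at hr
    rw [hr, smul_zero, smul_zero]
  | succ r ih =>
    have h1 := ih (v := x • v) (by rwa [pow_succ, mul_smul] at hr)
    rw [pow_succ, mul_smul, smul_smul x, h, add_smul, smul_add, mul_smul, h1, zero_add, smul_smul,
      ← Algebra.commutes, mul_smul, hr, smul_zero]

theorem IsNilpotentOn.map {N : Type} [AddCommGroup N] [Module Ghost N] (φ : M →ₗ[Ghost] N)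
    {b : Ghost} {v : M} (h : IsNilpotentOn b v) : IsNilpotentOn b (φ v) := by
  obtain ⟨a, ha⟩ := h
  exact ⟨a, by rw [← map_smul, ha, map_zero]⟩

theorem IsNilpotentOn.of_map {N : Type} [AddCommGroup N] [Module Ghost N] {φ : M →ₗ[Ghost] N}
    (hφ : Function.Injective φ) {b : Ghost} {v : M} (h : IsNilpotentOn b (φ v)) :
    IsNilpotentOn b v := by
  obtain ⟨a, ha⟩ := h
  exact ⟨a, hφ (by rw [map_smul, ha, map_zero])⟩

theorem IsNilpotentOn.of_exact {L N : Type} [AddCommGroup L] [Module Ghost L] [AddCommGroup N]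
    [Module Ghost N] {i : L →ₗ[Ghost] M} {p : M →ₗ[Ghost] N} (hip : Function.Exact i p)
    {b : Ghost} (hL : ∀ y : L, IsNilpotentOn b y) {v : M}
    (hv : IsNilpotentOn b (p v)) : IsNilpotentOn b v := by
  obtain ⟨r, hr⟩ := hv
  rw [← map_smul] at hr
  obtain ⟨y, hy⟩ := (hip _).1 hr
  obtain ⟨s, hs⟩ := hL y
  exact ⟨s + r, by rw [pow_add, mul_smul, ← hy, ← map_smul, hs, map_zero]⟩

variable [Module ℂ M] [IsScalarTower ℂ Ghost M]

/-- The vectors on which x is nilpotent form a subspace stable under all modes. This lets nilpotency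
be checked on a generator only. -/
theorem IsNilpotentOn.ghost_smul {x : Ghost} (hx : HasScalarCommutators x) {v : M}
    (hv : IsNilpotentOn x v) (a : Ghost) : IsNilpotentOn x (a • v) := by
  have hs : ∀ (c : ℂ) {w : M}, IsNilpotentOn x w → IsNilpotentOn x (c • w) := by
    rintro c w ⟨r, hr⟩
    exact ⟨r, by rw [smul_complex_comm, hr, smul_zero]⟩
  let N : Submodule ℂ M :=
    { carrier := {w | IsNilpotentOn x w}
      zero_mem' := .zero x
      add_mem' := .add
      smul_mem' := fun c w hw => hs c hw }
  exact smul_mem_of_stable N (fun n w hw => (hx.1 n).elim fun _ h => .smul_of_commutator h hw)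
    (fun n w hw => (hx.2 n).elim fun _ h => .smul_of_commutator h hw) a v hv

theorem LocallyFinite.ghost_smul {T : Set ℂ} (hT : ∀ (c : ℂ) (m : ℤ), c + m ∈ T → c ∈ T) {n : ℤ}
    {v : M} (hv : LocallyFinite T (number n) v) (a : Ghost) :
    LocallyFinite T (number n) (a • v) := by
  have hs : ∀ (c : ℂ) {w : M}, LocallyFinite T (number n) w →
      LocallyFinite T (number n) (c • w) := by
    rintro c w ⟨f, h1, h2, h3⟩
    exact ⟨f, h1, h2, by rw [smul_complex_comm, h3, smul_zero]⟩
  let N : Submodule ℂ M :=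
    { carrier := {w | LocallyFinite T (number n) w}
      zero_mem' := .zero _ _
      add_mem' := .add
      smul_mem' := fun c w hw => hs c hw }
  refine smul_mem_of_stable N (fun m w hw => .smul_of_shift (number_mul_beta n m) (fun c hc => ?_)
      hw) (fun m w hw => .smul_of_shift (number_mul_gamma n m) (fun c hc => ?_) hw) a v hv
  · refine hT c (-(if n = m then 1 else 0)) ?_
    split_ifs at hc ⊢ <;> simpa [sub_eq_add_neg] using hc
  · refine hT c (if n = -m then 1 else 0) ?_
    split_ifs at hc ⊢ <;> simpa [sub_eq_add_neg] using hc

end LocallyFinite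

/-! ### Homomorphisms and spectral flow -/

section Hom

variable {M N : Type} [AddCommGroup M] [Module Ghost M] [AddCommGroup N] [Module Ghost N]
  [Module ℂ M] [IsScalarTower ℂ Ghost M] [Module ℂ N] [IsScalarTower ℂ Ghost N]

/-- A linear map which commutes with all modes is a homomorphism of modules. -/
def homOfModes (f : M →ₗ[ℂ] N) (hb : ∀ n v, f (beta n • v) = beta n • f v)
    (hc : ∀ n v, f (gamma n • v) = gamma n • f v) : M →ₗ[Ghost] N where
  toFun := f
  map_add' := map_add f
  map_smul' a v := by
    -- The graph of f is a subspace stable under all modes, hence a submodule over the whole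
    -- algebra, and this is linearity of f.
    have h := smul_mem_of_stable (M := M × N) (LinearMap.graph f)
      (fun n w hw => by
        rw [LinearMap.mem_graph_iff] at hw ⊢
        rw [Prod.smul_fst, Prod.smul_snd, hb, hw])
      (fun n w hw => by
        rw [LinearMap.mem_graph_iff] at hw ⊢
        rw [Prod.smul_fst, Prod.smul_snd, hc, hw]) a (v, f v) ((LinearMap.mem_graph_iff f _).2 rfl)
    exact ((LinearMap.mem_graph_iff f _).1 h).symm

theorem ghost_hom_ext {A : Type*} [Ring A] [Algebra ℂ A] {f g : Ghost →ₐ[ℂ] A}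
    (hb : ∀ n, f (beta n) = g (beta n)) (hc : ∀ n, f (gamma n) = g (gamma n)) : f = g := by
  refine RingQuot.ringQuot_ext' (S := ℂ) (f := f) (g := g) (FreeAlgebra.hom_ext (funext fun x => ?_))
  cases x with
  | beta n => exact hb n
  | gamma n => exact hc n

theorem spectralFlow_beta (l n : ℤ) : spectralFlow l (beta n) = beta (n - l) := by
  rw [spectralFlow, liftModes_beta]

theorem spectralFlow_gamma (l n : ℤ) : spectralFlow l (gamma n) = gamma (n + l) := by
  rw [spectralFlow, liftModes_gamma]

theorem spectralFlow_neg_apply (l : ℤ) (a : Ghost) :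
    spectralFlow (-l) (spectralFlow l a) = a := by
  have : (spectralFlow (-l)).comp (spectralFlow l) = AlgHom.id ℂ Ghost :=
    ghost_hom_ext (fun n => by simp [spectralFlow_beta]) fun n => by simp [spectralFlow_gamma]
  exact DFunLike.congr_fun this a

theorem spectralFlow_apply_neg (l : ℤ) (a : Ghost) :
    spectralFlow l (spectralFlow (-l) a) = a := by
  have := spectralFlow_neg_apply (-l) a
  rwa [neg_neg] at this

end Hom

section FlowHom

variable {M N : ModuleCat.{0} Ghost} (k : ℤ)

theorem flow_smul (a : Ghost) (v : M) :
    (a • (show flow k M from v) : flow k M) = (spectralFlow (-k) a • v : M) := rfl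

/-- The spectral flow of a homomorphism. -/
def flowMap (f : M →ₗ[Ghost] N) : flow k M →ₗ[Ghost] flow k N where
  toFun := f
  map_add' := map_add f
  map_smul' a v := map_smul f (spectralFlow (-k) a) (show M from v)

/-- Homomorphisms from `σ^k M` to `N` are homomorphisms from `M` to `σ^{-k} N`. -/
def homOfFlow (f : M →ₗ[Ghost] flow (-k) N) : flow k M →ₗ[Ghost] N where
  toFun v := (show N from f v)
  map_add' := map_add f
  map_smul' a v := by
    refine (map_smul f (spectralFlow (-k) a) (show M from v)).trans ?_
    refine (flow_smul (M := N) (-k) _ _).trans ?_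
    rw [neg_neg, spectralFlow_apply_neg]
    rfl

/-- Homomorphisms from `σ^k M` to `N` are homomorphisms from `M` to `σ^{-k} N`. -/
def homToFlow (f : flow k M →ₗ[Ghost] N) : M →ₗ[Ghost] flow (-k) N where
  toFun v := (show flow (-k) N from f v)
  map_add' := map_add f
  map_smul' a v := by
    have h : (a • v : M) = (spectralFlow k a • (show flow k M from v) : flow k M) := by
      refine Eq.trans ?_ (flow_smul (M := M) k _ _).symm
      rw [spectralFlow_neg_apply]
    refine (congrArg f h).trans ((map_smul f _ _).trans ?_)
    refine Eq.trans ?_ (flow_smul (M := N) (-k) _ _).symm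
    rw [neg_neg]
    rfl

/-- Homomorphisms from `M` to `σ^k N` are homomorphisms from `σ^{-k} M` to `N`. -/
def homOfFlow' (f : M →ₗ[Ghost] flow k N) : flow (-k) M →ₗ[Ghost] N where
  toFun v := (show N from f v)
  map_add' := map_add f
  map_smul' a v := by
    refine (map_smul f (spectralFlow (- -k) a) (show M from v)).trans ?_
    refine (flow_smul (M := N) k _ _).trans ?_
    rw [spectralFlow_apply_neg (-k)]
    rfl

/-- Homomorphisms from `σ^{-k} M` to `N` are homomorphisms from `M` to `σ^k N`. -/
def homToFlow' (f : flow (-k) M →ₗ[Ghost] N) : M →ₗ[Ghost] flow k N where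
  toFun v := (show flow k N from f v)
  map_add' := map_add f
  map_smul' a v := by
    have h : (a • v : M) = (spectralFlow (-k) a • (show flow (-k) M from v) : flow (-k) M) := by
      refine Eq.trans ?_ (flow_smul (M := M) (-k) _ _).symm
      rw [spectralFlow_neg_apply]
    exact (congrArg f h).trans (map_smul f _ _)

theorem isNilpotentOn_flow (b : Ghost) (v : M) :
    IsNilpotentOn b (show flow k M from v) ↔ IsNilpotentOn (spectralFlow (-k) b) (v : M) := by
  refine exists_congr fun r => ?_
  rw [← map_pow]
  exact Iff.rfl

end FlowHom

/-- The modes `β_n` with `n > -l` and `γ_n` with `n > l` act nilpotently on `v`. -/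
def NilAt {M : Type} [AddCommGroup M] [Module Ghost M] (l : ℤ) (v : M) : Prop :=
  (∀ n, -l < n → IsNilpotentOn (beta n) v) ∧ ∀ n, l < n → IsNilpotentOn (gamma n) v

theorem nilAt_flow {M : ModuleCat.{0} Ghost} (k l : ℤ) (v : M) :
    NilAt l (show flow k M from v) ↔ NilAt (l - k) (v : M) := by
  simp only [NilAt, isNilpotentOn_flow, spectralFlow_beta, spectralFlow_gamma]
  constructor
  · rintro ⟨h1, h2⟩
    refine ⟨fun n hn => ?_, fun n hn => ?_⟩
    · have := h1 (n - k) (by omega); rwa [show n - k - -k = n by ring] at this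
    · have := h2 (n + k) (by omega); rwa [show n + k + -k = n by ring] at this
  · rintro ⟨h1, h2⟩
    exact ⟨fun n hn => h1 _ (by omega), fun n hn => h2 _ (by omega)⟩

/-! ### Creators and annihilators -/

/-- The creating modes. -/
def cre : ℕ ⊕ ℕ → Ghost
  | .inl n => beta (.negSucc n)
  | .inr n => gamma (.negSucc n)

/-- The annihilating modes. -/
def ann : ℕ ⊕ ℕ → Ghost
  | .inl n => gamma (.ofNat (n + 1))
  | .inr n => -beta (.ofNat (n + 1))

theorem cre_mul_cre (i j : ℕ ⊕ ℕ) : cre i * cre j = cre j * cre i := by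
  rcases i with m | m <;> rcases j with n | n <;> simp only [cre]
  · exact beta_mul_beta _ _
  · rw [gamma_mul_beta, if_neg (by omega), add_zero]
  · rw [gamma_mul_beta, if_neg (by omega), add_zero]
  · exact gamma_mul_gamma _ _

theorem ann_mul_ann (i j : ℕ ⊕ ℕ) : ann i * ann j = ann j * ann i := by
  rcases i with m | m <;> rcases j with n | n <;> simp only [ann, mul_neg, neg_mul, neg_neg]
  · exact gamma_mul_gamma _ _
  · rw [gamma_mul_beta, if_neg (by simp; omega), add_zero]
  · rw [gamma_mul_beta, if_neg (by simp; omega), add_zero]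
  · exact beta_mul_beta _ _

/-- The sign in `ann (.inr n)` is chosen so that the pairs `ann i`, `cre i` satisfy the relations of
∂/∂X_i and X_i without case distinction. -/
theorem ann_mul_cre (i j : ℕ ⊕ ℕ) :
    ann i * cre j = cre j * ann i + if i = j then 1 else 0 := by
  have ho : ∀ n : ℕ, Int.ofNat (n + 1) = (n : ℤ) + 1 := fun _ => rfl
  rcases i with m | m <;> rcases j with n | n <;>
    simp only [ann, cre, mul_neg, neg_mul, ho, Sum.inl.injEq, Sum.inr.injEq, reduceCtorEq,
      if_false, add_zero]
  · rw [gamma_mul_beta]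
    congr 1
    exact if_congr (by omega) rfl rfl
  · exact gamma_mul_gamma _ _
  · rw [beta_mul_beta]
  · rw [gamma_mul_beta]
    by_cases h : m = n
    · subst h; rw [if_pos (by omega), if_pos rfl]; abel
    · rw [if_neg (by omega), if_neg h]; simp

theorem exists_adjoin_cre_comm : ∃ f : MvPolynomial (ℕ ⊕ ℕ) ℂ →ₐ[ℂ] Ghost,
    ∀ i, f (MvPolynomial.X i) = cre i := by
  have hcomm := Algebra.isMulCommutative_adjoin ℂ (s := Set.range cre) (by
    rintro _ ⟨i, rfl⟩ _ ⟨j, rfl⟩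
    exact cre_mul_cre i j)
  -- Evaluation of `MvPolynomial` needs a commutative target, so it takes place in the commutative
  -- subalgebra generated by the creating modes.
  let _ : CommRing (Algebra.adjoin ℂ (Set.range cre)) :=
    { (Algebra.adjoin ℂ (Set.range cre)).toRing with mul_comm := hcomm.is_comm.comm }
  refine ⟨(Algebra.adjoin ℂ (Set.range cre)).val.comp
    (MvPolynomial.aeval fun i => ⟨cre i, Algebra.subset_adjoin ⟨i, rfl⟩⟩), fun i => ?_⟩
  rw [AlgHom.comp_apply, MvPolynomial.aeval_X]
  rfl

/-- Polynomials in the creating modes. -/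
def creHom : MvPolynomial (ℕ ⊕ ℕ) ℂ →ₐ[ℂ] Ghost := exists_adjoin_cre_comm.choose

theorem creHom_X (i : ℕ ⊕ ℕ) : creHom (.X i) = cre i := exists_adjoin_cre_comm.choose_spec i

/-- The commutator with `ann i` is a derivation which agrees with ∂/∂X_i on the variables. -/
theorem ann_mul_creHom (i : ℕ ⊕ ℕ) (f : MvPolynomial (ℕ ⊕ ℕ) ℂ) :
    ann i * creHom f = creHom f * ann i + creHom (dX i f) := by
  induction f using MvPolynomial.induction_on with
  | C c =>
    rw [← MvPolynomial.algebraMap_eq, AlgHom.commutes, Algebra.commutes]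
    simp [dX]
  | add f g hf hg => rw [map_add, mul_add, hf, hg, add_mul, map_add, map_add]; abel
  | mul_X f j hf =>
    have h1 : dX i (f * .X j) = dX i f * .X j + if i = j then f else 0 := by
      have := LinearMap.congr_fun (dX_mul_mulX i j) f
      simp only [mulX, Module.End.mul_apply, LinearMap.add_apply, LinearMap.mulLeft_apply] at this
      rw [mul_comm f, this, mul_comm (MvPolynomial.X j)]
      split_ifs <;> simp
    rw [h1, map_mul, ← mul_assoc, hf, add_mul, mul_assoc, creHom_X, ann_mul_cre, mul_add, map_add,
      map_mul, creHom_X, mul_assoc]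
    split_ifs
    · simp; abel
    · simp

theorem commute_creHom {x : Ghost} (hx : ∀ i, x * cre i = cre i * x)
    (f : MvPolynomial (ℕ ⊕ ℕ) ℂ) : x * creHom f = creHom f * x := by
  induction f using MvPolynomial.induction_on with
  | C c => rw [← MvPolynomial.algebraMap_eq, AlgHom.commutes, Algebra.commutes]
  | add f g hf hg => rw [map_add, mul_add, hf, hg, add_mul]
  | mul_X f j hf => rw [map_mul, creHom_X, ← mul_assoc, hf, mul_assoc, hx, mul_assoc]

theorem beta_zero_mul_cre (i : ℕ ⊕ ℕ) : beta 0 * cre i = cre i * beta 0 := by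
  rcases i with n | n
  · exact beta_mul_beta _ _
  · simp only [cre]; rw [gamma_mul_beta, if_neg (by omega), add_zero]

theorem gamma_zero_mul_cre (i : ℕ ⊕ ℕ) : gamma 0 * cre i = cre i * gamma 0 := by
  rcases i with n | n
  · simp only [cre]; rw [gamma_mul_beta, if_neg (by omega), add_zero]
  · exact gamma_mul_gamma _ _

/-! ### The universal property of induced modules -/

section Universal

variable {V : Type} [AddCommGroup V] [Module ℂ V] (p q : Module.End ℂ V) (hpq : p * q - q * p = 1)

theorem induced_ann (i : ℕ ⊕ ℕ) (v : FockSpace V) :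
    (ann i • (show induced p q hpq from v) : induced p q hpq) = (polyOp (dX i) v : FockSpace V) := by
  rcases i with n | n
  · exact induced_gamma p q hpq _ v
  · refine (neg_smul _ _).trans ((congrArg Neg.neg (induced_beta p q hpq _ v)).trans ?_)
    change -((-polyOp (dX (.inr n)) : Module.End ℂ (FockSpace V)) v) = _
    rw [LinearMap.neg_apply, neg_neg]

variable {E : Type} [AddCommGroup E] [Module Ghost E] [Module ℂ E] [IsScalarTower ℂ Ghost E]

/-- The only possible extension of φ sends f ⊗ u to f(creating modes) φ(u). It respects the zero
modes because these commute with the creating modes, and the annihilating modes because they kill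
φ(V) and act on f by derivatives. -/
theorem exists_hom_of_induced (φ : V →ₗ[ℂ] E) (hβ : ∀ u, beta 0 • φ u = -φ (p u))
    (hγ : ∀ u, gamma 0 • φ u = φ (q u)) (hann : ∀ i u, ann i • φ u = 0) :
    ∃ ψ : induced p q hpq →ₗ[Ghost] E, ∀ u, ψ (vec 1 u) = φ u := by
  let B : MvPolynomial (ℕ ⊕ ℕ) ℂ →ₗ[ℂ] V →ₗ[ℂ] E :=
    LinearMap.mk₂ ℂ (fun f u => creHom f • φ u)
      (fun f g u => by rw [map_add, add_smul])
      (fun c f u => by rw [map_smul, smul_assoc])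
      (fun f u w => by rw [map_add, smul_add])
      (fun c f u => by rw [map_smul, smul_complex_comm])
  let F : FockSpace V →ₗ[ℂ] E := TensorProduct.lift B
  have hF : ∀ f u, F (vec f u) = creHom f • φ u := fun f u => TensorProduct.lift.tmul f u
  have hext : ∀ (S : Module.End ℂ (FockSpace V)) (x : Ghost),
      (∀ f u, F (S (vec f u)) = x • F (vec f u)) → ∀ v, F (S v) = x • F v := by
    intro S x h v
    have : F ∘ₗ S = Module.toModuleEnd ℂ (S := Ghost) E x ∘ₗ F :=
      TensorProduct.ext' (M := MvPolynomial (ℕ ⊕ ℕ) ℂ) (N := V) h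
    exact LinearMap.congr_fun this v
  have hAnn : ∀ i v, F (polyOp (dX i) v) = ann i • F v := fun i => hext _ _ fun f u => by
    rw [polyOp_vec, hF, hF, smul_smul, ann_mul_creHom, add_smul, mul_smul, hann, smul_zero,
      zero_add]
  have hCre : ∀ i v, F (polyOp (mulX i) v) = cre i • F v := fun i => hext _ _ fun f u => by
    rw [polyOp_vec, hF, hF, smul_smul, ← creHom_X, ← map_mul]
    rfl
  refine ⟨homOfModes (M := induced p q hpq) { toFun := F, map_add' := map_add F, map_smul' := ?_ }
    ?_ ?_, fun u => ?_⟩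
  · intro c v
    exact (congrArg F (induced_complex_smul p q hpq c v)).trans (map_smul F c _)
  · intro n v
    refine (congrArg F (induced_beta p q hpq n v)).trans ?_
    change F (betaOp p n v) = beta n • F v
    rcases n with (_ | n) | n
    · refine hext _ _ (fun f u => ?_) v
      change F (-(coeffOp p (vec f u))) = _
      rw [map_neg, coeffOp_vec, hF, hF, smul_smul]
      change _ = (beta 0 * _) • _
      rw [commute_creHom beta_zero_mul_cre, mul_smul, hβ, smul_neg]
    · have h := hAnn (.inr n) v
      simp only [ann] at h
      change F (-(polyOp (dX (.inr n)) v)) = _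
      rw [map_neg, h, neg_smul, neg_neg]
    · exact hCre (.inl n) v
  · intro n v
    refine (congrArg F (induced_gamma p q hpq n v)).trans ?_
    change F (gammaOp q n v) = gamma n • F v
    rcases n with (_ | n) | n
    · refine hext _ _ (fun f u => ?_) v
      change F (coeffOp q (vec f u)) = _
      rw [coeffOp_vec, hF, hF, smul_smul]
      change _ = (gamma 0 * _) • _
      rw [commute_creHom gamma_zero_mul_cre, mul_smul, hγ]
    · exact hAnn (.inl n) v
    · exact hCre (.inr n) v
  · change F (vec 1 u) = _
    rw [hF, map_one, one_smul]

/-- The vectors of an induced module which are annihilated by the positive modes. -/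
theorem exists_vec_of_ann (z : induced p q hpq) (hz : ∀ i, ann i • z = 0) :
    ∃ u : V, z = (vec 1 u : FockSpace V) := by
  let e : FockSpace V ≃ₗ[ℂ] ((ℕ ⊕ ℕ →₀ ℕ) →₀ V) :=
    TensorProduct.equivFinsuppOfBasisLeft (MvPolynomial.basisMonomials (ℕ ⊕ ℕ) ℂ)
  have he : ∀ f u m, e (vec f u) m = f.coeff m • u := fun f u m =>
    TensorProduct.equivFinsuppOfBasisLeft_apply_tmul_apply _ _ _ _
  have hd : ∀ (i : ℕ ⊕ ℕ) (v : FockSpace V) (m : ℕ ⊕ ℕ →₀ ℕ),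
      e (polyOp (dX i) v) m = ((m i : ℂ) + 1) • e v (m + Finsupp.single i 1) := by
    intro i v m
    have : (Finsupp.lapply m ∘ₗ e.toLinearMap ∘ₗ polyOp (dX i) : FockSpace V →ₗ[ℂ] V) =
        ((m i : ℂ) + 1) • (Finsupp.lapply (m + Finsupp.single i 1) ∘ₗ e.toLinearMap) := by
      refine TensorProduct.ext' (M := MvPolynomial (ℕ ⊕ ℕ) ℂ) (N := V) fun f u => ?_
      change e (polyOp (dX i) (vec f u)) m = ((m i : ℂ) + 1) • e (vec f u) _
      rw [polyOp_vec, he, he, smul_smul, mul_comm]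
      exact congrArg (· • u) (MvPolynomial.coeff_pderiv f m)
    exact LinearMap.congr_fun this v
  let z' : FockSpace V := z
  refine ⟨e z' 0, e.injective (Finsupp.ext fun m => ?_)⟩
  change e z' m = _
  by_cases hm : m = 0
  · subst hm
    rw [he, MvPolynomial.coeff_zero_one, one_smul]
  -- If the variable i occurs in the monomial m, then the coefficient of z at m, multiplied by the
  -- positive integer m_i, is a coefficient of ∂z/∂X_i = 0; it vanishes in characteristic zero.
  · obtain ⟨i, hi⟩ := Finsupp.ne_iff.1 hm
    have hle : Finsupp.single i 1 ≤ m := Finsupp.single_le_iff.2 (Nat.one_le_iff_ne_zero.2 hi)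
    obtain ⟨m', rfl⟩ := exists_add_of_le hle
    have h0 : polyOp (dX i) z' = 0 := (induced_ann p q hpq i z').symm.trans (hz i)
    have h1 := hd i z' m'
    rw [h0, map_zero, Finsupp.zero_apply, eq_comm, smul_eq_zero] at h1
    rw [add_comm, h1.resolve_left (Nat.cast_add_one_ne_zero _), he, add_comm, MvPolynomial.coeff_one,
      if_neg (fun h => hm h.symm), zero_smul]

end Universal

/-! ### Generation by vacuum vectors -/

section Vacuum

variable {M : Type} [AddCommGroup M] [Module Ghost M]

/-- Vectors which are annihilated by the positive modes and which are eigenvectors of the number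
operator of the zero modes. -/
def IsVacuumVector (j : ℂ) (v : M) : Prop :=
  (∀ i, ann i • v = 0) ∧ number 0 • v = algebraMap ℂ Ghost j • v

theorem IsVacuumVector.map {N : Type} [AddCommGroup N] [Module Ghost N] {j : ℂ} {v : M}
    (h : IsVacuumVector j v) (f : M →ₗ[Ghost] N) : IsVacuumVector j (f v) :=
  ⟨fun i => by rw [← map_smul, h.1, map_zero], by rw [← map_smul, h.2, map_smul]⟩

theorem ann_eq_zero_iff (v : M) :
    (∀ i, ann i • v = 0) ↔ ∀ n : ℤ, 1 ≤ n → beta n • v = 0 ∧ gamma n • v = 0 := by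
  constructor
  · intro h n hn
    obtain ⟨m, rfl⟩ : ∃ m : ℕ, n = Int.ofNat (m + 1) :=
      ⟨(n - 1).toNat, by change _ = (((n - 1).toNat : ℤ) + 1); omega⟩
    refine ⟨?_, h (.inl m)⟩
    have := h (.inr m)
    rwa [ann, neg_smul, neg_eq_zero] at this
  · rintro h (n | n)
    · exact (h _ (by change (1 : ℤ) ≤ n + 1; omega)).2
    · rw [ann, neg_smul, (h _ (by change (1 : ℤ) ≤ n + 1; omega)).1, neg_zero]

theorem ann_pow_succ_mul_cre (i : ℕ ⊕ ℕ) (r : ℕ) :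
    ann i ^ (r + 1) * cre i = cre i * ann i ^ (r + 1) + algebraMap ℂ Ghost (r + 1) * ann i ^ r := by
  induction r with
  | zero => simp [ann_mul_cre]
  | succ r ih =>
    rw [pow_succ', mul_assoc, ih, mul_add, ← mul_assoc, ann_mul_cre, if_pos rfl, add_mul, one_mul,
      ← mul_assoc, ← Algebra.commutes, mul_assoc, mul_assoc, ← pow_succ', ← pow_succ']
    push_cast
    simp only [add_mul, one_mul]
    abel

theorem isNilpotentOn_ann {v : M} (h : NilAt 0 v) (i : ℕ ⊕ ℕ) : IsNilpotentOn (ann i) v := by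
  rcases i with n | n
  · exact h.2 _ (by change (0 : ℤ) < n + 1; omega)
  · obtain ⟨r, hr⟩ := h.1 (.ofNat (n + 1)) (by change (-0 : ℤ) < n + 1; omega)
    exact ⟨r, by rw [ann, neg_pow, mul_smul, hr, smul_zero]⟩

theorem NilAt.map {N : Type} [AddCommGroup N] [Module Ghost N] (f : M →ₗ[Ghost] N) {l : ℤ} {v : M}
    (h : NilAt l v) : NilAt l (f v) :=
  ⟨fun n hn => (h.1 n hn).map f, fun n hn => (h.2 n hn).map f⟩

theorem NilAt.of_map {N : Type} [AddCommGroup N] [Module Ghost N] {f : M →ₗ[Ghost] N}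
    (hf : Function.Injective f) {l : ℤ} {v : M} (h : NilAt l (f v)) : NilAt l v :=
  ⟨fun n hn => (h.1 n hn).of_map hf, fun n hn => (h.2 n hn).of_map hf⟩

theorem NilAt.of_exact {L N : Type} [AddCommGroup L] [Module Ghost L] [AddCommGroup N]
    [Module Ghost N] {i : L →ₗ[Ghost] M} {p : M →ₗ[Ghost] N} (hip : Function.Exact i p) {l : ℤ}
    (hL : ∀ y : L, NilAt l y) (hN : ∀ y : N, NilAt l y) (v : M) : NilAt l v :=
  ⟨fun n hn => .of_exact hip (fun y => (hL y).1 n hn) ((hN _).1 n hn),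
    fun n hn => .of_exact hip (fun y => (hL y).2 n hn) ((hN _).2 n hn)⟩

theorem nilAt_of_ann {v : M} (h : ∀ i, ann i • v = 0) : NilAt 0 v := by
  rw [ann_eq_zero_iff] at h
  exact ⟨fun n hn => ⟨1, by rw [pow_one, (h n (by omega)).1]⟩,
    fun n hn => ⟨1, by rw [pow_one, (h n (by omega)).2]⟩⟩

variable [Module ℂ M] [IsScalarTower ℂ Ghost M]

/-- The weight of the creating modes. -/
def creWeight : ℕ ⊕ ℕ → ℂ
  | .inl _ => 1
  | .inr _ => -1

theorem J0_cre (h : Smooth M) (i : ℕ ⊕ ℕ) (v : M) :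
    J0 h (cre i • v) = cre i • J0 h v + creWeight i • cre i • v := by
  rcases i with n | n
  · simp [cre, creWeight, J0_beta]
  · simp [cre, creWeight, J0_gamma, sub_eq_add_neg]

theorem J0_ann (h : Smooth M) (i : ℕ ⊕ ℕ) (v : M) :
    J0 h (ann i • v) = ann i • J0 h v - creWeight i • ann i • v := by
  rcases i with n | n
  · simp [ann, creWeight, J0_gamma]
  · simp only [ann, creWeight, neg_smul, map_neg, J0_beta, one_smul]; abel

theorem J0_of_ann (h : Smooth M) {v : M} (hv : ∀ i, ann i • v = 0) : J0 h v = number 0 • v := by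
  rw [J0_generator h ((ann_eq_zero_iff v).1 hv), number, mul_smul]
  rfl

/-- A weight module on which the positive modes are locally nilpotent is generated by its vacuum
vectors. -/
theorem span_isVacuumVector (hM : IsWeightModule M) (hn : ∀ v : M, NilAt 0 v) :
    Submodule.span Ghost {v : M | ∃ j, IsVacuumVector j v} = ⊤ := by
  set S := Submodule.span Ghost {v : M | ∃ j, IsVacuumVector j v} with hS
  -- Here s contains the annihilating modes that may act non-trivially on the weight vector v;
  -- smoothness supplies a finite s. For empty s, J_0 v = `number 0` v, so v is itself a vacuum
  -- vector.
  have key : ∀ (s : Finset (ℕ ⊕ ℕ)) (v : M), (∃ j : ℂ, J0 hM.smooth v = j • v) →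
      (∀ i ∉ s, ann i • v = 0) → v ∈ S := by
    intro s
    induction s using Finset.induction_on with
    | empty =>
      rintro v ⟨j, hj⟩ hv
      have hv' : ∀ i, ann i • v = 0 := fun i => hv i (Finset.notMem_empty i)
      rw [J0_of_ann _ hv', ← algebraMap_smul Ghost j v] at hj
      exact Submodule.subset_span ⟨j, hv', hj⟩
    | insert i s _ ih =>
      intro v hw hv
      obtain ⟨r, hr⟩ := isNilpotentOn_ann (hn v) i
      induction r using Nat.strong_induction_on generalizing v with
      | _ r ihr =>
      match r with
      | 0 =>
        rw [pow_zero, one_smul] at hr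
        exact hr ▸ S.zero_mem
      | 1 =>
        rw [pow_one] at hr
        refine ih v hw fun k hk => ?_
        by_cases hki : k = i
        · exact hki ▸ hr
        · exact hv k (by simp [hki, hk])
      | r + 2 =>
        obtain ⟨j, hj⟩ := hw
        have hκ : ((r : ℂ) + 1) ≠ 0 := Nat.cast_add_one_ne_zero r
        have h1 : ann i • v ∈ S := by
          refine ihr (r + 1) (by omega) _ ⟨j - creWeight i, ?_⟩ (fun k hk => ?_) ?_
          · rw [J0_ann, hj, smul_complex_comm, sub_smul]
          · rw [smul_smul, ann_mul_ann, mul_smul, hv k hk, smul_zero]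
          · rwa [smul_smul, ← pow_succ]
        -- Put a = `ann i` and c = `cre i`. From [a^{r+1}, c] = (r + 1) a^r and a^{r+2} v = 0, the
        -- correction term has the same image under a^{r+1} as v. The difference, like a v, thus has
        -- exponent r + 1, and v is recovered from the two.
        have h2 : v - ((r : ℂ) + 1)⁻¹ • cre i • ann i • v ∈ S := by
          refine ihr (r + 1) (by omega) _ ⟨j, ?_⟩ (fun k hk => ?_) ?_
          · rw [map_sub, map_smul, J0_cre, J0_ann, hj, smul_sub, smul_sub]
            simp only [smul_complex_comm]
            rw [sub_add_cancel, smul_comm _ j]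
          · have hki : k ≠ i := fun h => hk (h ▸ Finset.mem_insert_self _ _)
            rw [smul_sub, hv k hk, smul_complex_comm, smul_smul (ann k), ann_mul_cre, if_neg hki,
              add_zero, mul_smul, smul_smul (ann k), ann_mul_ann, mul_smul, hv k hk]
            simp
          · have hr' : ann i ^ (r + 1) • ann i • v = 0 := by rwa [smul_smul, ← pow_succ]
            rw [smul_sub, smul_complex_comm, smul_smul _ (cre i), ann_pow_succ_mul_cre, add_smul,
              mul_smul, hr', smul_zero, zero_add, mul_smul, smul_smul _ (ann i), ← pow_succ,
              algebraMap_smul, smul_smul, inv_mul_cancel₀ hκ, one_smul, sub_self]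
        have h3 := S.add_mem h2 (S.smul_mem (algebraMap ℂ Ghost ((r : ℂ) + 1)⁻¹ * cre i) h1)
        rwa [mul_smul, algebraMap_smul, sub_add_cancel] at h3
  have hle : ⨆ j : ℂ, Module.End.eigenspace (J0 hM.smooth) j ≤ S.restrictScalars ℂ := by
    refine iSup_le fun j v hv => ?_
    rw [Module.End.mem_eigenspace_iff] at hv
    obtain ⟨K, hK⟩ := hM.smooth v
    refine key ((Finset.range K.toNat).disjSum (Finset.range K.toNat)) v ⟨j, hv⟩ fun i hi => ?_
    rcases i with n | n
    · rw [Finset.inl_mem_disjSum, Finset.mem_range] at hi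
      exact (hK _ (by change K ≤ (n : ℤ) + 1; omega)).2
    · rw [Finset.inr_mem_disjSum, Finset.mem_range] at hi
      rw [ann, neg_smul, (hK _ (by change K ≤ (n : ℤ) + 1; omega)).1, neg_zero]
  rw [hM.semisimple] at hle
  exact eq_top_iff.2 fun v _ => hle Submodule.mem_top

theorem NilAt.ghost_smul {l : ℤ} {v : M} (h : NilAt l v) (a : Ghost) : NilAt l (a • v) :=
  ⟨fun n hn => (h.1 n hn).ghost_smul (hasScalarCommutators_beta n) a,
    fun n hn => (h.2 n hn).ghost_smul (hasScalarCommutators_gamma n) a⟩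

/-- Non-zero submodules contain non-zero vacuum vectors. -/
theorem exists_isVacuumVector_mem (hM : IsWeightModule M) (hn : ∀ v : M, NilAt 0 v)
    (N : Submodule Ghost M) (hN : N ≠ ⊥) : ∃ v ∈ N, v ≠ 0 ∧ ∃ j, IsVacuumVector j v := by
  by_contra! hcon
  refine hN ?_
  -- A submodule inherits semisimplicity of J_0 and local nilpotency, so it is generated by its own
  -- vacuum vectors.
  have hw : IsWeightModule N := hM.of_injective N.subtype Subtype.val_injective
  have h := span_isVacuumVector hw fun v => .of_map (f := N.subtype) Subtype.val_injective (hn v)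
  have h0 : {v : N | ∃ j, IsVacuumVector j v} ⊆ {0} := by
    rintro v ⟨j, hj⟩
    by_contra hv
    exact hcon v v.2 (fun h => hv (Subtype.ext h)) j (hj.map N.subtype)
  rw [← Submodule.subsingleton_iff_eq_bot, ← Submodule.subsingleton_iff Ghost,
    ← subsingleton_iff_bot_eq_top, ← h, eq_comm, Submodule.span_eq_bot]
  exact fun x hx => h0 hx

end Vacuum

/-! ### The modules `W_μ` -/

section Typical

theorem vec_one_injective {V : Type} [AddCommGroup V] [Module ℂ V] :
    Function.Injective (fun u : V => (vec 1 u : FockSpace V)) := by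
  intro u w h
  let e : FockSpace V ≃ₗ[ℂ] ((ℕ ⊕ ℕ →₀ ℕ) →₀ V) :=
    TensorProduct.equivFinsuppOfBasisLeft (MvPolynomial.basisMonomials (ℕ ⊕ ℕ) ℂ)
  have he : ∀ u, e (vec 1 u) 0 = u := fun u =>
    (TensorProduct.equivFinsuppOfBasisLeft_apply_tmul_apply _ _ _ _).trans
      ((congrArg (· • u) (MvPolynomial.coeff_zero_one)).trans (one_smul ℂ u))
  rw [← he u, ← he w]
  exact congrArg (fun z => e z 0) h

theorem vec_smul {V : Type} [AddCommGroup V] [Module ℂ V] (f : MvPolynomial (ℕ ⊕ ℕ) ℂ) (c : ℂ)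
    (u : V) : (vec f (c • u) : FockSpace V) = c • vec f u := TensorProduct.tmul_smul _ _ _

section Induced

variable {V : Type} [AddCommGroup V] [Module ℂ V] (p q : Module.End ℂ V) (hpq : p * q - q * p = 1)

theorem induced_ann_vec (i : ℕ ⊕ ℕ) (u : V) :
    ann i • (show induced p q hpq from vec 1 u) = 0 :=
  (ann_eq_zero_iff _).2 (induced_positive p q hpq u) i

theorem induced_beta_zero_vec (u : V) :
    beta 0 • (show induced p q hpq from vec 1 u) = (vec 1 (-p u) : FockSpace V) := by
  refine (induced_beta p q hpq 0 _).trans ?_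
  change -coeffOp p (vec 1 u) = _
  rw [coeffOp_vec]
  exact (TensorProduct.tmul_neg _ _).symm

theorem induced_gamma_zero_vec (u : V) :
    gamma 0 • (show induced p q hpq from vec 1 u) = (vec 1 (q u) : FockSpace V) :=
  induced_gamma p q hpq 0 _

theorem induced_number_zero_vec (u : V) :
    number 0 • (show induced p q hpq from vec 1 u) = (vec 1 (-q (p u)) : FockSpace V) := by
  rw [number, mul_smul]
  refine (congrArg _ (induced_beta_zero_vec p q hpq u)).trans ?_
  refine (induced_gamma_zero_vec p q hpq _).trans ?_
  rw [map_neg]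

theorem induced_algebraMap_vec (c : ℂ) (u : V) :
    algebraMap ℂ Ghost c • (show induced p q hpq from vec 1 u) = (vec 1 (c • u) : FockSpace V) := by
  rw [vec_smul]
  exact induced_complex_smul p q hpq c _

end Induced

variable (μ : ℂ)

theorem denseP_single (n : ℤ) (a : ℂ) :
    denseP μ (Finsupp.single n a) = (μ + n) • Finsupp.single (n - 1) a := by simp [denseP]

theorem denseQ_single (n : ℤ) (a : ℂ) :
    denseQ (Finsupp.single n a) = Finsupp.single (n + 1) a := by simp [denseQ]

theorem denseQ_denseP_apply (u : ℤ →₀ ℂ) (m : ℤ) : denseQ (denseP μ u) m = (μ + m) * u m := by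
  induction u using Finsupp.induction_linear with
  | zero => simp
  | add f g hf hg => simp only [map_add, Finsupp.add_apply, hf, hg, mul_add]
  | single n a =>
    rw [denseP_single, map_smul, denseQ_single, sub_add_cancel, Finsupp.smul_apply, smul_eq_mul]
    by_cases h : n = m
    · rw [h]
    · simp [Finsupp.single_eq_of_ne' h]

/-- The vacuum vector `x^{μ+n}` of `W_μ`. -/
def typicalVec (n : ℤ) : typical μ := (vec 1 (Finsupp.single n 1) : FockSpace (ℤ →₀ ℂ))

theorem isVacuumVector_typicalVec (n : ℤ) : IsVacuumVector (-(μ + n)) (typicalVec μ n) := by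
  refine ⟨fun i => induced_ann_vec _ _ _ i _, ?_⟩
  refine (induced_number_zero_vec _ _ _ _).trans (Eq.trans ?_ (induced_algebraMap_vec _ _ _ _ _).symm)
  rw [denseP_single, map_smul, denseQ_single, sub_add_cancel, neg_smul]

theorem typicalVec_ne_zero (n : ℤ) : typicalVec μ n ≠ 0 := by
  intro h
  have h0 : (vec 1 (0 : ℤ →₀ ℂ) : FockSpace (ℤ →₀ ℂ)) = 0 := TensorProduct.tmul_zero _ _
  have := vec_one_injective (h.trans h0.symm)
  simp at this

variable {μ}

theorem add_ne_zero_of_not_int (hμ : ∀ n : ℤ, μ ≠ n) (n : ℤ) : μ + n ≠ 0 := fun h =>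
  hμ (-n) (by rw [eq_neg_of_add_eq_zero_left h, Int.cast_neg])

/-- Multiplication by x raises the exponent, and differentiation lowers it up to the factor μ + m,
which never vanishes; so each x^{μ+n} reaches all others. -/
theorem typical_generator (hμ : ∀ n : ℤ, μ ≠ n) (n : ℤ) (v : typical μ) :
    ∃ a : Ghost, a • typicalVec μ n = v := by
  refine induced_generator _ _ _ (Finsupp.single n 1) (fun N h0 hpN hqN => ?_) v
  have h1 : ∀ i : ℕ, (Finsupp.single (n + i) 1 : ℤ →₀ ℂ) ∈ N := fun i => by
    induction i with
    | zero => simpa using h0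
    | succ i ih =>
      have := hqN _ ih
      rwa [denseQ_single, add_assoc] at this
  have h2 : ∀ i : ℕ, (Finsupp.single (n - i) 1 : ℤ →₀ ℂ) ∈ N := fun i => by
    induction i with
    | zero => simpa using h0
    | succ i ih =>
      have := N.smul_mem (μ + (n - i : ℤ))⁻¹ (hpN _ ih)
      rw [denseP_single, smul_smul, inv_mul_cancel₀ (add_ne_zero_of_not_int hμ _), one_smul,
        sub_sub] at this
      exact_mod_cast this
  have hall : ∀ m : ℤ, (Finsupp.single m 1 : ℤ →₀ ℂ) ∈ N := fun m => by
    rcases le_total n m with h | h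
    · have := h1 (m - n).toNat
      rwa [show n + ((m - n).toNat : ℤ) = m by omega] at this
    · have := h2 (n - m).toNat
      rwa [show n - ((n - m).toNat : ℤ) = m by omega] at this
  refine eq_top_iff.2 fun f _ => ?_
  induction f using Finsupp.induction_linear with
  | zero => exact N.zero_mem
  | add f g hf hg => exact N.add_mem (hf Submodule.mem_top) (hg Submodule.mem_top)
  | single n a => simpa using N.smul_mem a (hall n)

theorem isWeightModule_typical (hμ : ∀ n : ℤ, μ ≠ n) : IsWeightModule (typical μ) := by
  have h := isVacuumVector_typicalVec μ 0
  have hs := smooth_of_generator (typical_generator hμ 0) ((ann_eq_zero_iff _).1 h.1)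
  refine isWeightModule_of_iSup hs (-(μ + (0 : ℤ)))
    (iSup_eigenspace_of_generator (typical_generator hμ 0) hs _ ?_)
  rw [J0_of_ann hs h.1, h.2, algebraMap_smul]

theorem nilAt_typical (hμ : ∀ n : ℤ, μ ≠ n) (v : typical μ) : NilAt 0 v := by
  obtain ⟨a, rfl⟩ := typical_generator hμ 0 v
  exact (nilAt_of_ann (isVacuumVector_typicalVec μ 0).1).ghost_smul a

/-- The weights of `W_μ`. -/
def typicalWeights (μ : ℂ) : Set ℂ := {c | ∃ n : ℤ, c = -(μ + n)}

theorem typicalWeights_stable (c : ℂ) (m : ℤ) (h : c + m ∈ typicalWeights μ) :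
    c ∈ typicalWeights μ := by
  obtain ⟨n, hn⟩ := h
  exact ⟨n + m, by rw [eq_sub_of_add_eq hn]; push_cast; ring⟩

theorem locallyFinite_typical (hμ : ∀ n : ℤ, μ ≠ n) (v : typical μ) :
    LocallyFinite (typicalWeights μ) (number 0) v := by
  obtain ⟨a, rfl⟩ := typical_generator hμ 0 v
  exact (LocallyFinite.of_eigen (T := typicalWeights μ) ⟨0, rfl⟩ (isVacuumVector_typicalVec μ 0).2).ghost_smul
    typicalWeights_stable a

theorem disjoint_typicalWeights (hμ : ∀ n : ℤ, μ ≠ n) :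
    Disjoint (typicalWeights μ) (Set.range ((↑) : ℤ → ℂ)) := by
  rw [Set.disjoint_left]
  rintro _ ⟨n, rfl⟩ ⟨m, hm⟩
  refine hμ (-(m + n)) ?_
  push_cast
  rw [hm]; ring

/-- The annihilating modes confine z to the Weyl algebra module, where `number 0` is -x d/dx:
diagonal with the pairwise distinct eigenvalues -(μ + n). -/
theorem eq_typicalVec_of_isVacuumVector {j : ℂ} {z : typical μ} (hz : IsVacuumVector j z)
    (h0 : z ≠ 0) : ∃ (n : ℤ) (c : ℂ), c ≠ 0 ∧ j = -(μ + n) ∧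
      z = algebraMap ℂ Ghost c • typicalVec μ n := by
  obtain ⟨u, rfl⟩ := exists_vec_of_ann _ _ _ z hz.1
  have h1 : -denseQ (denseP μ u) = j • u := vec_one_injective
    ((induced_number_zero_vec _ _ _ _).symm.trans (hz.2.trans (induced_algebraMap_vec _ _ _ _ _)))
  have hu : u ≠ 0 := fun h => h0 (by
    rw [h]
    exact TensorProduct.tmul_zero _ _)
  obtain ⟨n, hn⟩ := Finsupp.ne_iff.1 hu
  have h2 : ∀ m, u m ≠ 0 → j = -(μ + m) := fun m hm => by
    have := DFunLike.congr_fun h1 m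
    rw [Finsupp.neg_apply, denseQ_denseP_apply, Finsupp.smul_apply, smul_eq_mul, ← neg_mul] at this
    exact (mul_right_cancel₀ hm this).symm
  refine ⟨n, u n, hn, h2 n hn, ?_⟩
  refine Eq.trans ?_ (induced_algebraMap_vec _ _ _ _ _).symm
  have : u = Finsupp.single n (u n) := by
    ext m
    by_cases h : n = m
    · rw [h, Finsupp.single_eq_same]
    · rw [Finsupp.single_eq_of_ne' h]
      by_contra hm
      have h3 := (h2 n hn).symm.trans (h2 m hm)
      exact h (by exact_mod_cast add_left_cancel (neg_injective h3))
  rw [Finsupp.smul_single, smul_eq_mul, mul_one, ← this]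

theorem typical_eq_top (hμ : ∀ n : ℤ, μ ≠ n) (N : Submodule Ghost (typical μ)) {n : ℤ}
    (h : typicalVec μ n ∈ N) : N = ⊤ := by
  refine eq_top_iff.2 fun v _ => ?_
  obtain ⟨a, rfl⟩ := typical_generator hμ n v
  exact N.smul_mem a h

theorem mem_of_algebraMap_smul_mem {M : Type} [AddCommGroup M] [Module Ghost M]
    {N : Submodule Ghost M} {c : ℂ} (hc : c ≠ 0) {v : M} (h : algebraMap ℂ Ghost c • v ∈ N) :
    v ∈ N := by
  have := N.smul_mem (algebraMap ℂ Ghost c⁻¹) h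
  rwa [smul_smul, ← map_mul, inv_mul_cancel₀ hc, map_one, one_smul] at this

/-- A non-zero submodule contains a non-zero vacuum vector, that is, a multiple of some x^{μ+n}, and
every such vector generates. -/
theorem isSimpleModule_typical (hμ : ∀ n : ℤ, μ ≠ n) : IsSimpleModule Ghost (typical μ) := by
  have : Nontrivial (typical μ) := nontrivial_of_ne _ _ (typicalVec_ne_zero μ 0)
  refine (isSimpleModule_iff _ _).2 (IsSimpleOrder.mk fun N => or_iff_not_imp_left.2 fun hN => ?_)
  obtain ⟨v, hv, h0, j, hj⟩ := exists_isVacuumVector_mem (isWeightModule_typical hμ)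
    (nilAt_typical hμ) N hN
  obtain ⟨n, c, hc, -, rfl⟩ := eq_typicalVec_of_isVacuumVector hj h0
  exact typical_eq_top hμ N (mem_of_algebraMap_smul_mem hc hv)

/-! ### The universal property of W_μ -/

section Universal

variable {E : Type} [AddCommGroup E] [Module Ghost E]

theorem ann_mul_beta_zero (i : ℕ ⊕ ℕ) : ann i * beta 0 = beta 0 * ann i := by
  have ho : ∀ n : ℕ, Int.ofNat (n + 1) = (n : ℤ) + 1 := fun _ => rfl
  rcases i with n | n
  · simp only [ann]; rw [gamma_mul_beta, ho, if_neg (by omega), add_zero]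
  · simp only [ann, neg_mul, mul_neg]; rw [beta_mul_beta]

theorem ann_mul_gamma_zero (i : ℕ ⊕ ℕ) : ann i * gamma 0 = gamma 0 * ann i := by
  have ho : ∀ n : ℕ, Int.ofNat (n + 1) = (n : ℤ) + 1 := fun _ => rfl
  rcases i with n | n
  · simp only [ann]; rw [gamma_mul_gamma]
  · simp only [ann, neg_mul, mul_neg]; rw [gamma_mul_beta, ho, if_neg (by omega), add_zero]

theorem IsVacuumVector.gamma_zero {j : ℂ} {v : E} (h : IsVacuumVector j v) :
    IsVacuumVector (j - 1) (gamma 0 • v) := by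
  refine ⟨fun i => by rw [smul_smul, ann_mul_gamma_zero, mul_smul, h.1, smul_zero], ?_⟩
  rw [smul_smul, number_mul_gamma, if_pos (by simp), mul_smul, add_smul, h.2, ← add_smul, ← map_add,
    smul_smul, ← Algebra.commutes, mul_smul, sub_eq_add_neg]

theorem IsVacuumVector.beta_zero {j : ℂ} {v : E} (h : IsVacuumVector j v) :
    IsVacuumVector (j + 1) (beta 0 • v) := by
  refine ⟨fun i => by rw [smul_smul, ann_mul_beta_zero, mul_smul, h.1, smul_zero], ?_⟩
  rw [smul_smul, number_mul_beta, if_pos rfl, mul_smul, add_smul, h.2, ← add_smul, ← map_add,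
    smul_smul, ← Algebra.commutes, mul_smul]

theorem IsVacuumVector.algebraMap_smul {j : ℂ} {v : E} (h : IsVacuumVector j v) (c : ℂ) :
    IsVacuumVector j (algebraMap ℂ Ghost c • v) := by
  refine ⟨fun i => ?_, ?_⟩
  · rw [smul_smul, ← Algebra.commutes, mul_smul, h.1, smul_zero]
  · rw [smul_smul, ← Algebra.commutes, mul_smul, h.2, smul_smul, smul_smul, Algebra.commutes]

theorem gamma_zero_beta_zero {j : ℂ} {v : E} (h : IsVacuumVector j v) :
    gamma 0 • beta 0 • v = algebraMap ℂ Ghost j • v := by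
  rw [← h.2, number, mul_smul]; rfl

theorem beta_zero_gamma_zero {j : ℂ} {v : E} (h : IsVacuumVector j v) :
    beta 0 • gamma 0 • v = algebraMap ℂ Ghost (j - 1) • v := by
  have := beta_mul_gamma_neg 0
  rw [smul_smul]
  change (beta 0 * gamma (-0)) • v = _
  rw [this, sub_smul, h.2, map_sub, map_one, sub_smul]

/-- One vacuum vector of weight -μ determines a copy of the string x^{μ+m}: upwards by powers of
γ_0, downwards by β_0. The eigenvalues met on the way down are non-zero because μ is not an integer.
-/
theorem exists_string (hμ : ∀ n : ℤ, μ ≠ n) {v : E} (h : IsVacuumVector (-μ) v) :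
    ∃ g : ℤ → E, g 0 = v ∧ ∀ m : ℤ, IsVacuumVector (-(μ + m)) (g m) ∧ gamma 0 • g m = g (m + 1) ∧
      beta 0 • g m = algebraMap ℂ Ghost (-(μ + m)) • g (m - 1) := by
  -- The rescaling is the one that makes γ_0 a plain shift on the lower half of the string as well.
  let s : ℕ → E := fun i => Nat.rec v
    (fun i w => algebraMap ℂ Ghost (-(μ - i))⁻¹ • beta 0 • w) i
  have hs : ∀ i, s (i + 1) = algebraMap ℂ Ghost (-(μ - i))⁻¹ • beta 0 • s i := fun _ => rfl
  have hs1 : ∀ i : ℕ, IsVacuumVector (-(μ - i)) (s i) := fun i => by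
    induction i with
    | zero => rw [Nat.cast_zero, sub_zero]; exact h
    | succ i ih =>
      rw [hs]
      have := (ih.beta_zero).algebraMap_smul (-(μ - i))⁻¹
      rwa [show -(μ - i) + 1 = -(μ - (i + 1 : ℕ)) by push_cast; ring] at this
  have hne : ∀ i : ℕ, -(μ - i) ≠ 0 := fun i h => hμ i (by
    rw [neg_eq_zero, sub_eq_zero] at h; simpa using h)
  have hs2 : ∀ i, gamma 0 • s (i + 1) = s i := fun i => by
    rw [hs, smul_smul, ← Algebra.commutes, mul_smul, gamma_zero_beta_zero (hs1 i), smul_smul,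
      ← map_mul, inv_mul_cancel₀ (hne i), map_one, one_smul]
  have hs3 : ∀ i, beta 0 • s i = algebraMap ℂ Ghost (-(μ - i)) • s (i + 1) := fun i => by
    rw [hs, smul_smul, ← map_mul, mul_inv_cancel₀ (hne i), map_one, one_smul]
  have hc1 : ∀ i : ℕ, IsVacuumVector (-(μ + i)) (gamma 0 ^ i • v) := fun i => by
    induction i with
    | zero => simpa using h
    | succ i ih =>
      rw [pow_succ', mul_smul]
      have := ih.gamma_zero
      rwa [show -(μ + i) - 1 = -(μ + (i + 1 : ℕ)) by push_cast; ring] at this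
  let g : ℤ → E := fun m => match m with
    | .ofNat i => gamma 0 ^ i • v
    | .negSucc i => s (i + 1)
  have hg1 : ∀ i : ℕ, g i = gamma 0 ^ i • v := fun _ => rfl
  have h0 : gamma 0 ^ 0 • v = v := by rw [pow_zero, one_smul]
  have hg2 : ∀ i : ℕ, g (-i) = s i := fun i => by
    cases i with
    | zero => exact h0
    | succ i => rfl
  refine ⟨g, h0, fun m => ?_⟩
  rcases m.eq_nat_or_neg with ⟨i, rfl | rfl⟩
  · refine ⟨by rw [hg1]; exact_mod_cast hc1 i, ?_, ?_⟩
    · rw [hg1, ← Nat.cast_succ, hg1, smul_smul, ← pow_succ']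
    · cases i with
      | zero =>
        have := hs3 0
        have h1 : g (-(1 : ℕ)) = s (0 + 1) := hg2 1
        simp only [Nat.cast_zero, sub_zero] at this
        rw [← h1, show s 0 = g 0 from h0.symm] at this
        simpa using this
      | succ i =>
        rw [show ((i + 1 : ℕ) : ℤ) - 1 = i by push_cast; ring, hg1, hg1, pow_succ', mul_smul,
          beta_zero_gamma_zero (hc1 i)]
        congr 2
        push_cast; ring
  · refine ⟨by rw [hg2]; simpa [sub_eq_add_neg] using hs1 i, ?_, ?_⟩
    · cases i with
      | zero =>
        have h1 := hg2 0
        simp only [Nat.cast_zero] at h1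
        rw [Nat.cast_zero, h1]
        change gamma 0 • v = gamma 0 ^ 1 • v
        rw [pow_one]
      | succ i =>
        rw [show -((i + 1 : ℕ) : ℤ) + 1 = -i by push_cast; ring, hg2, hg2, hs2]
    · rw [show -(i : ℤ) - 1 = -((i + 1 : ℕ) : ℤ) by push_cast; ring, hg2, hg2, hs3]
      congr 2
      push_cast; ring

variable [Module ℂ E] [IsScalarTower ℂ Ghost E]

/-- The universal property of `W_μ`. -/
theorem exists_hom_of_typical (hμ : ∀ n : ℤ, μ ≠ n) {n : ℤ} {v : E}
    (h : IsVacuumVector (-(μ + n)) v) :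
    ∃ ψ : typical μ →ₗ[Ghost] E, ψ (typicalVec μ n) = v := by
  -- The string around v has parameter μ + n; reindexing by m - n puts v in position n of the string
  -- for μ.
  obtain ⟨g', h0, hg'⟩ := exists_string (μ := μ + n) (fun m hm => hμ (m - n) (by
    rw [eq_sub_of_add_eq hm]; push_cast; rfl)) h
  have hg : ∀ m : ℤ, IsVacuumVector (-(μ + m)) (g' (m - n)) ∧
      gamma 0 • g' (m - n) = g' (m + 1 - n) ∧
      beta 0 • g' (m - n) = algebraMap ℂ Ghost (-(μ + m)) • g' (m - 1 - n) := fun m => by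
    have := hg' (m - n)
    rw [show m + 1 - n = m - n + 1 by ring, show m - 1 - n = m - n - 1 by ring]
    rwa [show μ + n + (m - n : ℤ) = μ + m by push_cast; ring] at this
  let φ : (ℤ →₀ ℂ) →ₗ[ℂ] E := Finsupp.linearCombination ℂ fun m => g' (m - n)
  have hφ : ∀ m a, φ (Finsupp.single m a) = a • g' (m - n) := fun m a =>
    Finsupp.linearCombination_single _ _ _
  have hext : ∀ (x : Ghost) (S : Module.End ℂ (ℤ →₀ ℂ)),
      (∀ m, x • φ (Finsupp.single m 1) = φ (S (Finsupp.single m 1))) → ∀ u, x • φ u = φ (S u) := by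
    intro x S hx u
    have : Module.toModuleEnd ℂ (S := Ghost) E x ∘ₗ φ = φ ∘ₗ S := Finsupp.lhom_ext' fun m =>
      LinearMap.ext_ring (hx m)
    exact LinearMap.congr_fun this u
  have hβ : ∀ u, beta 0 • φ u = -φ (denseP μ u) := fun u => by
    have := hext (beta 0) (-denseP μ) (fun m => ?_) u
    · rwa [LinearMap.neg_apply, map_neg] at this
    · rw [LinearMap.neg_apply, denseP_single, map_neg, map_smul, hφ, hφ, one_smul, one_smul,
        (hg m).2.2, algebraMap_smul, neg_smul]
  have hγ : ∀ u, gamma 0 • φ u = φ (denseQ u) := hext (gamma 0) denseQ fun m => by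
    rw [denseQ_single, hφ, hφ, one_smul, one_smul, (hg m).2.1]
  have hann : ∀ i u, ann i • φ u = 0 := fun i u => by
    have := hext (ann i) 0 (fun m => ?_) u
    · rw [this, LinearMap.zero_apply, map_zero]
    · rw [hφ, one_smul, (hg m).1.1 i, LinearMap.zero_apply, map_zero]
  obtain ⟨ψ, hψ⟩ := exists_hom_of_induced (denseP μ) denseQ _ φ hβ hγ hann
  refine ⟨ψ, (hψ _).trans ?_⟩
  rw [hφ, one_smul, sub_self, h0]

end Universal

end Typical

/-! ### Splitting of extensions by `W_μ` -/

section Split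

variable {L E N : Type} [AddCommGroup L] [Module Ghost L] [AddCommGroup E] [Module Ghost E]
  [AddCommGroup N] [Module Ghost N] {i : L →ₗ[Ghost] E} {p : E →ₗ[Ghost] N}

theorem exists_section_of_isCompl (hip : Function.Exact i p) (hp : Function.Surjective p)
    {C : Submodule Ghost E} (hC : IsCompl (LinearMap.range i) C) :
    ∃ s : N →ₗ[Ghost] E, ∀ x, p (s x) = x := by
  have hbij : Function.Bijective (p ∘ₗ C.subtype) := by
    constructor
    · rw [← LinearMap.ker_eq_bot, eq_bot_iff]
      rintro ⟨v, hv⟩ h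
      have h1 : v ∈ LinearMap.range i ⊓ C := ⟨(hip v).1 h, hv⟩
      rw [hC.inf_eq_bot] at h1
      exact Subtype.ext h1
    · intro x
      obtain ⟨v, rfl⟩ := hp x
      have h1 : v ∈ LinearMap.range i ⊔ C := hC.sup_eq_top ▸ Submodule.mem_top
      obtain ⟨_, ⟨y, rfl⟩, w, hw, rfl⟩ := Submodule.mem_sup.1 h1
      refine ⟨⟨w, hw⟩, ?_⟩
      rw [map_add, (hip _).2 ⟨y, rfl⟩, zero_add]
      rfl
  let e := LinearEquiv.ofBijective _ hbij
  exact ⟨C.subtype ∘ₗ e.symm.toLinearMap, fun x => e.apply_symm_apply x⟩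

theorem exists_retraction_of_isCompl (hi : Function.Injective i) {C : Submodule Ghost E}
    (hC : IsCompl (LinearMap.range i) C) : ∃ r : E →ₗ[Ghost] L, ∀ y, r (i y) = y := by
  refine ⟨(LinearEquiv.ofInjective i hi).symm.toLinearMap ∘ₗ
    (LinearMap.range i).projectionOnto C hC, fun y => ?_⟩
  have h := Submodule.projectionOnto_apply_left hC (LinearEquiv.ofInjective i hi y)
  change (LinearEquiv.ofInjective i hi).symm ((LinearMap.range i).projectionOnto C hC (i y)) = y
  rw [LinearEquiv.ofInjective_apply] at h
  rw [h, LinearEquiv.symm_apply_apply]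

/-- In the pattern l the zero mode γ_0 is nilpotent for l < 0 and β_0 for l > 0; only l = 0 leaves
both unconstrained. -/
theorem locallyFinite_int_of_nilAt {l : ℤ} (hl : l ≠ 0) {v : E} (h : NilAt l v) :
    LocallyFinite (Set.range ((↑) : ℤ → ℂ)) (number 0) v := by
  rcases lt_or_gt_of_ne hl with h0 | h0
  · exact locallyFinite_of_gamma (h.2 _ (by simpa using h0))
  · exact locallyFinite_of_beta (h.1 _ (by simpa using h0))

theorem int_stable (c : ℂ) (m : ℤ) (h : c + m ∈ Set.range ((↑) : ℤ → ℂ)) :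
    c ∈ Set.range ((↑) : ℤ → ℂ) := by
  obtain ⟨n, hn⟩ := h
  exact ⟨n - m, by rw [Int.cast_sub, hn, add_sub_cancel_right]⟩

variable [Module ℂ E] [IsScalarTower ℂ Ghost E]

/-- The submodule of vectors on which a number operator is locally finite with weights in `T`. -/
def locallyFiniteSubmodule (E : Type) [AddCommGroup E] [Module Ghost E] [Module ℂ E]
    [IsScalarTower ℂ Ghost E] (T : Set ℂ) (hT : ∀ (c : ℂ) (m : ℤ), c + m ∈ T → c ∈ T) (n : ℤ) :
    Submodule Ghost E where
  carrier := {v | LocallyFinite T (number n) v}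
  zero_mem' := .zero _ _
  add_mem' := .add
  smul_mem' a _ hv := hv.ghost_smul hT a

open Polynomial in
/-- An extension of modules with disjoint weights of a number operator splits. -/
theorem exists_isCompl_of_disjoint (hip : Function.Exact i p) {S T : Set ℂ} (hST : Disjoint S T)
    (hT : ∀ (c : ℂ) (m : ℤ), c + m ∈ T → c ∈ T) (n : ℤ)
    (hL : ∀ y : L, LocallyFinite S (number n) y) (hN : ∀ x : N, LocallyFinite T (number n) x) :
    ∃ C : Submodule Ghost E, IsCompl (LinearMap.range i) C := by
  refine ⟨locallyFiniteSubmodule E T hT n, isCompl_iff.2 ⟨?_, ?_⟩⟩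
  · rw [Submodule.disjoint_def]
    rintro _ ⟨y, rfl⟩ h
    exact ((hL y).map i).eq_zero hST h
  · rw [codisjoint_iff, eq_top_iff]
    intro v _
    obtain ⟨g, h1, h2, h3⟩ := hN (p v)
    rw [← map_smul] at h3
    obtain ⟨y, hy⟩ := (hip _).1 h3
    obtain ⟨f, h4, h5, h6⟩ := (hL y).map i
    obtain ⟨r, s, hrs⟩ := isCoprime_of_disjoint hST h4 h5 h2
    -- Bézout: r f + s g = 1, where g(N) v = i y and f(N) kills i y. The first summand lies in the
    -- range of i, and the second is killed by g(N), so it has weights in T.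
    have hv : v = aeval (number n) s • i y + aeval (number n) r • aeval (number n) f • v := by
      have := congrArg (fun q => aeval (number n) q • v) hrs
      simp only [map_add, map_mul, map_one, one_smul, add_smul, mul_smul] at this
      rw [hy, add_comm, this]
    rw [hv]
    refine Submodule.add_mem_sup ⟨_, map_smul i _ y⟩ ⟨g, h1, h2, ?_⟩
    rw [aeval_mul_comm, aeval_mul_comm _ g, ← hy, h6, smul_zero]

variable {μ : ℂ}

/-- Extensions of `W_μ` by modules with locally nilpotent modes split. -/
theorem exists_section_typical (hμ : ∀ n : ℤ, μ ≠ n) (hE : IsWeightModule E)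
    {i : L →ₗ[Ghost] E} {p : E →ₗ[Ghost] typical μ} (hip : Function.Exact i p)
    (hp : Function.Surjective p) {l : ℤ} (hL : ∀ y : L, NilAt l y) :
    ∃ s : typical μ →ₗ[Ghost] E, ∀ x, p (s x) = x := by
  by_cases hl : l = 0
  · subst hl
    have hn : ∀ v : E, NilAt 0 v := NilAt.of_exact hip hL (nilAt_typical hμ)
    have hspan := span_isVacuumVector hE hn
    -- Vacuum vectors generate E, so p would be zero if it killed all of them.
    obtain ⟨v, j, hj, hv⟩ : ∃ (v : E) (j : ℂ), IsVacuumVector j v ∧ p v ≠ 0 := by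
      by_contra! hcon
      have h0 : p = 0 := by
        refine LinearMap.ext_on hspan ?_
        rintro v ⟨j, hj⟩
        exact hcon v j hj
      obtain ⟨v, hv⟩ := hp (typicalVec μ 0)
      exact typicalVec_ne_zero μ 0 (by rw [← hv, h0, LinearMap.zero_apply])
    obtain ⟨n, c, hc, rfl, hpv⟩ := eq_typicalVec_of_isVacuumVector (hj.map p) hv
    obtain ⟨ψ, hψ⟩ := exists_hom_of_typical hμ (hj.algebraMap_smul c⁻¹)
    refine ⟨ψ, fun x => ?_⟩
    obtain ⟨a, rfl⟩ := typical_generator hμ n x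
    rw [map_smul, map_smul, hψ, map_smul, hpv, smul_smul (algebraMap ℂ Ghost c⁻¹), ← map_mul,
      inv_mul_cancel₀ hc, map_one, one_smul]
  · obtain ⟨C, hC⟩ := exists_isCompl_of_disjoint hip (disjoint_typicalWeights hμ).symm
      typicalWeights_stable 0 (fun y => locallyFinite_int_of_nilAt hl (hL y))
      (locallyFinite_typical hμ)
    exact exists_section_of_isCompl hip hp hC

/-- Extensions of modules with locally nilpotent modes by `W_μ` split. -/
theorem exists_retraction_typical (hμ : ∀ n : ℤ, μ ≠ n) (hE : IsWeightModule E)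
    {i : typical μ →ₗ[Ghost] E} {p : E →ₗ[Ghost] N} (hi : Function.Injective i)
    (hip : Function.Exact i p) {l : ℤ} (hN : ∀ y : N, NilAt l y) :
    ∃ r : E →ₗ[Ghost] typical μ, ∀ x, r (i x) = x := by
  by_cases hl : l = 0
  · subst hl
    have hn : ∀ v : E, NilAt 0 v := NilAt.of_exact hip (nilAt_typical hμ) hN
    have hspan := span_isVacuumVector hE hn
    have hstable : ∀ (c : ℂ) (m : ℤ), c + m ∈ (typicalWeights μ)ᶜ → c ∈ (typicalWeights μ)ᶜ :=
      fun c m h h' => h (typicalWeights_stable _ (-m) (by simpa using h'))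
    -- The vacuum vectors of foreign weight. All weights of `number 0` on O avoid -μ + ℤ, so O meets
    -- the copy of W_μ only in 0.
    let O : Submodule Ghost E :=
      Submodule.span Ghost {v | ∃ j ∈ (typicalWeights μ)ᶜ, IsVacuumVector j v}
    have hO : O ≤ locallyFiniteSubmodule E _ hstable 0 := Submodule.span_le.2 fun v ⟨j, hj, hv⟩ =>
      LocallyFinite.of_eigen hj hv.2
    have hinj : Function.Injective (O.mkQ ∘ₗ i) := by
      rw [← LinearMap.ker_eq_bot, eq_bot_iff]
      intro x hx
      have h1 : i x ∈ O := (Submodule.Quotient.mk_eq_zero O).1 hx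
      have h2 := ((locallyFinite_typical hμ x).map i).eq_zero disjoint_compl_right (hO h1)
      exact hi (h2.trans (map_zero i).symm)
    have hψ : ∀ v : {v : E // ∃ n : ℤ, IsVacuumVector (-(μ + n)) v},
        ∃ ψ : typical μ →ₗ[Ghost] E, v.1 ∈ LinearMap.range ψ := by
      rintro ⟨v, n, hv⟩
      obtain ⟨ψ, h⟩ := exists_hom_of_typical hμ hv
      exact ⟨ψ, _, h⟩
    choose ψ hψ using hψ
    have := isSimpleModule_typical hμ
    -- Modulo O only vacuum vectors with weight in -μ + ℤ remain, and each lies in a homomorphic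
    -- image of the simple module W_μ; a sum of such images is semisimple.
    have hss : IsSemisimpleModule Ghost (E ⧸ O) := by
      refine isSemisimpleModule_of_isSemisimpleModule_submodule'
        (p := fun v => LinearMap.range (O.mkQ ∘ₗ ψ v)) (fun v => IsSemisimpleModule.range _) ?_
      have h1 : Submodule.map O.mkQ ⊤ = ⊤ := by rw [Submodule.map_top, Submodule.range_mkQ]
      rw [eq_top_iff, ← h1, ← hspan, Submodule.map_span_le]
      rintro v ⟨j, hj⟩
      by_cases hjT : j ∈ typicalWeights μ
      · obtain ⟨n, rfl⟩ := hjT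
        refine Submodule.mem_iSup_of_mem ⟨v, n, hj⟩ ?_
        obtain ⟨x, hx⟩ := hψ ⟨v, n, hj⟩
        exact ⟨x, congrArg O.mkQ hx⟩
      · have : O.mkQ v = 0 := (Submodule.Quotient.mk_eq_zero O).2
          (Submodule.subset_span ⟨j, hjT, hj⟩)
        rw [this]
        exact Submodule.zero_mem _
    obtain ⟨C, hC⟩ := exists_isCompl (LinearMap.range (O.mkQ ∘ₗ i))
    obtain ⟨r, hr⟩ := exists_retraction_of_isCompl hinj hC
    exact ⟨r ∘ₗ O.mkQ, hr⟩
  · obtain ⟨C, hC⟩ := exists_isCompl_of_disjoint hip (disjoint_typicalWeights hμ)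
      int_stable 0 (locallyFinite_typical hμ) fun y => locallyFinite_int_of_nilAt hl (hN y)
    exact exists_retraction_of_isCompl hi hC

end Split

/-! ### Classes of modules closed under extensions -/

/-- The closure of a class of modules under extensions. -/
inductive ExtensionClosure (B : ModuleCat.{0} Ghost → Prop) : ModuleCat.{0} Ghost → Prop
  | base (M : ModuleCat.{0} Ghost) (hM : B M) : ExtensionClosure B M
  | extension {L M N : ModuleCat.{0} Ghost} (f : L →ₗ[Ghost] M) (g : M →ₗ[Ghost] N)
      (hf : Function.Injective f) (hfg : Function.Exact f g) (hg : Function.Surjective g)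
      (hL : ExtensionClosure B L) (hN : ExtensionClosure B N) : ExtensionClosure B M

section Lift

variable {L M N P : Type} [AddCommGroup L] [Module Ghost L] [AddCommGroup M] [Module Ghost M]
  [AddCommGroup N] [Module Ghost N] [AddCommGroup P] [Module Ghost P]

theorem exists_lift_of_injective {f : L →ₗ[Ghost] M} (hf : Function.Injective f)
    (h : P →ₗ[Ghost] M) (hh : ∀ x, h x ∈ LinearMap.range f) :
    ∃ k : P →ₗ[Ghost] L, ∀ x, f (k x) = h x := by
  refine ⟨(LinearEquiv.ofInjective f hf).symm.toLinearMap ∘ₗ h.codRestrict _ hh, fun x => ?_⟩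
  exact congrArg Subtype.val
    ((LinearEquiv.ofInjective f hf).apply_symm_apply (h.codRestrict _ hh x))

theorem exists_desc_of_surjective {g : M →ₗ[Ghost] N} (hg : Function.Surjective g)
    (h : M →ₗ[Ghost] P) (hh : ∀ x, g x = 0 → h x = 0) :
    ∃ k : N →ₗ[Ghost] P, ∀ x, k (g x) = h x := by
  refine ⟨(LinearMap.ker g).liftQ h hh ∘ₗ (g.quotKerEquivOfSurjective hg).symm.toLinearMap,
    fun x => ?_⟩
  have : (g.quotKerEquivOfSurjective hg).symm (g x) = Submodule.Quotient.mk x :=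
    (g.quotKerEquivOfSurjective hg).symm_apply_apply (Submodule.Quotient.mk x)
  rw [LinearMap.comp_apply, LinearEquiv.coe_coe, this]
  rfl

end Lift

namespace ExtensionClosure

variable {B : ModuleCat.{0} Ghost → Prop}

theorem mono {B' : ModuleCat.{0} Ghost → Prop} (h : ∀ M, B M → B' M) {M : ModuleCat.{0} Ghost}
    (hM : ExtensionClosure B M) : ExtensionClosure B' M := by
  induction hM with
  | base M hM => exact .base M (h M hM)
  | extension f g hf hfg hg _ _ h1 h2 => exact .extension f g hf hfg hg h1 h2

/-- The filtration of M is intersected with the submodule. -/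
theorem of_injective
    (hB : ∀ M K : ModuleCat.{0} Ghost, B M → ∀ j : K →ₗ[Ghost] M, Function.Injective j → B K)
    {M : ModuleCat.{0} Ghost} (hM : ExtensionClosure B M) : ∀ {K : ModuleCat.{0} Ghost}
    (j : K →ₗ[Ghost] M), Function.Injective j → ExtensionClosure B K := by
  induction hM with
  | base M hM => exact fun j hj => .base _ (hB M _ hM j hj)
  | @extension L M N f g hf hfg hg _ _ h1 h2 =>
    intro K j hj
    obtain ⟨k, hk⟩ := exists_lift_of_injective hf (j ∘ₗ (LinearMap.ker (g ∘ₗ j)).subtype)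
      fun x => (hfg _).1 x.2
    refine .extension (L := ModuleCat.of Ghost (LinearMap.ker (g ∘ₗ j)))
      (N := ModuleCat.of Ghost (LinearMap.range (g ∘ₗ j))) (LinearMap.ker (g ∘ₗ j)).subtype
      (g ∘ₗ j).rangeRestrict Subtype.val_injective (fun x => ?_) (LinearMap.surjective_rangeRestrict _)
      (h1 (K := ModuleCat.of Ghost (LinearMap.ker (g ∘ₗ j))) k fun x y h => ?_)
      (h2 (K := ModuleCat.of Ghost (LinearMap.range (g ∘ₗ j)))
        (LinearMap.range (g ∘ₗ j)).subtype Subtype.val_injective)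
    · constructor
      · intro h
        exact ⟨⟨x, congrArg Subtype.val h⟩, rfl⟩
      · rintro ⟨y, rfl⟩
        exact Subtype.ext y.2
    · have := congrArg f h
      rw [hk, hk] at this
      exact Subtype.ext (hj this)

/-- The filtration of M is pushed forward along the quotient map. -/
theorem of_surjective
    (hB : ∀ M K : ModuleCat.{0} Ghost, B M → ∀ q : M →ₗ[Ghost] K, Function.Surjective q → B K)
    {M : ModuleCat.{0} Ghost} (hM : ExtensionClosure B M) : ∀ {K : ModuleCat.{0} Ghost}
    (q : M →ₗ[Ghost] K), Function.Surjective q → ExtensionClosure B K := by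
  induction hM with
  | base M hM => exact fun j hj => .base _ (hB M _ hM j hj)
  | @extension L M N f g hf hfg hg _ _ h1 h2 =>
    intro K q hq
    let R := LinearMap.range (q ∘ₗ f)
    obtain ⟨k, hk⟩ := exists_desc_of_surjective hg (R.mkQ ∘ₗ q) fun x hx => by
      obtain ⟨y, rfl⟩ := (hfg x).1 hx
      exact (Submodule.Quotient.mk_eq_zero R).2 ⟨y, rfl⟩
    refine .extension (L := ModuleCat.of Ghost R) (N := ModuleCat.of Ghost (K ⧸ R)) R.subtype R.mkQ
      Subtype.val_injective (LinearMap.exact_subtype_mkQ R) (Submodule.mkQ_surjective R)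
      (h1 (K := ModuleCat.of Ghost R) (q ∘ₗ f).rangeRestrict (LinearMap.surjective_rangeRestrict _))
      (h2 (K := ModuleCat.of Ghost (K ⧸ R)) k fun y => ?_)
    obtain ⟨y, rfl⟩ := Submodule.mkQ_surjective R y
    obtain ⟨x, rfl⟩ := hq y
    exact ⟨g x, hk x⟩

/-- Non-zero submodules contain non-zero cyclic submodules from the original class. -/
theorem exists_span_singleton
    (hB : ∀ M K : ModuleCat.{0} Ghost, B M → ∀ j : K →ₗ[Ghost] M, Function.Injective j →
      ∀ z : K, (∀ v : K, ∃ a : Ghost, a • z = v) → B K)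
    {M : ModuleCat.{0} Ghost} (hM : ExtensionClosure B M) : ∀ {K : Type} [AddCommGroup K]
    [Module Ghost K] (j : K →ₗ[Ghost] M), Function.Injective j → Nontrivial K →
    ∃ x : K, x ≠ 0 ∧ B (ModuleCat.of Ghost (Submodule.span Ghost {x})) := by
  induction hM with
  | base M hM =>
    intro K _ _ j hj _
    obtain ⟨x, hx⟩ := exists_ne (0 : K)
    refine ⟨x, hx, hB M (ModuleCat.of Ghost (Submodule.span Ghost {x})) hM
      (j ∘ₗ (Submodule.span Ghost {x}).subtype) (hj.comp Subtype.val_injective)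
      (⟨x, Submodule.mem_span_singleton_self x⟩ : Submodule.span Ghost {x}) ?_⟩
    rintro ⟨v, hv⟩
    obtain ⟨a, ha⟩ := Submodule.mem_span_singleton.1 hv
    exact ⟨a, Subtype.ext ha⟩
  | @extension L M N f g hf hfg hg _ _ h1 h2 =>
    intro K _ _ j hj _
    -- Either the submodule meets L, and the claim for L applies, or it embeds into N. Only cyclic
    -- submodules are asked to stay in the class, since finite generation need not pass to arbitrary
    -- submodules.
    by_cases hker : ∃ x, x ≠ 0 ∧ g (j x) = 0
    · obtain ⟨x, hx, hgx⟩ := hker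
      obtain ⟨k, hk⟩ := exists_lift_of_injective hf (j ∘ₗ (LinearMap.ker (g ∘ₗ j)).subtype)
        fun x => (hfg _).1 x.2
      obtain ⟨y, hy, hBy⟩ := h1 k (fun a b h => by
          have := congrArg f h
          rw [hk, hk] at this
          exact Subtype.ext (hj this))
        (nontrivial_of_ne (⟨x, hgx⟩ : LinearMap.ker (g ∘ₗ j)) 0 fun h => hx (congrArg Subtype.val h))
      refine ⟨y, fun h => hy (Subtype.ext h), ?_⟩
      -- The spans of y inside the kernel and inside K are different types, so the property has to
      -- be transported between them.
      obtain ⟨m, hm⟩ := exists_lift_of_injective (f := (Submodule.span Ghost {y}).subtype)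
        Subtype.val_injective ((Submodule.inclusion (show Submodule.span Ghost {y.1} ≤
          LinearMap.ker (g ∘ₗ j) from
            (Submodule.span_singleton_le_iff_mem _ _).2 y.2))) (fun x => by
          rw [Submodule.range_subtype]
          obtain ⟨a, ha⟩ := Submodule.mem_span_singleton.1 x.2
          exact Submodule.mem_span_singleton.2 ⟨a, Subtype.ext ha⟩)
      refine hB _ (ModuleCat.of Ghost (Submodule.span Ghost {y.1})) hBy m (fun a b h => ?_)
        (⟨y.1, Submodule.mem_span_singleton_self _⟩ : Submodule.span Ghost {y.1}) ?_
      · have := congrArg (Submodule.span Ghost {y}).subtype h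
        rw [hm, hm] at this
        exact Submodule.inclusion_injective _ this
      · rintro ⟨v, hv⟩
        obtain ⟨a, ha⟩ := Submodule.mem_span_singleton.1 hv
        exact ⟨a, Subtype.ext ha⟩
    · push Not at hker
      exact h2 (g ∘ₗ j) (by
        rw [← LinearMap.ker_eq_bot, eq_bot_iff]
        intro x hx
        by_contra h0
        exact hker x h0 hx) inferInstance

end ExtensionClosure

/-! ### Devissage of splittings -/

section Devissage

variable {B : ModuleCat.{0} Ghost → Prop} {X : ModuleCat.{0} Ghost}

theorem IsWeightModule.submodule {E : Type} [AddCommGroup E] [Module Ghost E] [Module ℂ E]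
    [IsScalarTower ℂ Ghost E] (h : IsWeightModule E) (N : Submodule Ghost E) :
    IsWeightModule (ModuleCat.of Ghost N) :=
  h.of_injective (M := ModuleCat.of Ghost N) N.subtype Subtype.val_injective

theorem IsWeightModule.quotient {E : Type} [AddCommGroup E] [Module Ghost E] [Module ℂ E]
    [IsScalarTower ℂ Ghost E] (h : IsWeightModule E) (N : Submodule Ghost E) :
    IsWeightModule (ModuleCat.of Ghost (E ⧸ N)) :=
  h.of_surjective (N := ModuleCat.of Ghost (E ⧸ N)) N.mkQ (Submodule.mkQ_surjective N)

/-- With R the image of L, the case of N splits E/R over X; the preimage in E of that section maps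
onto X with kernel the image of L, and the case of L splits it. Since i is not required to be
injective, no injectivity has to be carried through the quotients. -/
theorem exists_section_of_closure
    (hB : ∀ M : ModuleCat.{0} Ghost, B M → ∀ E : ModuleCat.{0} Ghost, IsWeightModule E →
      ∀ (i : M →ₗ[Ghost] E) (p : E →ₗ[Ghost] X), Function.Exact i p → Function.Surjective p →
        ∃ s : X →ₗ[Ghost] E, ∀ x, p (s x) = x) {M : ModuleCat.{0} Ghost}
    (hM : ExtensionClosure B M) : ∀ E : ModuleCat.{0} Ghost, IsWeightModule E →
      ∀ (i : M →ₗ[Ghost] E) (p : E →ₗ[Ghost] X), Function.Exact i p → Function.Surjective p →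
        ∃ s : X →ₗ[Ghost] E, ∀ x, p (s x) = x := by
  induction hM with
  | base M hM => exact hB M hM
  | @extension L M N f g hf hfg hg _ _ h1 h2 =>
    intro E hE i p hip hp
    let R := LinearMap.range (i ∘ₗ f)
    have hRp : R ≤ LinearMap.ker p := by
      rintro _ ⟨y, rfl⟩
      exact (hip _).2 ⟨f y, rfl⟩
    obtain ⟨k, hk⟩ := exists_desc_of_surjective hg (R.mkQ ∘ₗ i) fun x hx => by
      obtain ⟨y, rfl⟩ := (hfg x).1 hx
      exact (Submodule.Quotient.mk_eq_zero R).2 ⟨y, rfl⟩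
    obtain ⟨s, hs⟩ := h2 (ModuleCat.of Ghost (E ⧸ R)) (hE.quotient R) k (R.liftQ p hRp)
      (fun v => by
        obtain ⟨v, rfl⟩ := Submodule.mkQ_surjective R v
        constructor
        · intro h
          obtain ⟨m, rfl⟩ := (hip v).1 h
          exact ⟨g m, hk m⟩
        · rintro ⟨n, hn⟩
          obtain ⟨m, rfl⟩ := hg n
          rw [← hn, hk]
          exact (hip _).2 ⟨m, rfl⟩)
      (fun x => by
        obtain ⟨v, hv⟩ := hp x
        exact ⟨R.mkQ v, hv⟩)
    let s' : X →ₗ[Ghost] (E ⧸ R) := s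
    let E' : Submodule Ghost E := (LinearMap.range s').comap R.mkQ
    have hL : ∀ y, (i ∘ₗ f) y ∈ E' := fun y =>
      ⟨0, (map_zero s').trans ((Submodule.Quotient.mk_eq_zero R).2 ⟨y, rfl⟩).symm⟩
    obtain ⟨t, ht⟩ := h1 (ModuleCat.of Ghost E') (hE.submodule E')
      ((i ∘ₗ f).codRestrict E' hL) (p ∘ₗ E'.subtype)
      (fun v => by
        obtain ⟨v, x, hx⟩ := v
        constructor
        · intro h
          have h3 : x = 0 := by
            rw [← hs x]
            exact (congrArg (R.liftQ p hRp) hx).trans h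
          have h4 : R.mkQ v = 0 := by rw [← hx, h3, map_zero]
          obtain ⟨y, hy⟩ := (Submodule.Quotient.mk_eq_zero R).1 h4
          exact ⟨y, Subtype.ext hy⟩
        · rintro ⟨y, hy⟩
          exact (congrArg (fun w : E' => p w) hy).symm.trans ((hip _).2 ⟨f y, rfl⟩))
      (fun x => by
        obtain ⟨v, hv⟩ := Submodule.mkQ_surjective R (s' x)
        refine ⟨⟨v, x, hv.symm⟩, ?_⟩
        exact (congrArg (R.liftQ p hRp) hv).trans (hs x))
    exact ⟨E'.subtype ∘ₗ t, ht⟩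

/-- Dual to `exists_section_of_closure`: the part E' of E over L retracts onto X by the case of L.
Dividing E by the kernel of this retraction leaves X with a map to N, to which the case of N
applies. -/
theorem exists_retraction_of_closure
    (hB : ∀ M : ModuleCat.{0} Ghost, B M → ∀ E : ModuleCat.{0} Ghost, IsWeightModule E →
      ∀ (i : X →ₗ[Ghost] E) (p : E →ₗ[Ghost] M), Function.Injective i → Function.Exact i p →
        ∃ r : E →ₗ[Ghost] X, ∀ x, r (i x) = x) {M : ModuleCat.{0} Ghost}
    (hM : ExtensionClosure B M) : ∀ E : ModuleCat.{0} Ghost, IsWeightModule E →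
      ∀ (i : X →ₗ[Ghost] E) (p : E →ₗ[Ghost] M), Function.Injective i → Function.Exact i p →
        ∃ r : E →ₗ[Ghost] X, ∀ x, r (i x) = x := by
  induction hM with
  | base M hM => exact hB M hM
  | @extension L M N f g hf hfg hg _ _ h1 h2 =>
    intro E hE i p hi hip
    let E' := LinearMap.ker (g ∘ₗ p)
    have hpi : ∀ x, p (i x) = 0 := fun x => (hip _).2 ⟨x, rfl⟩
    have hiE : ∀ x, i x ∈ E' := fun x => by
      change g (p (i x)) = 0
      rw [hpi, map_zero]
    obtain ⟨k, hk⟩ := exists_lift_of_injective hf (p ∘ₗ E'.subtype) fun v => (hfg _).1 v.2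
    obtain ⟨r, hr⟩ := h1 (ModuleCat.of Ghost E') (hE.submodule E') (i.codRestrict E' hiE) k
      (fun x y h => hi (congrArg Subtype.val h))
      (fun v => by
        constructor
        · intro h
          have h3 : p v.1 = 0 := (hk v).symm.trans ((congrArg f h).trans (map_zero f))
          obtain ⟨x, hx⟩ := (hip _).1 h3
          exact ⟨x, Subtype.ext hx⟩
        · rintro ⟨x, rfl⟩
          exact hf ((hk _).trans ((hpi x).trans (map_zero f).symm)))
    let r' : E' →ₗ[Ghost] X := r
    have hr' : ∀ x, r' ⟨i x, hiE x⟩ = x := hr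
    let K : Submodule Ghost E := (LinearMap.ker r').map E'.subtype
    have hK : K ≤ LinearMap.ker (g ∘ₗ p) := by
      rintro _ ⟨v, -, rfl⟩
      exact v.2
    obtain ⟨t, ht⟩ := h2 (ModuleCat.of Ghost (E ⧸ K)) (hE.quotient K) (K.mkQ ∘ₗ i)
      (K.liftQ (g ∘ₗ p) hK)
      (by
        rw [← LinearMap.ker_eq_bot, eq_bot_iff]
        intro x hx
        obtain ⟨v, hv, hvx⟩ := (Submodule.Quotient.mk_eq_zero K).1 hx
        have h3 : v = ⟨i x, hiE x⟩ := Subtype.ext hvx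
        rw [h3] at hv
        exact (hr' x).symm.trans hv)
      (fun v => by
        obtain ⟨v, rfl⟩ := Submodule.mkQ_surjective K v
        constructor
        · intro h
          refine ⟨r' ⟨v, h⟩, (Submodule.Quotient.eq K).2 ?_⟩
          refine ⟨⟨i (r' ⟨v, h⟩), hiE _⟩ - ⟨v, h⟩, ?_, rfl⟩
          change r' _ = 0
          rw [map_sub, hr', sub_self]
        · rintro ⟨x, hx⟩
          rw [← hx]
          exact hiE x)
    exact ⟨t ∘ₗ K.mkQ, ht⟩

end Devissage

/-! ### Modules in `R` -/

section ClassR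

variable {M N : Type} [AddCommGroup M] [Module Ghost M] [AddCommGroup N] [Module Ghost N]
  [Module ℂ M] [IsScalarTower ℂ Ghost M] [Module ℂ N] [IsScalarTower ℂ Ghost N]

theorem IsR.of_surjective (hM : IsR M) (f : M →ₗ[Ghost] N) (hf : Function.Surjective f) : IsR N where
  toIsWeightModule := hM.toIsWeightModule.of_surjective f hf
  finite := have := hM.finite; Module.Finite.of_surjective f hf
  nilpotent w := by
    obtain ⟨v, rfl⟩ := hf w
    have : FiniteDimensional ℂ (positiveSpan v) := hM.nilpotent v
    refine Submodule.finiteDimensional_of_le (S₂ := (positiveSpan v).map (toC f)) ?_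
    rintro _ ⟨a, ha, rfl⟩
    exact ⟨a • v, ⟨a, ha, rfl⟩, map_smul f a v⟩

theorem IsR.of_injective (hM : IsR M) (f : N →ₗ[Ghost] M) (hf : Function.Injective f) {z : N}
    (hz : ∀ v : N, ∃ a : Ghost, a • z = v) : IsR N where
  toIsWeightModule := hM.toIsWeightModule.of_injective f hf
  finite := ⟨⟨{z}, by
    rw [Finset.coe_singleton, eq_top_iff]
    exact fun v _ => Submodule.mem_span_singleton.2 (hz v)⟩⟩
  nilpotent v := by
    have : FiniteDimensional ℂ (positiveSpan (f v)) := hM.nilpotent (f v)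
    have h : ∀ w ∈ positiveSpan v, toC f w ∈ positiveSpan (f v) := by
      rintro _ ⟨a, ha, rfl⟩
      exact ⟨a, ha, (map_smul f a v).symm⟩
    exact Module.Finite.of_injective ((toC f).restrict h) fun x y hxy =>
      Subtype.ext (hf (congrArg Subtype.val hxy))

/-- The powers of x shift the J_0-weight by multiples of ε ≠ 0. If all x^i v were non-zero, they
would be linearly independent eigenvectors in a finite-dimensional space. -/
theorem isNilpotentOn_of_finite (h : Smooth M) {x : Ghost} (hx : x ∈ positiveModes) {ε : ℂ}
    (hε : ε ≠ 0) (hJ : ∀ v : M, J0 h (x • v) = x • J0 h v + ε • x • v) {j : ℂ} {v : M}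
    (hv : J0 h v = j • v) [FiniteDimensional ℂ (positiveSpan v)] : IsNilpotentOn x v := by
  by_contra hcon
  simp only [IsNilpotentOn, not_exists] at hcon
  have hw : ∀ i : ℕ, J0 h (x ^ i • v) = (j + i * ε) • x ^ i • v := fun i => by
    induction i with
    | zero => simp [hv]
    | succ i ih =>
      rw [pow_succ', mul_smul, hJ, ih, smul_complex_comm, ← add_smul]
      push_cast
      ring_nf
  have hli := Module.End.eigenvectors_linearIndependent' (J0 h) (fun i : ℕ => j + i * ε)
    (fun a b hab => by simpa [hε] using hab) (fun i => x ^ i • v)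
    fun i => ⟨Module.End.mem_eigenspace_iff.2 (hw i), hcon i⟩
  have hli' : LinearIndependent ℂ fun i : ℕ =>
      (⟨x ^ i • v, x ^ i, positiveModes.pow_mem hx i, rfl⟩ : positiveSpan v) :=
    LinearIndependent.of_comp (positiveSpan v).subtype hli
  have hcard := (hli'.comp (Fin.val (n := Module.finrank ℂ (positiveSpan v) + 1))
    Fin.val_injective).fintype_card_le_finrank
  rw [Fintype.card_fin] at hcard
  omega

theorem IsR.nilAt (hM : IsR M) (v : M) : NilAt 0 v := by
  have key : ∀ v : M, v ∈ ⨆ j : ℂ, Module.End.eigenspace (J0 hM.smooth) j → NilAt 0 v := by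
    intro v hv
    induction hv using Submodule.iSup_induction' with
    | mem j v hv =>
      rw [Module.End.mem_eigenspace_iff] at hv
      have : FiniteDimensional ℂ (positiveSpan v) := hM.nilpotent v
      constructor
      · refine fun n hn => isNilpotentOn_of_finite hM.smooth
          (Algebra.subset_adjoin (.inl ⟨n, by omega, rfl⟩)) one_ne_zero (fun w => ?_) hv
        rw [J0_beta, one_smul]
      · refine fun n hn => isNilpotentOn_of_finite hM.smooth
          (Algebra.subset_adjoin (.inr ⟨n, by omega, rfl⟩)) (neg_ne_zero.2 one_ne_zero)
          (fun w => ?_) hv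
        rw [J0_gamma, neg_one_smul, sub_eq_add_neg]
    | zero => exact ⟨fun _ _ => .zero _, fun _ _ => .zero _⟩
    | add v w _ _ h1 h2 =>
      exact ⟨fun n hn => (h1.1 n hn).add (h2.1 n hn), fun n hn => (h1.2 n hn).add (h2.2 n hn)⟩
  exact key v (hM.semisimple ▸ Submodule.mem_top)

theorem HasRealWeights.of_injective (hM : HasRealWeights M) (f : N →ₗ[Ghost] M)
    (hf : Function.Injective f) : HasRealWeights N := by
  obtain ⟨hs, hr⟩ := hM
  refine ⟨hs.of_injective f hf, fun j hj => ?_⟩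
  obtain ⟨v, hv⟩ := hj.exists_hasEigenvector
  refine hr j (Module.End.hasEigenvalue_of_hasEigenvector (x := f v) ⟨?_, fun h => hv.2 ?_⟩)
  · rw [Module.End.mem_eigenspace_iff, ← map_J0 (hs.of_injective f hf) hs, hv.apply_eq_smul,
      map_complex_smul]
  · exact hf (h.trans (map_zero f).symm)

/-- Images of the eigenspaces of M already span N, so an eigenspace of N for a further, non-real
eigenvalue would be independent of all of N. -/
theorem HasRealWeights.of_surjective (hM : HasRealWeights M) (hw : IsWeightModule M)
    (f : M →ₗ[Ghost] N) (hf : Function.Surjective f) : HasRealWeights N := by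
  obtain ⟨hs, hr⟩ := hM
  have hN := hs.of_surjective f hf
  refine ⟨hN, fun j hj => ?_⟩
  by_contra hne
  have hdis := Module.End.eigenspaces_iSupIndep (J0 hN) j
  have hle : (⊤ : Submodule ℂ N) ≤ ⨆ (i : ℂ) (_ : i ≠ j), Module.End.eigenspace (J0 hN) i := by
    intro y _
    obtain ⟨v, rfl⟩ := hf y
    have hv : v ∈ ⨆ i : ℂ, Module.End.eigenspace (J0 hs) i := hw.semisimple ▸ Submodule.mem_top
    induction hv using Submodule.iSup_induction' with
    | mem i v hv =>
      by_cases h0 : v = 0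
      · rw [h0, map_zero]; exact Submodule.zero_mem _
      · have hi := hr i (Module.End.hasEigenvalue_of_hasEigenvector ⟨hv, h0⟩)
        rw [Module.End.mem_eigenspace_iff] at hv
        refine Submodule.mem_iSup_of_mem i (Submodule.mem_iSup_of_mem ?_ ?_)
        · rintro rfl
          exact hne hi
        · rw [Module.End.mem_eigenspace_iff, ← map_J0 hs hN, hv, map_complex_smul]
    | zero => rw [map_zero]; exact Submodule.zero_mem _
    | add v w _ _ h1 h2 =>
      rw [map_add]
      exact Submodule.add_mem _ (h1 Submodule.mem_top) (h2 Submodule.mem_top)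
  rw [top_le_iff.1 hle, disjoint_top] at hdis
  exact hj hdis

end ClassR

/-- Spectral flows of modules in `R`, up to isomorphism. -/
def IsFlowR (M : ModuleCat.{0} Ghost) : Prop := ∃ l : ℤ, IsR (flow (-l) M)

/-- Modules on which almost all modes with positive index act locally nilpotently, in the pattern
of a spectral flow. -/
def IsLocallyNil (M : ModuleCat.{0} Ghost) : Prop := ∃ l : ℤ, ∀ v : M, NilAt l v

theorem IsFlowR.isLocallyNil {M : ModuleCat.{0} Ghost} (h : IsFlowR M) : IsLocallyNil M := by
  obtain ⟨l, hl⟩ := h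
  refine ⟨l, fun v => ?_⟩
  have := (nilAt_flow (M := M) (-l) 0 v).1 (hl.nilAt _)
  rwa [zero_sub, neg_neg] at this

theorem IsFlowR.of_surjective (M K : ModuleCat.{0} Ghost) (h : IsFlowR M) (q : M →ₗ[Ghost] K)
    (hq : Function.Surjective q) : IsFlowR K := by
  obtain ⟨l, hl⟩ := h
  exact ⟨l, hl.of_surjective (flowMap (-l) q) hq⟩

theorem IsFlowR.of_injective (M K : ModuleCat.{0} Ghost) (h : IsFlowR M) (j : K →ₗ[Ghost] M)
    (hj : Function.Injective j) (z : K) (hz : ∀ v : K, ∃ a : Ghost, a • z = v) : IsFlowR K := by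
  obtain ⟨l, hl⟩ := h
  refine ⟨l, hl.of_injective (flowMap (-l) j) hj (z := z) fun v => ?_⟩
  obtain ⟨a, ha⟩ := hz v
  refine ⟨spectralFlow (-l) a, Eq.trans ?_ ha⟩
  refine (flow_smul (M := K) (-l) _ z).trans ?_
  rw [spectralFlow_neg_apply (-l)]

theorem IsLocallyNil.of_injective (M K : ModuleCat.{0} Ghost) (h : IsLocallyNil M)
    (j : K →ₗ[Ghost] M) (hj : Function.Injective j) : IsLocallyNil K := by
  obtain ⟨l, hl⟩ := h
  exact ⟨l, fun v => (hl (j v)).of_map hj⟩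

theorem IsLocallyNil.of_surjective (M K : ModuleCat.{0} Ghost) (h : IsLocallyNil M)
    (q : M →ₗ[Ghost] K) (hq : Function.Surjective q) : IsLocallyNil K := by
  obtain ⟨l, hl⟩ := h
  refine ⟨l, fun w => ?_⟩
  obtain ⟨v, rfl⟩ := hq w
  exact (hl v).map q

/-- The base case speaks of the twists themselves. Isomorphic copies enter as extensions whose
quotient is the zero module. -/
theorem isIteratedExtension_of_equiv {M N : ModuleCat.{0} Ghost} (hM : IsIteratedExtension M)
    (e : M ≃ₗ[Ghost] N) : IsIteratedExtension N := by
  have hzero : IsR (ModuleCat.of Ghost PUnit.{1}) := by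
    have hs : Smooth (ModuleCat.of Ghost PUnit.{1}) := fun v => ⟨0, fun n _ => ⟨rfl, rfl⟩⟩
    refine { smooth := hs, semisimple := ?_, finite := ?_, nilpotent := fun v => ?_ }
    · exact eq_top_iff.2 fun v _ => (Submodule.zero_mem _ : (0 : ModuleCat.of Ghost PUnit.{1}) ∈ _)
    · exact inferInstanceAs (Module.Finite Ghost PUnit.{1})
    · have : Finite (ModuleCat.of Ghost PUnit.{1}) := inferInstanceAs (Finite PUnit.{1})
      infer_instance
  refine .extension (N := flow 0 (ModuleCat.of Ghost PUnit.{1})) e.toLinearMap 0 e.injective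
    (fun v => ⟨fun _ => e.surjective v, fun _ => rfl⟩) (fun v => ⟨0, rfl⟩) hM (.flow 0 _ hzero)

/-- Replacing the twists by the isomorphism-invariant class `IsFlowR` makes the general facts on
`ExtensionClosure` applicable to F. -/
theorem isIteratedExtension_iff {M : ModuleCat.{0} Ghost} :
    IsIteratedExtension M ↔ ExtensionClosure IsFlowR M := by
  constructor
  · intro h
    induction h with
    | flow l M hM =>
      refine .base _ ⟨l, hM.of_surjective (homToFlow l (LinearMap.id (M := flow l M))) ?_⟩
      exact Function.surjective_id
    | extension f g hf hfg hg _ _ h1 h2 => exact .extension f g hf hfg hg h1 h2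
  · intro h
    induction h with
    | base M hM =>
      obtain ⟨l, hl⟩ := hM
      exact isIteratedExtension_of_equiv (.flow l _ hl) (LinearEquiv.ofBijective
        (homOfFlow l (LinearMap.id (M := flow (-l) M))) Function.bijective_id)
    | extension f g hf hfg hg _ _ h1 h2 => exact .extension f g hf hfg hg h1 h2

/-- Almost all modes of positive index are locally nilpotent on the subquotients of a filtration. -/
abbrev IsFilteredNil : ModuleCat.{0} Ghost → Prop := ExtensionClosure IsLocallyNil

/-- Forgetting finite generation gives a class stable under all submodules, so that kernels of
surjections can serve as left ends of extensions. -/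
theorem IsF.isFilteredNil {M : ModuleCat.{0} Ghost} (h : IsF M) : IsFilteredNil M :=
  (isIteratedExtension_iff.1 h.2.2).mono fun _ hM => hM.isLocallyNil

theorem IsF.of_surjective {M N : ModuleCat.{0} Ghost} (h : IsF M) (f : M →ₗ[Ghost] N)
    (hf : Function.Surjective f) : IsF N :=
  ⟨h.1.of_surjective f hf, h.2.1.of_surjective h.1 f hf, isIteratedExtension_iff.2
    ((isIteratedExtension_iff.1 h.2.2).of_surjective IsFlowR.of_surjective f hf)⟩

/-- Non-zero submodules of objects of `F` contain non-zero objects of `F`. -/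
theorem IsF.exists_submodule {M : ModuleCat.{0} Ghost} (h : IsF M) (K : Submodule Ghost M)
    (hK : K ≠ ⊥) : ∃ (Z : ModuleCat.{0} Ghost) (j : Z →ₗ[Ghost] M), IsF Z ∧ j ≠ 0 ∧
      ∀ z, j z ∈ K := by
  have : Nontrivial K := Submodule.nontrivial_iff_ne_bot.2 hK
  obtain ⟨x, hx, hB⟩ := (isIteratedExtension_iff.1 h.2.2).exists_span_singleton
    IsFlowR.of_injective K.subtype Subtype.val_injective this
  let j : ModuleCat.of Ghost (Submodule.span Ghost {x}) →ₗ[Ghost] M :=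
    K.subtype ∘ₗ (Submodule.span Ghost {x}).subtype
  have hj : Function.Injective j := Subtype.val_injective.comp Subtype.val_injective
  refine ⟨ModuleCat.of Ghost (Submodule.span Ghost {x}), j,
    ⟨h.1.of_injective j hj, h.2.1.of_injective j hj,
      isIteratedExtension_iff.2 (.base _ hB)⟩, fun h0 => hx ?_, fun z => z.1.2⟩
  exact Subtype.ext (LinearMap.congr_fun h0
    (⟨x, Submodule.mem_span_singleton_self x⟩ : Submodule.span Ghost {x}))

/-! ### Extensions by the modules `σ^k W_μ` -/

theorem isWeightModule_flow {M : ModuleCat.{0} Ghost} (l : ℤ) (h : IsWeightModule M) :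
    IsWeightModule (flow l M) where
  smooth := smooth_flow l h.smooth
  semisimple := by
    have hall : ∀ w : M, w ∈ ⨆ j : ℂ, Module.End.eigenspace (J0 h.smooth) j →
        (show flow l M from w) ∈
          ⨆ j : ℂ, Module.End.eigenspace (J0 (smooth_flow l h.smooth)) j := by
      intro w hw
      induction hw using Submodule.iSup_induction' with
      | mem j v hv =>
        rw [Module.End.mem_eigenspace_iff] at hv
        refine Submodule.mem_iSup_of_mem (j - l) ?_
        rw [Module.End.mem_eigenspace_iff]
        refine (J0_flow l h.smooth v).trans (Eq.trans ?_ (flow_complex_smul l M _ v).symm)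
        rw [hv, ← sub_smul]
      | zero => exact Submodule.zero_mem _
      | add v w _ _ h1 h2 => exact Submodule.add_mem _ h1 h2
    exact eq_top_iff.2 fun w _ => hall w (h.semisimple ▸ Submodule.mem_top)

theorem exists_section_flow_typical {μ : ℂ} (hμ : ∀ n : ℤ, μ ≠ n) (k : ℤ)
    {M : ModuleCat.{0} Ghost} (hM : IsFilteredNil M)
    {E : ModuleCat.{0} Ghost} (hE : IsWeightModule E) (i : M →ₗ[Ghost] E)
    (p : E →ₗ[Ghost] flow k (typical μ)) (hip : Function.Exact i p)
    (hp : Function.Surjective p) :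
    ∃ s : flow k (typical μ) →ₗ[Ghost] E, ∀ x, p (s x) = x := by
  refine exists_section_of_closure (fun M hM E hE i p hip hp => ?_) hM E hE i p hip hp
  obtain ⟨l, hl⟩ := hM
  -- Twisting by σ^{-k} reduces to W_μ itself and moves the pattern of M from l to l - k.
  obtain ⟨s, hs⟩ := exists_section_typical hμ (isWeightModule_flow (-k) hE)
    (i := flowMap (-k) i) (p := homOfFlow' k p) hip hp (l := l - k) fun y =>
      (nilAt_flow (M := M) (-k) (l - k) y).2 (by rw [sub_neg_eq_add, sub_add_cancel]; exact hl y)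
  exact ⟨homOfFlow k s, hs⟩

theorem exists_retraction_flow_typical {μ : ℂ} (hμ : ∀ n : ℤ, μ ≠ n) (k : ℤ)
    {M : ModuleCat.{0} Ghost} (hM : IsFilteredNil M)
    {E : ModuleCat.{0} Ghost} (hE : IsWeightModule E) (i : flow k (typical μ) →ₗ[Ghost] E)
    (p : E →ₗ[Ghost] M) (hi : Function.Injective i) (hip : Function.Exact i p) :
    ∃ r : E →ₗ[Ghost] flow k (typical μ), ∀ x, r (i x) = x := by
  refine exists_retraction_of_closure (fun M hM E hE i p hi hip => ?_) hM E hE i p hi hip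
  obtain ⟨l, hl⟩ := hM
  obtain ⟨r, hr⟩ := exists_retraction_typical hμ (isWeightModule_flow (-k) hE)
    (i := homToFlow k i) (p := flowMap (-k) p) hi hip (l := l - k) fun y =>
      (nilAt_flow (M := M) (-k) (l - k) y).2 (by rw [sub_neg_eq_add, sub_add_cancel]; exact hl y)
  exact ⟨homToFlow' k r, hr⟩

/-- The fibre product over X is an extension of σ^k W_μ by the kernel of e; a section of it,
projected to E, is the lift. -/
theorem exists_lift_flow_typical {μ : ℂ} (hμ : ∀ n : ℤ, μ ≠ n) (k : ℤ)
    (hW : IsWeightModule (flow k (typical μ)))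
    {E X : ModuleCat.{0} Ghost} (hE : IsWeightModule E)
    (hF : IsFilteredNil E) (e : E →ₗ[Ghost] X) (he : Function.Surjective e)
    (f : flow k (typical μ) →ₗ[Ghost] X) :
    ∃ s : flow k (typical μ) →ₗ[Ghost] E, ∀ x, e (s x) = f x := by
  let E' : Submodule Ghost (E × flow k (typical μ)) :=
    LinearMap.eqLocus (e ∘ₗ LinearMap.fst Ghost _ _) (f ∘ₗ LinearMap.snd Ghost _ _)
  let K := LinearMap.ker e
  have hK : IsFilteredNil (ModuleCat.of Ghost K) :=
    hF.of_injective IsLocallyNil.of_injective (K := ModuleCat.of Ghost K) K.subtype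
      Subtype.val_injective
  obtain ⟨s, hs⟩ := exists_section_flow_typical hμ k hK
    (E := ModuleCat.of Ghost E') ((hE.prod hW).submodule E')
    ((LinearMap.inl Ghost E (flow k (typical μ)) ∘ₗ K.subtype).codRestrict E' fun y => by
      change e y.1 = f 0
      rw [map_zero]
      exact y.2)
    (LinearMap.snd Ghost E (flow k (typical μ)) ∘ₗ E'.subtype)
    (fun v => by
      obtain ⟨⟨a, w⟩, h⟩ := v
      have h' : e a = f w := h
      constructor
      · intro h0
        have h1 : w = 0 := h0
        subst h1
        exact ⟨⟨a, h'.trans (map_zero f)⟩, rfl⟩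
      · rintro ⟨y, hy⟩
        exact (congrArg (fun v : E' => v.1.2) hy).symm)
    (fun w => by
      obtain ⟨a, ha⟩ := he (f w)
      exact ⟨⟨(a, w), ha⟩, rfl⟩)
  let s' : flow k (typical μ) →ₗ[Ghost] E' := s
  refine ⟨LinearMap.fst Ghost E (flow k (typical μ)) ∘ₗ E'.subtype ∘ₗ s', fun x => ?_⟩
  have h : e (s' x).1.1 = f (s' x).1.2 := (s' x).2
  exact h.trans (congrArg f (hs x))

/-- The pushout along f and m is an extension of the cokernel of m by σ^k W_μ; its retraction,
restricted to Y, extends f. -/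
theorem exists_extension_flow_typical {μ : ℂ} (hμ : ∀ n : ℤ, μ ≠ n) (k : ℤ)
    (hW : IsWeightModule (flow k (typical μ)))
    {X Y : ModuleCat.{0} Ghost} (hY : IsWeightModule Y) (hF : IsFilteredNil Y) (m : X →ₗ[Ghost] Y)
    (hm : Function.Injective m) (f : X →ₗ[Ghost] flow k (typical μ)) :
    ∃ r : Y →ₗ[Ghost] flow k (typical μ), ∀ x, r (m x) = f x := by
  let R := LinearMap.range (f.prod (-m))
  let S := LinearMap.range m
  have hN : IsFilteredNil (ModuleCat.of Ghost (Y ⧸ S)) :=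
    hF.of_surjective IsLocallyNil.of_surjective (K := ModuleCat.of Ghost (Y ⧸ S)) S.mkQ
      (Submodule.mkQ_surjective S)
  obtain ⟨r, hr⟩ := exists_retraction_flow_typical hμ k hN
    (E := ModuleCat.of Ghost ((flow k (typical μ) × Y) ⧸ R)) ((hW.prod hY).quotient R)
    (R.mkQ ∘ₗ LinearMap.inl Ghost (flow k (typical μ)) Y)
    (R.liftQ (S.mkQ ∘ₗ LinearMap.snd Ghost (flow k (typical μ)) Y) (by
      rintro _ ⟨x, rfl⟩
      exact (Submodule.Quotient.mk_eq_zero S).2 ⟨-x, map_neg m x⟩))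
    (by
      rw [← LinearMap.ker_eq_bot, eq_bot_iff]
      intro w hw
      obtain ⟨x, hx⟩ := (Submodule.Quotient.mk_eq_zero R).1 hw
      have h1 : f x = w := congrArg Prod.fst hx
      have h2 : -m x = 0 := congrArg Prod.snd hx
      have h3 : x = 0 := hm ((neg_eq_zero.1 h2).trans (map_zero m).symm)
      rw [← h1, h3, map_zero]
      exact Submodule.zero_mem _)
    (fun v => by
      obtain ⟨⟨w, y⟩, rfl⟩ := Submodule.mkQ_surjective R v
      constructor
      · intro h
        obtain ⟨x, rfl⟩ := (Submodule.Quotient.mk_eq_zero S).1 h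
        refine ⟨w + f x, (Submodule.Quotient.eq R).2 ⟨x, Prod.ext ?_ ?_⟩⟩
        · change f x = w + f x - w
          abel
        · change -m x = 0 - m x
          abel
      · rintro ⟨w', hw'⟩
        rw [← hw']
        exact map_zero S.mkQ)
  let r' : (flow k (typical μ) × Y) ⧸ R →ₗ[Ghost] flow k (typical μ) := r
  refine ⟨r' ∘ₗ R.mkQ ∘ₗ LinearMap.inr Ghost (flow k (typical μ)) Y, fun x => ?_⟩
  refine Eq.trans (congrArg r' ?_) (hr (f x))
  refine (Submodule.Quotient.eq R).2 ⟨-x, Prod.ext ?_ ?_⟩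
  · change f (-x) = 0 - f x
    rw [map_neg, zero_sub]
  · change -m (-x) = m x - 0
    rw [map_neg, neg_neg, sub_zero]

/-! ### Vanishing of extensions, projectivity and injectivity -/

theorem Ext1.mk_eq_zero_of_section {X Y : CatF} (e : Extn X Y) (s : X.obj →ₗ[Ghost] e.E.obj)
    (hs : ∀ x, e.p (s x) = x) : Ext1.mk e = 0 := by
  refine Ext1.cls_injective (Eq.trans ?_ Ext1.cls_zero.symm)
  have : Extn.IsCocycle e (toC s) 0 := ⟨hs, fun a x => by
    change e.i 0 = a • s x - s (a • x)
    rw [map_zero, map_smul, sub_self]⟩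
  exact this.cls_eq

theorem Ext1.mk_eq_zero_of_retraction {X Y : CatF} (e : Extn X Y) (r : e.E.obj →ₗ[Ghost] Y.obj)
    (hr : ∀ y, r (e.i y) = y) : Ext1.mk e = 0 := by
  obtain ⟨s, hs⟩ := exists_section_of_isCompl e.exact e.surjective (C := LinearMap.ker r) <| by
    refine isCompl_iff.2 ⟨?_, ?_⟩
    · rw [Submodule.disjoint_def]
      rintro _ ⟨y, rfl⟩ h
      have h' : r (e.i y) = 0 := h
      rw [hr] at h'
      rw [h', map_zero]
    · rw [codisjoint_iff, eq_top_iff]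
      intro v _
      rw [← add_sub_cancel (e.i (r v)) v]
      refine Submodule.add_mem_sup ⟨_, rfl⟩ ?_
      rw [LinearMap.mem_ker, map_sub, hr, sub_self]
  exact mk_eq_zero_of_section e s hs

theorem rank_ext_typical (μ : ℝ) (hμ : ∀ n : ℤ, μ ≠ n) (k : ℤ) (M : CatF) :
    Module.rank ℂ (Ext1 (typicalF μ hμ k) M) = 0 := by
  have : Subsingleton (Ext1 (typicalF μ hμ k) M) := by
    refine subsingleton_of_forall_eq 0 fun x => ?_
    obtain ⟨e⟩ := x
    obtain ⟨s, hs⟩ := exists_section_flow_typical (μ := μ) (fun n h => hμ n (by exact_mod_cast h)) k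
      M.property.isFilteredNil e.E.property.1 e.i e.p e.exact e.surjective
    exact Ext1.mk_eq_zero_of_section e s hs
  exact rank_subsingleton' ℂ _

theorem rank_ext_typical' (μ : ℝ) (hμ : ∀ n : ℤ, μ ≠ n) (k : ℤ) (M : CatF) :
    Module.rank ℂ (Ext1 M (typicalF μ hμ k)) = 0 := by
  have : Subsingleton (Ext1 M (typicalF μ hμ k)) := by
    refine subsingleton_of_forall_eq 0 fun x => ?_
    obtain ⟨e⟩ := x
    obtain ⟨r, hr⟩ := exists_retraction_flow_typical (μ := μ)
      (fun n h => hμ n (by exact_mod_cast h)) k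
      M.property.isFilteredNil e.E.property.1 e.i e.p e.injective e.exact
    exact Ext1.mk_eq_zero_of_retraction e r hr
  exact rank_subsingleton' ℂ _

/-- The morphism of `F` given by a homomorphism of modules. -/
def homOfLinear {X Y : CatF} (f : X.obj →ₗ[Ghost] Y.obj) : X ⟶ Y :=
  ObjectProperty.homMk (ModuleCat.ofHom f)

/-- F is closed under quotients, so the projection onto the cokernel and the zero map can be
compared inside F. -/
theorem surjective_of_epi {E X : CatF} (e : E ⟶ X) [Epi e] : Function.Surjective e.hom.hom := by
  let R := LinearMap.range e.hom.hom
  have hQ : IsF (ModuleCat.of Ghost (X.obj ⧸ R)) :=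
    X.property.of_surjective (N := ModuleCat.of Ghost (X.obj ⧸ R)) R.mkQ (Submodule.mkQ_surjective R)
  let Q : CatF := ⟨_, hQ⟩
  let f : X ⟶ Q := ObjectProperty.homMk (ModuleCat.ofHom (Y := X.obj ⧸ R) R.mkQ)
  let g : X ⟶ Q := ObjectProperty.homMk (ModuleCat.ofHom (Y := X.obj ⧸ R) 0)
  have h : e ≫ f = e ≫ g := by
    refine ObjectProperty.hom_ext _ (ModuleCat.hom_ext (LinearMap.ext fun x => ?_))
    exact (Submodule.Quotient.mk_eq_zero R).2 ⟨x, rfl⟩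
  have hfg : f = g := (cancel_epi e).1 h
  intro x
  have h2 : R.mkQ x = 0 := congrArg (fun φ : X ⟶ Q => φ.hom.hom x) hfg
  exact (Submodule.Quotient.mk_eq_zero R).1 h2

/-- The kernel need not be known to lie in F; a non-zero object of F mapping into it is enough as a
test object. -/
theorem injective_of_mono {X Y : CatF} (m : X ⟶ Y) [Mono m] : Function.Injective m.hom.hom := by
  rw [← LinearMap.ker_eq_bot]
  by_contra hK
  obtain ⟨Z, j, hZ, hj0, hj⟩ := X.property.exists_submodule _ hK
  let Z' : CatF := ⟨Z, hZ⟩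
  let f : Z' ⟶ X := ObjectProperty.homMk (ModuleCat.ofHom j)
  let g : Z' ⟶ X := ObjectProperty.homMk (ModuleCat.ofHom 0)
  have h : f ≫ m = g ≫ m := by
    refine ObjectProperty.hom_ext _ (ModuleCat.hom_ext (LinearMap.ext fun x => ?_))
    exact (hj x).trans (map_zero m.hom.hom).symm
  have hfg : f = g := (cancel_mono m).1 h
  exact hj0 (congrArg (fun φ : Z' ⟶ X => φ.hom.hom) hfg)

theorem projective_typicalF (μ : ℝ) (hμ : ∀ n : ℤ, μ ≠ n) (k : ℤ) :
    Projective (typicalF μ hμ k) where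
  factors {E X} f e _ := by
    obtain ⟨s, hs⟩ := exists_lift_flow_typical (μ := μ) (fun n h => hμ n (by exact_mod_cast h)) k
      (E := E.obj) (X := X.obj) (isF_typical μ hμ k).1 E.property.1 E.property.isFilteredNil e.hom.hom
      (surjective_of_epi e) f.hom.hom
    refine ⟨homOfLinear (X := typicalF μ hμ k) s, ?_⟩
    exact ObjectProperty.hom_ext _ (ModuleCat.hom_ext (LinearMap.ext hs))

theorem injective_typicalF (μ : ℝ) (hμ : ∀ n : ℤ, μ ≠ n) (k : ℤ) :
    Injective (typicalF μ hμ k) where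
  factors {X Y} f m _ := by
    obtain ⟨r, hr⟩ := exists_extension_flow_typical (μ := μ)
      (fun n h => hμ n (by exact_mod_cast h)) k
      (X := X.obj) (Y := Y.obj) (isF_typical μ hμ k).1 Y.property.1 Y.property.isFilteredNil m.hom.hom
      (injective_of_mono m) f.hom.hom
    refine ⟨homOfLinear (Y := typicalF μ hμ k) r, ?_⟩
    exact ObjectProperty.hom_ext _ (ModuleCat.hom_ext (LinearMap.ext hr))

/-! ### The spectral flows of the vacuum module -/

section Vac

/-- The annihilation conditions for the generating vector of `σ^k V`. -/
def IsVac {M : Type} [AddCommGroup M] [Module Ghost M] (k : ℤ) (v : M) : Prop :=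
  (∀ n, -k ≤ n → beta n • v = 0) ∧ ∀ n, k + 1 ≤ n → gamma n • v = 0

theorem isVac_flow {M : ModuleCat.{0} Ghost} (m k : ℤ) (v : M) :
    IsVac k (show flow m M from v) ↔ IsVac (k - m) (v : M) := by
  constructor
  · rintro ⟨h1, h2⟩
    refine ⟨fun n hn => ?_, fun n hn => ?_⟩
    · have := (flow_beta m M (n - m) v).symm.trans (h1 (n - m) (by omega))
      rwa [sub_add_cancel] at this
    · have := (flow_gamma m M (n + m) v).symm.trans (h2 (n + m) (by omega))
      rwa [add_sub_cancel_right] at this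
  · rintro ⟨h1, h2⟩
    exact ⟨fun n hn => (flow_beta m M n v).trans (h1 _ (by omega)),
      fun n hn => (flow_gamma m M n v).trans (h2 _ (by omega))⟩

theorem isVac_zero_iff {M : Type} [AddCommGroup M] [Module Ghost M] (v : M) :
    IsVac 0 v ↔ beta 0 • v = 0 ∧ ∀ i, ann i • v = 0 := by
  rw [ann_eq_zero_iff]
  constructor
  · rintro ⟨h1, h2⟩
    exact ⟨h1 0 (by omega), fun n hn => ⟨h1 n (by omega), h2 n (by omega)⟩⟩
  · rintro ⟨h0, h⟩
    refine ⟨fun n hn => ?_, fun n hn => (h n (by omega)).2⟩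
    rcases eq_or_lt_of_le hn with h1 | h1
    · rw [← h1]; exact h0
    · exact (h n (by omega)).1

theorem flow_generator {M : ModuleCat.{0} Ghost} (k : ℤ) {v w : M} (h : ∃ a : Ghost, a • v = w) :
    ∃ a : Ghost, a • (show flow k M from v) = (show flow k M from w) := by
  obtain ⟨a, ha⟩ := h
  refine ⟨spectralFlow k a, Eq.trans ?_ ha⟩
  refine (flow_smul (M := M) k _ v).trans ?_
  rw [spectralFlow_neg_apply]

theorem vacuum_generator (v : vacuum) :
    ∃ a : Ghost, a • (show vacuum from (vec 1 1 : FockSpace (Polynomial ℂ))) = v := by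
  refine induced_generator _ _ _ (1 : Polynomial ℂ) (fun N h1 _ hq => ?_) v
  refine eq_top_iff.2 fun f _ => ?_
  induction f using Polynomial.induction_on' with
  | add f g hf hg => exact N.add_mem (hf Submodule.mem_top) (hg Submodule.mem_top)
  | monomial n a =>
    have : ∀ n : ℕ, (Polynomial.X ^ n : Polynomial ℂ) ∈ N := fun n => by
      induction n with
      | zero => simpa using h1
      | succ n ih => rw [pow_succ']; exact hq _ ih
    rw [← Polynomial.smul_X_eq_monomial]
    exact N.smul_mem a (this n)

theorem vacuum_isVac : IsVac 0 (show vacuum from (vec 1 1 : FockSpace (Polynomial ℂ))) := by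
  refine (isVac_zero_iff _).2 ⟨?_, fun i => induced_ann_vec _ _ _ i _⟩
  refine (induced_beta_zero_vec _ _ _ _).trans ?_
  rw [Polynomial.derivative_one, neg_zero]
  exact TensorProduct.tmul_zero _ _

/-- The positive modes confine y to ℂ[x], where β_0 acts as -d/dx, whose kernel consists of the
constants. -/
theorem vacuum_eq_of_isVac {y : vacuum} (h : IsVac 0 y) : ∃ c : ℂ,
    y = algebraMap ℂ Ghost c • (show vacuum from (vec 1 1 : FockSpace (Polynomial ℂ))) := by
  rw [isVac_zero_iff] at h
  obtain ⟨f, rfl⟩ := exists_vec_of_ann _ _ _ y h.2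
  have h0 : (vec 1 (0 : Polynomial ℂ) : FockSpace (Polynomial ℂ)) = 0 := TensorProduct.tmul_zero _ _
  have h1 : -Polynomial.derivative f = 0 := vec_one_injective
    ((induced_beta_zero_vec _ _ _ f).symm.trans (h.1.trans h0.symm))
  have h2 := Polynomial.derivative_eq_zero.1 (neg_eq_zero.1 h1)
  obtain ⟨c, rfl⟩ := Polynomial.natDegree_eq_zero.1 h2
  refine ⟨c, Eq.trans ?_ (induced_algebraMap_vec _ _ _ _ _).symm⟩
  rw [Polynomial.smul_eq_C_mul, mul_one]

/-- The submodule generated by y contains a vacuum vector z ≠ 0. As β_0 is locally nilpotent, the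
last non-zero β_0^r z satisfies all relations of the generating vector, hence is a multiple of it.
-/
theorem vacuum_simple {y : vacuum} (hy : y ≠ 0) :
    ∃ a : Ghost, a • y = (show vacuum from (vec 1 1 : FockSpace (Polynomial ℂ))) := by
  set w : vacuum := (vec 1 1 : FockSpace (Polynomial ℂ)) with hw
  have hw0 := (isVac_zero_iff _).1 vacuum_isVac
  have hs : Smooth vacuum := smooth_of_generator vacuum_generator ((ann_eq_zero_iff _).1 hw0.2)
  have hweight : IsWeightModule vacuum := by
    refine isWeightModule_of_iSup hs 0 (iSup_eigenspace_of_generator vacuum_generator hs _ ?_)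
    rw [J0_of_ann hs hw0.2, number, mul_smul, hw0.1, smul_zero, zero_smul]
  have hnil : ∀ v : vacuum, NilAt 0 v := fun v => by
    obtain ⟨a, rfl⟩ := vacuum_generator v
    exact (nilAt_of_ann hw0.2).ghost_smul a
  obtain ⟨z, hz, hz0, j, hj⟩ := exists_isVacuumVector_mem hweight hnil (Submodule.span Ghost {y})
    (by rwa [Ne, Submodule.span_singleton_eq_bot])
  have hb : IsNilpotentOn (beta 0) z := by
    obtain ⟨a, rfl⟩ := vacuum_generator z
    exact IsNilpotentOn.ghost_smul (hasScalarCommutators_beta 0) ⟨1, by rw [pow_one, hw0.1]⟩ a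
  obtain ⟨r, hr, hr0⟩ : ∃ r : ℕ, beta 0 ^ r • z ≠ 0 ∧ beta 0 ^ (r + 1) • z = 0 := by
    by_contra! hcon
    obtain ⟨r, hr⟩ := hb
    have : ∀ r : ℕ, beta 0 ^ r • z ≠ 0 := fun r => by
      induction r with
      | zero => simpa using hz0
      | succ r ih => exact hcon r ih
    exact this r hr
  have hvac : IsVac 0 (beta 0 ^ r • z) := by
    refine (isVac_zero_iff _).2 ⟨by rw [smul_smul, ← pow_succ', hr0], fun i => ?_⟩
    have hc : Commute (ann i) (beta 0) := ann_mul_beta_zero i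
    rw [smul_smul, (hc.pow_right r).eq, mul_smul, hj.1, smul_zero]
  obtain ⟨c, hc⟩ := vacuum_eq_of_isVac hvac
  have hc0 : c ≠ 0 := by
    rintro rfl
    rw [map_zero, zero_smul] at hc
    exact hr hc
  have hmem : w ∈ Submodule.span Ghost {y} :=
    mem_of_algebraMap_smul_mem hc0 (hc ▸ Submodule.smul_mem _ _ hz)
  exact Submodule.mem_span_singleton.1 hmem

/-- As [β_0, γ_0] = -1, the commutator with β_0 is minus the derivative in γ_0. So f ↦ f(γ_0) v is a
map of Weyl algebra modules from ℂ[x] whenever β_0 v = 0. -/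
theorem beta_zero_mul_aeval_gamma (f : Polynomial ℂ) :
    beta 0 * Polynomial.aeval (gamma 0) f =
      Polynomial.aeval (gamma 0) f * beta 0 - Polynomial.aeval (gamma 0) (.derivative f) := by
  have h0 : beta 0 * gamma 0 = gamma 0 * beta 0 - 1 := by
    rw [gamma_mul_beta, if_pos (by omega), add_sub_cancel_right]
  have hp : ∀ n : ℕ, beta 0 * gamma 0 ^ n =
      gamma 0 ^ n * beta 0 - algebraMap ℂ Ghost n * gamma 0 ^ (n - 1) := fun n => by
    induction n with
    | zero => simp
    | succ n ih =>
      rw [pow_succ, ← mul_assoc, ih, sub_mul, mul_assoc, h0, mul_sub, mul_one, mul_assoc,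
        mul_assoc, Nat.add_sub_cancel]
      rcases n with _ | n
      · simp
      · rw [Nat.add_sub_cancel, ← pow_succ]
        push_cast
        simp only [add_mul, one_mul]
        abel
  induction f using Polynomial.induction_on' with
  | add f g hf hg =>
    simp only [map_add, mul_add, add_mul, hf, hg]; abel
  | monomial n a =>
    simp only [Polynomial.aeval_monomial, Polynomial.derivative_monomial, map_mul]
    rw [← mul_assoc, ← Algebra.commutes, mul_assoc, hp, mul_sub, mul_assoc, mul_assoc]

theorem exists_hom_of_isVac_zero {E : Type} [AddCommGroup E] [Module Ghost E] [Module ℂ E]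
    [IsScalarTower ℂ Ghost E] {v : E} (h : IsVac 0 v) : ∃ φ : vacuum →ₗ[Ghost] E,
      φ (show vacuum from (vec 1 1 : FockSpace (Polynomial ℂ))) = v := by
  rw [isVac_zero_iff] at h
  let φ : Polynomial ℂ →ₗ[ℂ] E :=
    { toFun := fun f => Polynomial.aeval (gamma 0) f • v
      map_add' := fun f g => by rw [map_add, add_smul]
      map_smul' := fun c f => by rw [map_smul, smul_assoc, RingHom.id_apply] }
  have hφ : ∀ f, φ f = Polynomial.aeval (gamma 0) f • v := fun _ => rfl
  obtain ⟨ψ, hψ⟩ := exists_hom_of_induced (E := E) (Polynomial.derivative : Module.End ℂ _)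
    (LinearMap.mulLeft ℂ Polynomial.X) (by refine LinearMap.ext fun f => ?_; simp) φ
    (fun f => by
      rw [hφ, hφ, smul_smul, beta_zero_mul_aeval_gamma, sub_smul, mul_smul, h.1, smul_zero,
        zero_sub])
    (fun f => by
      rw [hφ, hφ, LinearMap.mulLeft_apply, map_mul, Polynomial.aeval_X, mul_smul])
    (fun i f => by
      have hc : Commute (ann i) (gamma 0) := ann_mul_gamma_zero i
      have hc' : ann i * Polynomial.aeval (gamma 0) f = Polynomial.aeval (gamma 0) f * ann i := by
        induction f using Polynomial.induction_on' with
        | add f g hf hg => rw [map_add, mul_add, hf, hg, add_mul]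
        | monomial n a =>
          rw [Polynomial.aeval_monomial, ← mul_assoc, ← Algebra.commutes, mul_assoc,
            (hc.pow_right n).eq, mul_assoc]
      rw [hφ, smul_smul, hc', mul_smul, h.2, smul_zero])
  exact ⟨ψ, (hψ 1).trans (by rw [hφ, map_one, one_smul])⟩

/-- The generating vector of `σ^k V`. -/
def vacVec (k : ℤ) : flow k vacuum := (vec 1 1 : FockSpace (Polynomial ℂ))

variable (k : ℤ)

theorem vacVec_isVac : IsVac k (vacVec k) :=
  (isVac_flow (M := vacuum) k k _).2 (by rw [sub_self]; exact vacuum_isVac)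

variable {k}

theorem flow_vacuum_generator (v : flow k vacuum) : ∃ a : Ghost, a • vacVec k = v :=
  flow_generator k (vacuum_generator v)

theorem flow_vacuum_simple {y : flow k vacuum} (hy : y ≠ 0) : ∃ a : Ghost, a • y = vacVec k :=
  flow_generator (M := vacuum) k (vacuum_simple hy)

theorem flow_vacuum_eq_of_isVac {y : flow k vacuum} (h : IsVac k y) :
    ∃ c : ℂ, y = algebraMap ℂ Ghost c • vacVec k := by
  have h0 := (isVac_flow (M := vacuum) k k y).1 h
  rw [sub_self] at h0
  obtain ⟨c, hc⟩ := vacuum_eq_of_isVac h0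
  refine ⟨c, hc.trans (Eq.symm ?_)⟩
  refine (flow_smul (M := vacuum) k _ _).trans ?_
  rw [AlgHom.commutes]
  rfl

theorem exists_hom_of_isVac {E : ModuleCat.{0} Ghost} {v : E} (h : IsVac k v) :
    ∃ φ : flow k vacuum →ₗ[Ghost] E, φ (vacVec k) = v := by
  obtain ⟨φ, hφ⟩ := exists_hom_of_isVac_zero (E := flow (-k) E) (v := v)
    ((isVac_flow (M := E) (-k) 0 v).2 (by rwa [zero_sub, neg_neg]))
  exact ⟨homOfFlow k φ, hφ⟩

theorem flow_vacuum_injective {E : Type} [AddCommGroup E] [Module Ghost E]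
    (φ : flow k vacuum →ₗ[Ghost] E) (h : φ (vacVec k) ≠ 0) : Function.Injective φ := by
  rw [← LinearMap.ker_eq_bot, eq_bot_iff]
  intro y hy
  by_contra h0
  obtain ⟨a, ha⟩ := flow_vacuum_simple (y := y) h0
  exact h (by rw [← ha, map_smul, LinearMap.mem_ker.1 hy, smul_zero])

/-- The eigenvalues of the number operators on the generating vector of `σ^k V`. -/
def vacWeight (k n : ℤ) : ℂ := if -k ≤ n then 0 else 1

/-- For each n either β_n or γ_{-n} kills v; in the second case β_n γ_{-n} = `number n - 1` gives
the eigenvalue 1. -/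
theorem IsVac.number_smul {M : Type} [AddCommGroup M] [Module Ghost M] {v : M} (h : IsVac k v)
    (n : ℤ) : number n • v = algebraMap ℂ Ghost (vacWeight k n) • v := by
  rw [vacWeight]
  split_ifs with hn
  · rw [number, mul_smul, h.1 n hn, smul_zero, map_zero, zero_smul]
  · have := beta_mul_gamma_neg n
    rw [eq_sub_iff_add_eq] at this
    rw [← this, add_smul, mul_smul, h.2 (-n) (by omega), smul_zero, zero_add, map_one]

theorem flow_vacuum_beta_nilpotent (v : flow k vacuum) {n : ℤ} (hn : -k ≤ n) :
    IsNilpotentOn (beta n) v := by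
  obtain ⟨a, rfl⟩ := flow_vacuum_generator v
  exact IsNilpotentOn.ghost_smul (hasScalarCommutators_beta n)
    ⟨1, by rw [pow_one, (vacVec_isVac k).1 n hn]⟩ a

theorem flow_vacuum_gamma_nilpotent (v : flow k vacuum) {n : ℤ} (hn : k + 1 ≤ n) :
    IsNilpotentOn (gamma n) v := by
  obtain ⟨a, rfl⟩ := flow_vacuum_generator v
  exact IsNilpotentOn.ghost_smul (hasScalarCommutators_gamma n)
    ⟨1, by rw [pow_one, (vacVec_isVac k).2 n hn]⟩ a

theorem flow_vacuum_locallyFinite (n : ℤ) (v : flow k vacuum) :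
    LocallyFinite (Set.range ((↑) : ℤ → ℂ)) (number n) v := by
  by_cases hn : -k ≤ n
  · exact locallyFinite_of_beta (flow_vacuum_beta_nilpotent v hn)
  · exact locallyFinite_of_gamma (flow_vacuum_gamma_nilpotent v (by omega))

theorem eq_zero_of_vacWeight_one {n : ℤ} {y : flow k vacuum} (hn : -k ≤ n)
    (h : IsGenEigen 1 (number n) y) : y = 0 := by
  refine eq_zero_of_beta (flow_vacuum_beta_nilpotent y hn) (fun m hm => ?_) h
  have : ((1 + m : ℕ) : ℂ) = 0 := by push_cast; rw [hm]; ring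
  have := Nat.cast_eq_zero.1 this
  omega

theorem eq_zero_of_vacWeight_zero {n : ℤ} {y : flow k vacuum} (hn : n < -k)
    (h : IsGenEigen 0 (number n) y) : y = 0 := by
  refine eq_zero_of_gamma (flow_vacuum_gamma_nilpotent y (by omega)) (fun m hm => ?_) h
  exact Nat.cast_add_one_ne_zero m hm.symm

theorem isGenEigen_beta {M : Type} [AddCommGroup M] [Module Ghost M] {c : ℂ} {m : ℤ} {v : M}
    (h : IsGenEigen c (number m) v) (n : ℤ) :
    IsGenEigen (c + if m = n then 1 else 0) (number m) (beta n • v) :=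
  h.smul_of_shift (number_mul_beta m n)

theorem isGenEigen_gamma {M : Type} [AddCommGroup M] [Module Ghost M] {c : ℂ} {m : ℤ} {v : M}
    (h : IsGenEigen c (number m) v) (n : ℤ) :
    IsGenEigen (c + if m = -n then -1 else 0) (number m) (gamma n • v) :=
  h.smul_of_shift (number_mul_gamma m n)

/-- The modes in question would move the eigenvalue of one number operator from 0 to 1 or from 1 to
0, to a value which does not occur on σ^k V. -/
theorem isVac_of_isGenEigen {y : flow k vacuum}
    (h : ∀ n, IsGenEigen (vacWeight k n) (number n) y) : IsVac k y := by
  refine ⟨fun n hn => ?_, fun n hn => ?_⟩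
  · refine eq_zero_of_vacWeight_one hn ?_
    have := isGenEigen_beta (h n) n
    rwa [if_pos rfl, vacWeight, if_pos hn, zero_add] at this
  · refine eq_zero_of_vacWeight_zero (n := -n) (by omega) ?_
    have := isGenEigen_gamma (h (-n)) n
    rwa [if_pos rfl, vacWeight, if_neg (by omega), add_neg_cancel] at this

end Vac

/-! ### Lifting joint generalized eigenvectors -/

section LiftEigen

open Polynomial

variable {E X : Type} [AddCommGroup E] [Module Ghost E] [AddCommGroup X] [Module Ghost X]

/-- Removing all factors X - c from the annihilating polynomial leaves g with g(c) ≠ 0. Then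
g(b)/g(c) maps v to a generalized eigenvector and does not change p v, on which it acts as 1. -/
theorem exists_isGenEigen {T : Set ℂ} {b : Ghost} {v : E} (hv : LocallyFinite T b v) (c : ℂ)
    (p : E →ₗ[Ghost] X) (hp : b • p v = algebraMap ℂ Ghost c • p v) :
    ∃ g : ℂ[X], p (aeval b g • v) = p v ∧ IsGenEigen c b (aeval b g • v) := by
  obtain ⟨f, hf, -, hfv⟩ := hv
  obtain ⟨g, hfg, hg⟩ := exists_eq_pow_rootMultiplicity_mul_and_not_dvd f hf c
  have hgc : g.eval c ≠ 0 := fun h => hg (dvd_iff_isRoot.2 h)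
  refine ⟨C (g.eval c)⁻¹ * g, ?_, f.rootMultiplicity c, ?_⟩
  · rw [map_smul, aeval_smul_of_eigen hp, eval_mul, eval_C, inv_mul_cancel₀ hgc, map_one, one_smul]
  · have h1 : (b - algebraMap ℂ Ghost c) ^ f.rootMultiplicity c =
        aeval b ((Polynomial.X - C c) ^ f.rootMultiplicity c) := by simp
    rw [h1, smul_smul, ← map_mul, mul_left_comm, ← hfg, map_mul, mul_smul, hfv, smul_zero]

theorem isGenEigen_aeval {b b' : Ghost} (hb : Commute b b') {c : ℂ} {v : E}
    (h : IsGenEigen c b v) (g : ℂ[X]) : IsGenEigen c b (aeval b' g • v) := by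
  have h1 : b * aeval b' g = aeval b' g * (b + algebraMap ℂ Ghost 0) := by
    rw [map_zero, add_zero]
    induction g using Polynomial.induction_on' with
    | add f g hf hg => rw [map_add, mul_add, hf, hg, add_mul]
    | monomial n a =>
      rw [aeval_monomial, ← mul_assoc, ← Algebra.commutes, mul_assoc, (hb.pow_right n).eq,
        mul_assoc]
  simpa using h.smul_of_shift h1

/-- Smoothness makes any lift an honest eigenvector of `number n` for almost all n. The finitely
many others are corrected one at a time by polynomials in them, which preserve what was achieved
because number operators commute. -/
theorem exists_joint_isGenEigen (hE : Smooth E) {T : Set ℂ}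
    (hT : ∀ (n : ℤ) (v : E), LocallyFinite T (number n) v) (p : E →ₗ[Ghost] X) {k : ℤ} {w : X}
    (hw : IsVac k w) (hp : ∃ v, p v = w) :
    ∃ v, p v = w ∧ ∀ n, IsGenEigen (vacWeight k n) (number n) v := by
  obtain ⟨v0, hv0⟩ := hp
  obtain ⟨K, hK⟩ := hE v0
  -- For |n| ≥ L, either n ≥ -k and β_n kills v0, or n < -k and γ_{-n} does.
  let L : ℕ := K.natAbs + k.natAbs + 1
  have key : ∀ s : Finset ℤ, ∃ v, p v = w ∧ ∀ n : ℤ, (n ∈ s ∨ L ≤ n.natAbs) →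
      IsGenEigen (vacWeight k n) (number n) v := by
    intro s
    induction s using Finset.induction_on with
    | empty =>
      refine ⟨v0, hv0, fun n hn => IsGenEigen.of_eigen ?_⟩
      have hn : L ≤ n.natAbs := hn.resolve_left (Finset.notMem_empty n)
      rw [vacWeight]
      split_ifs with h
      · rw [number, mul_smul, (hK n (by omega)).1, smul_zero, map_zero, zero_smul]
      · have := beta_mul_gamma_neg n
        rw [eq_sub_iff_add_eq] at this
        rw [← this, add_smul, mul_smul, (hK (-n) (by omega)).2, smul_zero, zero_add, map_one]
    | insert m s _ ih =>
      obtain ⟨v, hv, h⟩ := ih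
      obtain ⟨g, hg1, hg2⟩ := exists_isGenEigen (hT m v) (vacWeight k m) p (by
        rw [hv]; exact hw.number_smul m)
      refine ⟨aeval (number m) g • v, hg1.trans hv, fun n hn => ?_⟩
      by_cases hnm : n = m
      · rw [hnm]; exact hg2
      · refine isGenEigen_aeval (number_commute n m) (h n ?_) g
        simpa [hnm] using hn
  obtain ⟨v, hv, h⟩ := key (Finset.Icc (-L) L)
  refine ⟨v, hv, fun n => h n ?_⟩
  rw [Finset.mem_Icc]
  omega

end LiftEigen

/-! ### Extensions of the spectral flows of the vacuum module -/

section VacExt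

variable {k l : ℤ}

/-- A mode that kills the generating vector of σ^k V sends the lift into the image of σ^l V, and
shifts exactly one of its weights; injectivity of `e.i` transfers these weights to the preimage y.
-/
theorem exists_good_lift (e : Extn (vacuumF k) (vacuumF l)) : ∃ v : e.E.obj, e.p v = vacVec k ∧
    (∀ n, -k ≤ n → ∃ y : flow l vacuum, beta n • v = e.i y ∧
      ∀ m, IsGenEigen (vacWeight k m + if m = n then 1 else 0) (number m) y) ∧
    ∀ n, k + 1 ≤ n → ∃ y : flow l vacuum, gamma n • v = e.i y ∧
      ∀ m, IsGenEigen (vacWeight k m + if m = -n then -1 else 0) (number m) y := by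
  obtain ⟨v, hv, hgen⟩ := exists_joint_isGenEigen e.E.property.1.smooth
    (fun n v => LocallyFinite.of_exact (T := Set.range ((↑) : ℤ → ℂ)) e.exact
      (flow_vacuum_locallyFinite (k := l) n) (flow_vacuum_locallyFinite (k := k) n (e.p v)))
    e.p (vacVec_isVac k) (e.surjective (vacVec k))
  refine ⟨v, hv, fun n hn => ?_, fun n hn => ?_⟩
  · obtain ⟨y, hy⟩ := (e.exact (beta n • v)).1 (by
      rw [map_smul, hv]; exact (vacVec_isVac k).1 n hn)
    refine ⟨y, hy.symm, fun m => .of_map e.injective ?_⟩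
    rw [hy]
    exact isGenEigen_beta (hgen m) n
  · obtain ⟨y, hy⟩ := (e.exact (gamma n • v)).1 (by
      rw [map_smul, hv]; exact (vacVec_isVac k).2 n hn)
    refine ⟨y, hy.symm, fun m => .of_map e.injective ?_⟩
    rw [hy]
    exact isGenEigen_gamma (hgen m) n

/-- If n ≥ -l, then y has weight 1 for `number n`, whose eigenvalues on σ^l V are at most 0. If n <
-l, some other index m with -k ≤ m < -l has weight 0, although the eigenvalues there are at least 1:
m = -k works unless n = -k, and then m = -k + 1 does, because l ≤ k - 2. -/
theorem beta_weight_eq_zero {n : ℤ} (hn : -k ≤ n) (hne : ¬(l = k - 1 ∧ n = -k))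
    {y : flow l vacuum}
    (h : ∀ m, IsGenEigen (vacWeight k m + if m = n then 1 else 0) (number m) y) : y = 0 := by
  have h0 : ∀ m, -k ≤ m → m ≠ n → IsGenEigen 0 (number m) y := fun m hm hmn => by
    have := h m
    rwa [vacWeight, if_pos hm, if_neg hmn, add_zero] at this
  by_cases hnl : -l ≤ n
  · refine eq_zero_of_vacWeight_one hnl ?_
    have := h n
    rwa [vacWeight, if_pos hn, if_pos rfl, zero_add] at this
  · by_cases hnk : n = -k
    · exact eq_zero_of_vacWeight_zero (n := -k + 1) (by omega) (h0 _ (by omega) (by omega))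
    · exact eq_zero_of_vacWeight_zero (n := -k) (by omega) (h0 _ (by omega) (by omega))

/-- Mirror image of `beta_weight_eq_zero`: the contradiction comes from weight 0 at -n < -l, or from
weight 1 at an index m ≥ -l, namely -k - 1, or -k - 2 when n = k + 1. -/
theorem gamma_weight_eq_zero {n : ℤ} (hn : k + 1 ≤ n) (hne : ¬(l = k + 1 ∧ n = k + 1))
    {y : flow l vacuum}
    (h : ∀ m, IsGenEigen (vacWeight k m + if m = -n then -1 else 0) (number m) y) : y = 0 := by
  have h0 : ∀ m, m < -k → m ≠ -n → IsGenEigen 1 (number m) y := fun m hm hmn => by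
    have := h m
    rwa [vacWeight, if_neg (by omega), if_neg hmn, add_zero] at this
  by_cases hnl : -n < -l
  · refine eq_zero_of_vacWeight_zero hnl ?_
    have := h (-n)
    rwa [vacWeight, if_neg (by omega), if_pos rfl, add_neg_cancel] at this
  · by_cases hnk : n = k + 1
    · exact eq_zero_of_vacWeight_one (n := -k - 2) (by omega) (h0 _ (by omega) (by omega))
    · exact eq_zero_of_vacWeight_one (n := -k - 1) (by omega) (h0 _ (by omega) (by omega))

theorem Ext1.mk_eq_zero_of_isVac (e : Extn (vacuumF k) (vacuumF l)) {v : e.E.obj}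
    (hv : e.p v = vacVec k) (h : IsVac k v) : Ext1.mk e = 0 := by
  obtain ⟨s, hs⟩ := exists_hom_of_isVac h
  refine Ext1.mk_eq_zero_of_section e s fun x => ?_
  obtain ⟨a, rfl⟩ := flow_vacuum_generator (k := k) x
  refine (congrArg e.p (map_smul s a (vacVec k))).trans ?_
  rw [hs, map_smul, hv]
  rfl

theorem rank_ext_vacuum_eq_zero (h : |k - l| ≠ 1) :
    Module.rank ℂ (Ext1 (vacuumF k) (vacuumF l)) = 0 := by
  have h1 : l ≠ k - 1 := by rintro rfl; exact h (by simp)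
  have h2 : l ≠ k + 1 := by rintro rfl; exact h (by simp)
  have : Subsingleton (Ext1 (vacuumF k) (vacuumF l)) := by
    refine subsingleton_of_forall_eq 0 fun x => ?_
    obtain ⟨e⟩ := x
    obtain ⟨v, hv, hb, hc⟩ := exists_good_lift e
    refine Ext1.mk_eq_zero_of_isVac e hv ⟨fun n hn => ?_, fun n hn => ?_⟩
    · obtain ⟨y, hy, hgen⟩ := hb n hn
      rw [hy, beta_weight_eq_zero hn (fun h => h1 h.1) hgen]
      exact map_zero e.i
    · obtain ⟨y, hy, hgen⟩ := hc n hn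
      rw [hy, gamma_weight_eq_zero hn (fun h => h2 h.1) hgen]
      exact map_zero e.i
  exact rank_subsingleton' ℂ _

/-- The extension `e` is described by the scalar `c`: the generating vector of `σ^k V` has a lift
which is annihilated by its annihilating modes except for the mode `a`, which maps it to the
multiple by `c` of the generating vector of `σ^l V`. -/
def HasInvariant (a : Ghost) (e : Extn (vacuumF k) (vacuumF l)) (c : ℂ) : Prop :=
  ∃ v : e.E.obj, e.p v = vacVec k ∧ (∀ n, -k ≤ n → beta n ≠ a → beta n • v = 0) ∧
    (∀ n, k + 1 ≤ n → gamma n ≠ a → gamma n • v = 0) ∧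
    a • v = e.i (algebraMap ℂ Ghost c • vacVec l)

theorem HasInvariant.mk_eq_zero {a : Ghost} {e : Extn (vacuumF k) (vacuumF l)}
    (h : HasInvariant a e 0) : Ext1.mk e = 0 := by
  obtain ⟨v, hv, hb, hc, ha⟩ := h
  have ha' : a • v = 0 := by
    refine ha.trans ?_
    rw [map_zero, zero_smul]
    exact map_zero e.i
  refine Ext1.mk_eq_zero_of_isVac e hv ⟨fun n hn => ?_, fun n hn => ?_⟩
  · by_cases h : beta n = a
    · rw [h, ha']
    · exact hb n hn h
  · by_cases h : gamma n = a
    · rw [h, ha']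
    · exact hc n hn h

theorem HasInvariant.baerSum {a : Ghost} {e e' : Extn (vacuumF k) (vacuumF l)} {c c' : ℂ}
    (h : HasInvariant a e c) (h' : HasInvariant a e' c') :
    HasInvariant a (e.baerSum e') (c + c') := by
  obtain ⟨v, hv, hb, hc, ha⟩ := h
  obtain ⟨v', hv', hb', hc', ha'⟩ := h'
  let w : (vacuumF l).obj := vacVec l
  let q : e.fibre e' →ₗ[Ghost] (e.baerSum e').E.obj :=
    (LinearMap.range (e.antidiagonal e')).mkQ
  let u : e.fibre e' := ⟨(v, v'), hv.trans hv'.symm⟩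
  have hz : ∀ x : Ghost, x • v = 0 → x • v' = 0 → x • q u = 0 := fun x h1 h2 => by
    have : x • u = 0 := Subtype.ext (Prod.ext h1 h2)
    rw [← map_smul, this, map_zero]
  refine ⟨q u, hv, fun n hn hne => hz _ (hb n hn hne) (hb' n hn hne),
    fun n hn hne => hz _ (hc n hn hne) (hc' n hn hne), ?_⟩
  rw [← map_smul]
  -- With w the generating vector of σ^l V, the pair (c w, c' w) differs from ((c + c') w, 0) by
  -- (-c' w, c' w), the antidiagonal image of -c' w.
  refine (Submodule.Quotient.eq _).2 ⟨-(algebraMap ℂ Ghost c' • w), ?_⟩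
  refine Subtype.ext (Prod.ext ?_ ?_)
  · refine Eq.trans ?_ (congrArg (· - e.i (algebraMap ℂ Ghost (c + c') • w)) ha).symm
    refine Eq.trans (congrArg e.i ?_) (map_sub e.i _ _)
    change -(algebraMap ℂ Ghost c' • w) =
      algebraMap ℂ Ghost c • w - algebraMap ℂ Ghost (c + c') • w
    rw [map_add, add_smul, sub_add_cancel_left]
  · refine Eq.trans ?_ (congrArg (· - (0 : e'.E.obj)) ha').symm
    refine (congrArg Neg.neg (map_neg e'.i _)).trans ?_
    rw [neg_neg]
    exact (sub_zero _).symm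

theorem HasInvariant.scale {a : Ghost} {e : Extn (vacuumF k) (vacuumF l)} {c : ℂ}
    (h : HasInvariant a e c) (t : ℂ) : HasInvariant a (e.scale t) (t * c) := by
  obtain ⟨v, hv, hb, hc, ha⟩ := h
  let q : e.E.obj × (vacuumF l).obj →ₗ[Ghost] (e.scale t).E.obj :=
    (LinearMap.range (e.scaleMap t)).mkQ
  let u : e.E.obj × (vacuumF l).obj := (v, 0)
  have hz : ∀ x : Ghost, x • v = 0 → x • q u = 0 := fun x h1 => by
    have : x • u = 0 := Prod.ext h1 (smul_zero x)
    rw [← map_smul, this, map_zero]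
  refine ⟨q u, hv, fun n hn hne => hz _ (hb n hn hne), fun n hn hne => hz _ (hc n hn hne), ?_⟩
  rw [← map_smul]
  -- In the pushout (i y, 0) equals (0, t y); this is applied to y = c times the generating vector.
  refine (Submodule.Quotient.eq _).2 ⟨algebraMap ℂ Ghost c • vacVec l, Prod.ext ?_ ?_⟩
  · change e.i (algebraMap ℂ Ghost c • vacVec l) = a • v - 0
    rw [ha, sub_zero]
  · change -(t • (algebraMap ℂ Ghost c • (vacVec l : (vacuumF l).obj))) =
      a • 0 - algebraMap ℂ Ghost (t * c) • vacVec l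
    rw [smul_zero, zero_sub, map_mul, mul_smul]
    rfl

/-- If e0 is non-split with scalar c0, then c0 ≠ 0, and e - (c/c0) e0 has scalar 0, hence splits. -/
theorem rank_ext_vacuum_eq_one {a : Ghost}
    (h : ∀ e : Extn (vacuumF k) (vacuumF l), ∃ c, HasInvariant a e c)
    (h0 : ∃ e : Extn (vacuumF k) (vacuumF l), Ext1.mk e ≠ 0) :
    Module.rank ℂ (Ext1 (vacuumF k) (vacuumF l)) = 1 := by
  obtain ⟨e0, he0⟩ := h0
  obtain ⟨c0, hc0⟩ := h e0
  have hne : c0 ≠ 0 := by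
    rintro rfl
    exact he0 hc0.mk_eq_zero
  refine rank_eq_one_iff.2 ⟨Ext1.mk e0, he0, fun x => ?_⟩
  obtain ⟨e⟩ := x
  obtain ⟨c, hc⟩ := h e
  refine ⟨c * c0⁻¹, ?_⟩
  have h1 := hc.baerSum (hc0.scale (-(c * c0⁻¹)))
  rw [neg_mul, inv_mul_cancel_right₀ hne, add_neg_cancel] at h1
  have h2 : Ext1.mk e + (-(c * c0⁻¹)) • Ext1.mk e0 = 0 := h1.mk_eq_zero
  rw [neg_smul, add_neg_eq_zero] at h2
  exact h2.symm

/-- A module generated by a vector `v` which is mapped by the mode `a` to a generating vector of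
`σ^l V`, and which otherwise satisfies the relations of `σ^k V`, is a non-split extension. -/
theorem exists_mk_ne_zero {E : ModuleCat.{0} Ghost} (hE : IsF E) {a a' : Ghost} {v : E}
    (hgen : ∀ x : E, ∃ b : Ghost, b • v = x) (hu : IsVac l (a • v)) (hu0 : a • v ≠ 0)
    (hb : ∀ n, -k ≤ n → beta n ≠ a → beta n • v = 0)
    (hc : ∀ n, k + 1 ≤ n → gamma n ≠ a → gamma n • v = 0) (ha : a • vacVec k = 0)
    (ha' : a' • a • v = 0) (hN : ∀ y : flow l vacuum, a' • a • y = 0 → y = 0) :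
    ∃ e : Extn (vacuumF k) (vacuumF l), Ext1.mk e ≠ 0 := by
  obtain ⟨i, hi⟩ := exists_hom_of_isVac hu
  have hinj := flow_vacuum_injective i (hi ▸ hu0)
  have hN' : ∀ y, a' • a • i y = 0 → y = 0 := fun y hy => hN y (hinj (by
    rw [map_smul, map_smul, hy, map_zero]))
  let R := LinearMap.range i
  have huR : R.mkQ (a • v) = 0 := (Submodule.Quotient.mk_eq_zero R).2 ⟨_, hi⟩
  have hv : IsVac k (R.mkQ v) := by
    refine ⟨fun n hn => ?_, fun n hn => ?_⟩
    · by_cases h : beta n = a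
      · rw [← map_smul, h, huR]
      · rw [← map_smul, hb n hn h, map_zero]
    · by_cases h : gamma n = a
      · rw [← map_smul, h, huR]
      · rw [← map_smul, hc n hn h, map_zero]
  obtain ⟨ψ', hψ'⟩ := exists_hom_of_isVac (E := ModuleCat.of Ghost (E ⧸ R)) hv
  let ψ : flow k vacuum →ₗ[Ghost] (E ⧸ R) := ψ'
  have hψ : ψ (vacVec k) = R.mkQ v := hψ'
  -- If v were zero in the quotient, then v = i y with a' a y = 0, so y = 0 and v = 0, against a v ≠
  -- 0.
  have hψinj : Function.Injective ψ := flow_vacuum_injective ψ fun h => by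
    rw [hψ] at h
    obtain ⟨y, hy⟩ := (Submodule.Quotient.mk_eq_zero R).1 h
    have h0 := hN' y (by rw [hy, ha'])
    rw [h0, map_zero] at hy
    exact hu0 (by rw [← hy, smul_zero])
  have hψsurj : Function.Surjective ψ := fun x => by
    obtain ⟨x, rfl⟩ := Submodule.mkQ_surjective R x
    obtain ⟨b, rfl⟩ := hgen x
    exact ⟨b • vacVec k, by rw [map_smul, hψ, map_smul]⟩
  let ε := LinearEquiv.ofBijective ψ ⟨hψinj, hψsurj⟩
  have hεv : ε.symm (R.mkQ v) = vacVec k := by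
    rw [← hψ]
    exact ε.symm_apply_apply (vacVec k)
  let e : Extn (vacuumF k) (vacuumF l) :=
    { E := ⟨E, hE⟩
      i := i
      p := ε.symm.toLinearMap ∘ₗ R.mkQ
      injective := hinj
      exact := fun x => by
        refine Iff.trans ?_ (Submodule.Quotient.mk_eq_zero R)
        exact ε.symm.map_eq_zero_iff
      surjective := ε.symm.surjective.comp (Submodule.mkQ_surjective R) }
  refine ⟨e, fun h => ?_⟩
  obtain ⟨φ, -, h2⟩ : Extn.Equivalent e (Extn.split _ _) := Quotient.exact h
  -- A splitting would give a lift of the generating vector killed by a. Its difference from v is i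
  -- y with a i y = -a v, so a' a y = 0, hence y = 0 and a v = 0.
  let w : (Extn.split (vacuumF k) (vacuumF l)).E.obj :=
    ((0 : (vacuumF l).obj), (vacVec k : (vacuumF k).obj))
  have hw : a • w = 0 := Prod.ext (smul_zero a) ha
  have hp : e.p (φ.symm w) = vacVec k := by
    rw [← h2, φ.apply_symm_apply]
    rfl
  obtain ⟨y, hy⟩ := (e.exact (φ.symm w - v)).1 (by
    rw [map_sub, hp]
    exact sub_eq_zero.2 hεv.symm)
  have hy' : i y = φ.symm w - v := hy
  have h3 : a • i y = -(a • v) := by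
    rw [hy', smul_sub]
    have : a • φ.symm w = 0 := by rw [← map_smul, hw, map_zero]
    exact (congrArg (· - a • v) this).trans (zero_sub _)
  have h4 := hN' y (by rw [h3, smul_neg, ha', neg_zero])
  rw [h4, map_zero, smul_zero, zero_eq_neg] at h3
  exact hu0 h3

/-! ### Weyl algebra modules inducing the non-split extensions -/

/-- The operator `p` on the twist of `ℂ[x, x⁻¹]` with quotient module `ℂ[x]`. -/
def twistedP : Module.End ℂ (ℤ →₀ ℂ) :=
  Finsupp.lsum ℂ fun n : ℤ => (if 1 ≤ n then (n : ℂ) else 1) • Finsupp.lsingle (n - 1)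

/-- The operator `q` on the twist of `ℂ[x, x⁻¹]` with quotient module `ℂ[x]`. -/
def twistedQ : Module.End ℂ (ℤ →₀ ℂ) :=
  Finsupp.lsum ℂ fun n : ℤ => (if 0 ≤ n then 1 else (n : ℂ) + 1) • Finsupp.lsingle (n + 1)

theorem twistedP_single (n : ℤ) (a : ℂ) : twistedP (Finsupp.single n a) =
    (if 1 ≤ n then (n : ℂ) else 1) • Finsupp.single (n - 1) a := by
  rw [twistedP, Finsupp.lsum_single]; rfl

theorem twistedQ_single (n : ℤ) (a : ℂ) : twistedQ (Finsupp.single n a) =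
    (if 0 ≤ n then 1 else (n : ℂ) + 1) • Finsupp.single (n + 1) a := by
  rw [twistedQ, Finsupp.lsum_single]; rfl

theorem twisted_commutator : twistedP * twistedQ - twistedQ * twistedP = 1 := by
  refine Finsupp.lhom_ext fun n a => ?_
  rw [LinearMap.sub_apply, Module.End.mul_apply, Module.End.mul_apply, twistedQ_single,
    twistedP_single, map_smul, map_smul, twistedP_single, twistedQ_single, add_sub_cancel_right,
    sub_add_cancel, smul_smul, smul_smul, ← sub_smul, Module.End.one_apply]
  rcases lt_trichotomy n 0 with h | rfl | h
  · rw [if_neg (by omega), if_neg (by omega), if_neg (by omega), if_neg (by omega)]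
    push_cast
    rw [show ((n : ℂ) + 1) * 1 - 1 * (n - 1 + 1) = 1 by ring, one_smul]
  · simp
  · rw [if_pos (by omega), if_pos (by omega), if_pos (by omega), if_pos (by omega)]
    push_cast
    rw [show 1 * ((n : ℂ) + 1) - n * 1 = 1 by ring, one_smul]

theorem finsupp_eq_top {N : Submodule ℂ (ℤ →₀ ℂ)} (m : ℤ)
    (h0 : (Finsupp.single m 1 : ℤ →₀ ℂ) ∈ N)
    (hup : ∀ n, m ≤ n → (Finsupp.single n 1 : ℤ →₀ ℂ) ∈ N →
      (Finsupp.single (n + 1) 1 : ℤ →₀ ℂ) ∈ N)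
    (hdown : ∀ n, n ≤ m → (Finsupp.single n 1 : ℤ →₀ ℂ) ∈ N →
      (Finsupp.single (n - 1) 1 : ℤ →₀ ℂ) ∈ N) : N = ⊤ := by
  have hall : ∀ n : ℤ, (Finsupp.single n 1 : ℤ →₀ ℂ) ∈ N := fun n => by
    rcases le_total m n with h | h
    · induction n, h using Int.leInduction with
      | base => exact h0
      | succ n hn ih => exact hup n hn ih
    · induction n, h using Int.leInductionDown with
      | base => exact h0
      | pred n hn ih => exact hdown n hn ih
  refine eq_top_iff.2 fun f _ => ?_
  induction f using Finsupp.induction_linear with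
  | zero => exact N.zero_mem
  | add f g hf hg => exact N.add_mem (hf Submodule.mem_top) (hg Submodule.mem_top)
  | single n a => simpa using N.smul_mem a (hall n)

theorem twisted_generator (N : Submodule ℂ (ℤ →₀ ℂ)) (h0 : Finsupp.single 0 1 ∈ N)
    (hp : ∀ v ∈ N, twistedP v ∈ N) (hq : ∀ v ∈ N, twistedQ v ∈ N) : N = ⊤ := by
  refine finsupp_eq_top 0 h0 (fun n hn h => ?_) fun n hn h => ?_
  · have := hq _ h
    rwa [twistedQ_single, if_pos hn, one_smul] at this
  · have := hp _ h
    rwa [twistedP_single, if_neg (by omega), one_smul] at this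

/-- Differentiation vanishes only on x^0, so from x^{-1} it reaches all lower exponents, while
multiplication by x reaches the higher ones. -/
theorem dense_generator (N : Submodule ℂ (ℤ →₀ ℂ)) (h0 : Finsupp.single (-1) 1 ∈ N)
    (hp : ∀ v ∈ N, denseP 0 v ∈ N) (hq : ∀ v ∈ N, denseQ v ∈ N) : N = ⊤ := by
  refine finsupp_eq_top (-1) h0 (fun n hn h => ?_) fun n hn h => ?_
  · have := hq _ h
    rwa [denseQ_single] at this
  · have hn0 : (n : ℂ) ≠ 0 := by exact_mod_cast (by omega : n ≠ 0)
    have := N.smul_mem (n : ℂ)⁻¹ (hp _ h)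
    rwa [denseP_single, zero_add, smul_smul, inv_mul_cancel₀ hn0, one_smul] at this

theorem vec_one_ne_zero {V : Type} [AddCommGroup V] [Module ℂ V] {u : V} (hu : u ≠ 0) :
    (vec 1 u : FockSpace V) ≠ 0 := fun h => by
  have h0 : (vec 1 (0 : V) : FockSpace V) = 0 := TensorProduct.tmul_zero _ _
  exact hu (vec_one_injective (h.trans h0.symm))

/-- Since q kills the basis vector of index -1, the negative indices span a submodule with quotient
ℂ[x], and p leads from index 0 into it. After the twist, γ_k β_{-k} = `number (-k)` has only
eigenvalues 1, 2, … on σ^{k-1} V, so it is injective there. -/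
theorem exists_nonsplit_pred (k : ℤ) :
    ∃ e : Extn (vacuumF k) (vacuumF (k - 1)), Ext1.mk e ≠ 0 := by
  let M := induced twistedP twistedQ twisted_commutator
  let v : flow k M := (vec 1 (Finsupp.single 0 1) : FockSpace (ℤ →₀ ℂ))
  have hpos := (ann_eq_zero_iff _).1 fun i =>
    induced_ann_vec twistedP twistedQ twisted_commutator i (Finsupp.single 0 1)
  have hav : beta (-k) • v = (vec 1 (-Finsupp.single (-1) 1) : FockSpace (ℤ →₀ ℂ)) := by
    refine (flow_beta k M (-k) v).trans ?_
    rw [neg_add_cancel]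
    refine (induced_beta_zero_vec _ _ _ _).trans ?_
    rw [twistedP_single, if_neg (by omega), one_smul, zero_sub]
  have hu : IsVac (k - 1) (beta (-k) • v) := by
    rw [hav]
    refine (isVac_flow (M := M) k (k - 1) _).2 ?_
    have hpos' := (ann_eq_zero_iff _).1 fun i =>
      induced_ann_vec twistedP twistedQ twisted_commutator i (-Finsupp.single (-1) 1)
    refine ⟨fun n hn => (hpos' n (by omega)).1, fun n hn => ?_⟩
    by_cases h : n = 0
    · subst h
      refine (induced_gamma_zero_vec _ _ _ _).trans ?_
      rw [map_neg, twistedQ_single, if_neg (by omega)]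
      simp only [Int.cast_neg, Int.cast_one, neg_add_cancel, zero_smul, neg_zero]
      exact TensorProduct.tmul_zero _ _
    · exact (hpos' n (by omega)).2
  refine exists_mk_ne_zero (E := flow k M) (a := beta (-k)) (a' := gamma k) (v := v) ?_ ?_ hu ?_
    (fun n hn hne => ?_) (fun n hn _ => ?_) ((vacVec_isVac k).1 _ le_rfl) (hu.2 k (by omega))
    (fun y hy => ?_)
  · refine isF_flow_induced _ _ _ (Finsupp.single 0 1) twisted_generator 0 rfl ?_ k
    rw [twistedP_single, if_neg (by omega), one_smul, twistedQ_single, if_neg (by omega)]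
    simp
  · exact fun x => flow_generator k (induced_generator _ _ _ _ twisted_generator x)
  · rw [hav]
    exact vec_one_ne_zero (by simp)
  · have hnk : n ≠ -k := fun h => hne (by rw [h])
    exact (flow_beta k M n v).trans (hpos (n + k) (by omega)).1
  · exact (flow_gamma k M n v).trans (hpos (n - k) (by omega)).2
  · refine eq_zero_of_vacWeight_zero (n := -k) (by omega) (.of_eigen ?_)
    rw [number, neg_neg, mul_smul, hy, map_zero, zero_smul]

/-- In ℂ[x, x⁻¹], generated by x^{-1}, multiplication by x maps the generator to 1, which generates
ℂ[x]. After the twist, β_{-(k+1)} γ_{k+1} is `number (-(k+1)) - 1`, injective on σ^{k+1} V because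
the eigenvalues of the number operator there are at most 0. -/
theorem exists_nonsplit_succ (k : ℤ) :
    ∃ e : Extn (vacuumF k) (vacuumF (k + 1)), Ext1.mk e ≠ 0 := by
  let M := typical 0
  let v : flow (k + 1) M := typicalVec 0 (-1)
  have hpos := fun n => (ann_eq_zero_iff _).1 (isVacuumVector_typicalVec 0 n).1
  have hav : gamma (k + 1) • v = typicalVec 0 0 := by
    refine (flow_gamma (k + 1) M (k + 1) v).trans ?_
    rw [sub_self]
    refine (induced_gamma_zero_vec _ _ _ _).trans ?_
    rw [denseQ_single]
    rfl
  have hu : IsVac (k + 1) (gamma (k + 1) • v) := by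
    rw [hav]
    refine (isVac_flow (M := M) (k + 1) (k + 1) _).2 ?_
    rw [sub_self, isVac_zero_iff]
    refine ⟨?_, (isVacuumVector_typicalVec 0 0).1⟩
    refine (induced_beta_zero_vec _ _ _ _).trans ?_
    rw [denseP_single]
    simp only [Int.cast_zero, add_zero, zero_smul, neg_zero]
    exact TensorProduct.tmul_zero _ _
  refine exists_mk_ne_zero (E := flow (k + 1) M) (a := gamma (k + 1)) (a' := beta (-(k + 1)))
    (v := v) ?_ ?_ hu ?_ (fun n hn _ => ?_) (fun n hn hne => ?_) ((vacVec_isVac k).2 _ le_rfl)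
    (hu.1 _ le_rfl) (fun y hy => ?_)
  · refine isF_flow_induced _ _ _ (Finsupp.single (-1) 1) dense_generator 1 (by simp) ?_ (k + 1)
    rw [denseP_single, map_smul, denseQ_single]
    simp
  · exact fun x => flow_generator (k + 1) (induced_generator _ _ _ _ dense_generator x)
  · rw [hav]
    exact typicalVec_ne_zero 0 0
  · exact (flow_beta (k + 1) M n v).trans (hpos (-1) (n + (k + 1)) (by omega)).1
  · have hnk : n ≠ k + 1 := fun h => hne (by rw [h])
    exact (flow_gamma (k + 1) M n v).trans (hpos (-1) (n - (k + 1)) (by omega)).2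
  · refine eq_zero_of_vacWeight_one (n := -(k + 1)) le_rfl (.of_eigen ?_)
    have h1 := beta_mul_gamma_neg (-(k + 1))
    rw [neg_neg, eq_sub_iff_add_eq] at h1
    rw [← h1, add_smul, mul_smul, hy, zero_add, map_one]

/-! ### Dimensions for neighbouring spectral flows -/

theorem rank_ext_vacuum_pred (k : ℤ) :
    Module.rank ℂ (Ext1 (vacuumF k) (vacuumF (k - 1))) = 1 := by
  refine rank_ext_vacuum_eq_one (a := beta (-k)) (fun e => ?_) (exists_nonsplit_pred k)
  obtain ⟨v, hv, hb, hc⟩ := exists_good_lift e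
  obtain ⟨y, hy, hgen⟩ := hb (-k) le_rfl
  have hvac : IsVac (k - 1) y := isVac_of_isGenEigen fun n => by
    have := hgen n
    -- Raising the weight at -k from 0 to 1 gives exactly the weights of the generating vector of
    -- σ^{k-1} V, so y is a multiple of it.
    have hw : vacWeight k n + (if n = -k then 1 else 0) = vacWeight (k - 1) n := by
      rw [vacWeight, vacWeight]
      rcases lt_trichotomy n (-k) with h | h | h
      · rw [if_neg (by omega), if_neg (by omega), if_neg (by omega), add_zero]
      · rw [if_pos (by omega), if_pos h, if_neg (by omega), zero_add]
      · rw [if_pos (by omega), if_neg (by omega), if_pos (by omega), add_zero]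
    rwa [hw] at this
  obtain ⟨c, hc'⟩ := flow_vacuum_eq_of_isVac hvac
  refine ⟨c, v, hv, fun n hn hne => ?_, fun n hn _ => ?_, ?_⟩
  · obtain ⟨z, hz, hzgen⟩ := hb n hn
    rw [hz, beta_weight_eq_zero hn (fun h => hne (by rw [h.2])) hzgen]
    exact map_zero e.i
  · obtain ⟨z, hz, hzgen⟩ := hc n hn
    rw [hz, gamma_weight_eq_zero hn (fun h => by omega) hzgen]
    exact map_zero e.i
  · rw [hy, hc']

theorem rank_ext_vacuum_succ (k : ℤ) :
    Module.rank ℂ (Ext1 (vacuumF k) (vacuumF (k + 1))) = 1 := by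
  refine rank_ext_vacuum_eq_one (a := gamma (k + 1)) (fun e => ?_) (exists_nonsplit_succ k)
  obtain ⟨v, hv, hb, hc⟩ := exists_good_lift e
  obtain ⟨y, hy, hgen⟩ := hc (k + 1) le_rfl
  have hvac : IsVac (k + 1) y := isVac_of_isGenEigen fun n => by
    have := hgen n
    -- Lowering the weight at -(k + 1) from 1 to 0 gives the weights of the generating vector of
    -- σ^{k+1} V.
    have hw : vacWeight k n + (if n = -(k + 1) then -1 else 0) = vacWeight (k + 1) n := by
      rw [vacWeight, vacWeight]
      rcases lt_trichotomy n (-(k + 1)) with h | h | h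
      · rw [if_neg (by omega), if_neg (by omega), if_neg (by omega), add_zero]
      · rw [if_neg (by omega), if_pos h, if_pos (by omega), add_neg_cancel]
      · rw [if_pos (by omega), if_neg (by omega), if_pos (by omega), add_zero]
    rwa [hw] at this
  obtain ⟨c, hc'⟩ := flow_vacuum_eq_of_isVac hvac
  refine ⟨c, v, hv, fun n hn _ => ?_, fun n hn hne => ?_, ?_⟩
  · obtain ⟨z, hz, hzgen⟩ := hb n hn
    rw [hz, beta_weight_eq_zero hn (fun h => by omega) hzgen]
    exact map_zero e.i
  · obtain ⟨z, hz, hzgen⟩ := hc n hn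
    rw [hz, gamma_weight_eq_zero hn (fun h => hne (by rw [h.2])) hzgen]
    exact map_zero e.i
  · rw [hy, hc']

theorem rank_ext_vacuum (k l : ℤ) : Module.rank ℂ (Ext1 (vacuumF k) (vacuumF l)) =
    if |k - l| = 1 then 1 else 0 := by
  split_ifs with h
  · rcases (abs_eq zero_le_one).1 h with h1 | h1
    · obtain rfl : l = k - 1 := by omega
      exact rank_ext_vacuum_pred k
    · obtain rfl : l = k + 1 := by omega
      exact rank_ext_vacuum_succ k
  · exact rank_ext_vacuum_eq_zero h

end VacExt

end

end BosonicGhost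

theorem mainTheorem8 :
    (∀ k l : ℤ, Module.rank ℂ
        (BosonicGhost.Ext1 (BosonicGhost.vacuumF k) (BosonicGhost.vacuumF l)) =
      if |k - l| = 1 then 1 else 0) ∧
    (∀ (μ : ℝ) (hμ : ∀ n : ℤ, μ ≠ n) (k : ℤ) (M : BosonicGhost.CatF),
      Module.rank ℂ (BosonicGhost.Ext1 (BosonicGhost.typicalF μ hμ k) M) = 0 ∧
      Module.rank ℂ (BosonicGhost.Ext1 M (BosonicGhost.typicalF μ hμ k)) = 0) ∧
    (∀ (μ : ℝ) (hμ : ∀ n : ℤ, μ ≠ n) (k : ℤ),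
      CategoryTheory.Projective (BosonicGhost.typicalF μ hμ k) ∧
      CategoryTheory.Injective (BosonicGhost.typicalF μ hμ k)) :=
  ⟨BosonicGhost.rank_ext_vacuum,
    fun μ hμ k M => ⟨BosonicGhost.rank_ext_typical μ hμ k M,
      BosonicGhost.rank_ext_typical' μ hμ k M⟩,
    fun μ hμ k => ⟨BosonicGhost.projective_typicalF μ hμ k,
      BosonicGhost.injective_typicalF μ hμ k⟩⟩
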